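/- Let $F$ be a non-archimedean local field (of any characteristic and any residue characteristic), with ring of integers $\mathcal O$, maximal ideal $\mathcal P$, residue field of cardinality $q$ and normalized valuation $\mathrm{val}$. Put $G=\mathrm{GL}(2,F)$ and $\mathfrak g=M_2(F)$, with $G$ acting on $\mathfrak g$ by conjugation. Let $\mathcal N\subset\mathfrak g$ be the set of nilpotent matrices and $\mathcal O(0)$ the (finite) set of $G$-orbits in $\mathcal N$. Let $\mathcal B$ be the reduced Bruhat–Tits building of $G$, i.e. the set of homothety classes of norms on $F^2$; for $x\in\mathcal B$ (represented by a norm $\alpha$) and $r\in\mathbb R$ let $\mathfrak g_{x,r}=\{Y:\alpha(Yv)\le q^{-r}\alpha(v)\ \forall v\in F^2\}$ be the Moy–Prasad lattice, $\mathfrak g_{x,r^+}=\bigcup_{s>r}\mathfrak g_{x,s}$ and $\mathfrak g_{r^+}=\bigcup_{x}\mathfrak g_{x,r^+}$; for $r\ge 0$ put $G_{x,r^+}=1+\mathfrak g_{x,r^+}$. Let $\mathcal S(\mathfrak g)$ be the space of locally constant compactly supported functions $\mathfrak g\to\mathbb C$, $J(\mathfrak g)$ the space of $G$-invariant linear functionals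 on $\mathcal S(\mathfrak g)$, and $J(\mathcal N)\subset J(\mathfrak g)$ the subspace of those supported in $\mathcal N$. For $r\in\mathbb R$ let $D_{r^+}=\sum_{x\in\mathcal B}C_c(\mathfrak g/\mathfrak g_{x,r^+})$, where $C_c(\mathfrak g/L)\subset\mathcal S(\mathfrak g)$ consists of the functions invariant under translation by $L$, and let $\tilde J_{r^+}$ be the space of all $T\in J(\mathfrak g)$ such that, for all $x\in\mathcal B$ and all $s\le r$, $T(f)=0$ whenever $f\in\mathcal S(\mathfrak g)$ is supported in $\mathfrak g_{x,s}$, is invariant under translation by $\mathfrak g_{x,r^+}$, and satisfies $\mathrm{supp}(f)\cap\mathfrak g_{s^+}=\emptyset$. (1) For every $r\in\tfrac12\mathbb Z$, $$\mathrm{res}_{D_{r^+}}\tilde J_{r^+}=\mathrm{res}_{D_{r^+}}J(\mathcal N).$$ (2) Fix Haar measures on $\mathfrak g$ and $G$ and an additive character $\Lambda:F\to S^1$ trivial on $\mathcal P$ and not trivial on $\mathcal O$, and put $\hat f(X)=\int_{\mathfrak g}f(Y)\Lambda(\mathrm{tr}(XY))\,dY$. Every nilpotent orbit $\mathfrak o\in\mathcal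 O(0)$ carries a nonzero $G$-invariant measure $\mu_{\mathfrak o}$ that is finite on compact subsets of $\mathfrak g$; fix one for each $\mathfrak o$. Near each regular semisimple $X$ (one with distinct eigenvalues in an algebraic closure) the distribution $f\mapsto\int\hat f\,d\mu_{\mathfrak o}$ is represented by a constant function, whose value is denoted $\hat\mu_{\mathfrak o}(X)$. Let $(\pi,V)$ be an irreducible smooth complex representation of $G$, and let its depth $\rho(\pi)$ be the smallest real $\rho\ge0$ such that $V$ has a nonzero vector fixed by $G_{x,\rho^+}$ for some $x\in\mathcal B$. Then there are complex constants $c_{\mathfrak o}(\pi)$, $\mathfrak o\in\mathcal O(0)$, such that for every regular semisimple $X\in\mathfrak g_{\rho(\pi)^+}$ the matrix $1+X$ is invertible, the distribution $f\mapsto\mathrm{tr}\,\pi(f)$ on $G$ is represented near $1+X$ by a constant function, whose value is denoted $\chi_\pi(1+X)$, and $$\chi_\pi(1+X)=\sum_{\mathfrak o\in\mathcal O(0)}c_{\mathfrak o}(\pi)\,\hat\mu_{\mathfrak o}(X).$$ -/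

import Mathlib

open MeasureTheory Topology ValuativeRel
open scoped Matrix

noncomputable section

namespace GLTwo

/-- Schwartz–Bruhat functions: locally constant complex functions with compact support. -/
def schwartz (Y : Type*) [TopologicalSpace Y] : Submodule ℂ (Y → ℂ) where
  carrier := {f | IsLocallyConstant f ∧ HasCompactSupport f}
  zero_mem' := ⟨IsLocallyConstant.const 0, HasCompactSupport.zero⟩
  add_mem' := fun hf hg => ⟨hf.1.add hg.1, hf.2.add hg.2⟩
  smul_mem' := fun c _ hf => ⟨hf.1.comp (fun z => c * z), hf.2.mul_left⟩

/-- `T` is given near `y` by the constant `c` times the measure `m`. For a functional that is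
represented on some open set by a locally constant function `φ`, this says `c = φ y`. -/
def HasValueAt {Y : Type*} [TopologicalSpace Y] [MeasurableSpace Y] (m : Measure Y)
    (T : schwartz Y → ℂ) (y : Y) (c : ℂ) : Prop :=
  ∃ U ∈ 𝓝 y, ∀ f : schwartz Y, Function.support (f : Y → ℂ) ⊆ U →
    T f = c * ∫ z, (f : Y → ℂ) z ∂m

open Classical in
/-- The value at `y` of the locally constant function that represents `T` near `y`
(and `0` if there is none). -/
def valueAt {Y : Type*} [TopologicalSpace Y] [MeasurableSpace Y] (m : Measure Y)
    (T : schwartz Y → ℂ) (y : Y) : ℂ :=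
  if h : ∃ c, HasValueAt m T y c then h.choose else 0

section LocalField

variable (F : Type*) [Field F]

/-- The group `GL(2,F)`. -/
abbrev G := GL (Fin 2) F

/-- The Lie algebra of `GL(2,F)`. -/
abbrev g := Matrix (Fin 2) (Fin 2) F

variable {F}

/-- The adjoint action of `GL(2,F)` on its Lie algebra. -/
def Ad (x : G F) (X : g F) : g F := (x : g F) * X * ((x⁻¹ : G F) : g F)

/-- `X` has distinct eigenvalues in an algebraic closure. -/
def IsRegSemisimple (X : g F) : Prop := X.charpoly.Separable

variable (F)

/-- The nilpotent cone. -/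
def nilCone : Set (g F) := {X | IsNilpotent X}

/-- The set of nilpotent `GL(2,F)`-orbits. -/
def NilOrbit : Type _ :=
  {O : Set (g F) // ∃ X ∈ nilCone F, O = Set.range (fun x : G F => Ad x X)}

variable [ValuativeRel F] [TopologicalSpace F] [IsNonarchimedeanLocalField F]

/-- The cardinality of the residue field. -/
def q : ℝ := (Nat.card 𝓀[F] : ℝ)

variable {F}

/-- The normalized valuation `F^× → ℤ` (with value `0` at `0`). -/
def val (a : F) : ℤ :=
  - WithZero.log (IsNonarchimedeanLocalField.valueGroupWithZeroIsoInt F (valuation F a))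

open Classical in
/-- The normalized absolute value `q ^ (- val a)`. -/
def nabs (a : F) : ℝ := if a = 0 then 0 else q F ^ (- val a)

variable (F)

/-- A (split) norm on `F²`. -/
structure SplitNorm where
  toFun : (Fin 2 → F) → ℝ
  split : ∃ (b : Module.Basis (Fin 2) F (Fin 2 → F)) (w : Fin 2 → ℝ), (∀ i, 0 < w i) ∧
    ∀ v, toFun v = max (nabs (b.repr v 0) * w 0) (nabs (b.repr v 1) * w 1)

/-- Homothety of norms. -/
instance SplitNorm.setoid : Setoid (SplitNorm F) where
  r α β := ∃ c : ℝ, 0 < c ∧ ∀ v, β.toFun v = c * α.toFun v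
  iseqv :=
    { refl := fun _ => ⟨1, one_pos, fun _ => (one_mul _).symm⟩
      symm := by
        rintro α β ⟨c, hc, h⟩
        exact ⟨c⁻¹, inv_pos.2 hc, fun v => by rw [h, inv_mul_cancel_left₀ hc.ne']⟩
      trans := by
        rintro α β γ ⟨c, hc, h⟩ ⟨d, hd, h'⟩
        exact ⟨d * c, mul_pos hd hc, fun v => by rw [h', h, mul_assoc]⟩ }

/-- The reduced Bruhat–Tits building of `GL(2,F)`, realized as the set of homothety classes of
norms on `F²`. -/
def Building : Type _ := Quotient (SplitNorm.setoid F)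

variable {F}

/-- The Moy–Prasad lattice `g_{x,r}`: the endomorphisms that raise the (additive) norm `x`
by at least `r`. -/
def lat (x : Building F) (r : ℝ) : Set (g F) :=
  Quotient.lift
    (fun α : SplitNorm F => {Y : g F | ∀ v, α.toFun (Y *ᵥ v) ≤ q F ^ (-r) * α.toFun v})
    (by
      rintro α β ⟨c, hc, h⟩
      ext Y
      refine forall_congr' fun v => ?_
      rw [h, h, mul_left_comm, mul_le_mul_iff_right₀ hc]) x

/-- The lattice `g_{x,r^+}`. -/
def latPlus (x : Building F) (r : ℝ) : Set (g F) := ⋃ s > r, lat x s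

/-- The group `G_{x,r^+} = 1 + g_{x,r^+}`, for `r ≥ 0`. -/
def grpPlus (x : Building F) (r : ℝ) : Set (G F) := {γ | (γ : g F) - 1 ∈ latPlus x r}

variable (F)

/-- The set `g_{r^+}`. -/
def gPlus (r : ℝ) : Set (g F) := ⋃ x : Building F, latPlus x r

/-- The invariant distributions on the Lie algebra. -/
def invDist : Submodule ℂ (Module.Dual ℂ (schwartz (g F))) where
  carrier := {T | ∀ (x : G F) (f f' : schwartz (g F)),
    (∀ X, (f' : g F → ℂ) X = (f : g F → ℂ) (Ad x X)) → T f' = T f}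
  zero_mem' := fun _ _ _ _ => rfl
  add_mem' := fun hS hT x f f' h => congrArg₂ (· + ·) (hS x f f' h) (hT x f f' h)
  smul_mem' := fun c _ hT x f f' h => congrArg (c • ·) (hT x f f' h)

/-- The distributions that vanish on every `f` in `A`. -/
def vanishOn (A : Set (schwartz (g F))) : Submodule ℂ (Module.Dual ℂ (schwartz (g F))) where
  carrier := {T | ∀ f ∈ A, T f = 0}
  zero_mem' := fun _ _ => rfl
  add_mem' := fun hS hT f hf => by
    rw [LinearMap.add_apply, hS f hf, hT f hf, add_zero]
  smul_mem' := fun c _ hT f hf => by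
    rw [LinearMap.smul_apply, hT f hf, smul_zero]

/-- `J(ω)`: the invariant distributions with support in the closed set `ω`. -/
def invDistOn (ω : Set (g F)) : Submodule ℂ (Module.Dual ℂ (schwartz (g F))) :=
  invDist F ⊓ vanishOn F {f | Disjoint ω (Function.support (f : g F → ℂ))}

variable {F}

/-- `C_c(g/L)`, the functions in `S(g)` that are invariant under translation by `L`. -/
def transInv (L : Set (g F)) : Submodule ℂ (schwartz (g F)) where
  carrier := {f | ∀ X, ∀ Y ∈ L, (f : g F → ℂ) (X + Y) = (f : g F → ℂ) X}
  zero_mem' := fun _ _ _ => rfl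
  add_mem' := fun hf hf' X Y hY => congrArg₂ (· + ·) (hf X Y hY) (hf' X Y hY)
  smul_mem' := fun c _ hf X Y hY => congrArg (c • ·) (hf X Y hY)

/-- `C(L/L')`, the functions in `S(g)` supported in `L` and invariant under `L'`. -/
def latFun (L L' : Set (g F)) : Set (schwartz (g F)) :=
  {f | f ∈ transInv L' ∧ Function.support (f : g F → ℂ) ⊆ L}

variable (F)

/-- The space `D_{r^+}`, the sum over the building of the spaces `C_c(g/g_{x,r^+})`. -/
def DPlus (r : ℝ) : Submodule ℂ (schwartz (g F)) := ⨆ x : Building F, transInv (latPlus x r)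

variable {F}

/-- The space `J̃_{x,s,r^+}`. -/
def JTildeAt (x : Building F) (s r : ℝ) : Submodule ℂ (Module.Dual ℂ (schwartz (g F))) :=
  invDist F ⊓ vanishOn F {f | f ∈ latFun (lat x s) (latPlus x r) ∧
    Disjoint (gPlus F s) (Function.support (f : g F → ℂ))}

variable (F)

/-- The space `J̃_{r^+}`. -/
def JTilde (r : ℝ) : Submodule ℂ (Module.Dual ℂ (schwartz (g F))) :=
  ⨅ (x : Building F) (s : ℝ) (_ : s ≤ r), JTildeAt x s r

variable {F}

section Fourier

variable [MeasurableSpace (g F)]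

/-- The Fourier transform on the Lie algebra. -/
def fourier (dY : Measure (g F)) (Λ : AddChar F Circle) (f : g F → ℂ) (X : g F) : ℂ :=
  ∫ Y, f Y * (Λ (X * Y).trace : ℂ) ∂dY

/-- `μ` is an orbital integral on the orbit `O`: a nonzero invariant measure carried by `O`
for which compact subsets of the Lie algebra have finite measure. -/
structure IsOrbitalMeasure (O : NilOrbit F) (μ : Measure (g F)) : Prop where
  ne_zero : μ ≠ 0
  carried : μ (O.1)ᶜ = 0
  invariant : ∀ x : G F, μ.map (Ad x) = μ
  finite : ∀ K : Set (g F), IsCompact K → μ K < ⊤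

/-- The Fourier transform of the distribution `f ↦ ∫ f dμ`. -/
def fourierDist (dY : Measure (g F)) (Λ : AddChar F Circle) (μ : Measure (g F)) :
    schwartz (g F) → ℂ :=
  fun f => ∫ X, fourier dY Λ (f : g F → ℂ) X ∂μ

/-- The function that represents the Fourier transform of `f ↦ ∫ f dμ`. -/
def fourierFun (dY : Measure (g F)) (Λ : AddChar F Circle) (μ : Measure (g F)) (X : g F) : ℂ :=
  valueAt dY (fourierDist dY Λ μ) X

end Fourier

section Representations

variable {V : Type*} [AddCommGroup V] [Module ℂ V]

/-- Every vector is fixed by a neighbourhood of the identity. -/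
def IsSmooth (π : Representation ℂ (G F) V) : Prop :=
  ∀ v : V, ∀ᶠ x in 𝓝 (1 : G F), π x v = v

/-- The depth of `π`: the smallest `ρ ≥ 0` such that `π` has a nonzero vector fixed by
`G_{x,ρ^+}` for some `x` in the building. -/
def depth (π : Representation ℂ (G F) V) : ℝ :=
  sInf {ρ : ℝ | 0 ≤ ρ ∧ ∃ x : Building F, ∃ v : V, v ≠ 0 ∧ ∀ γ ∈ grpPlus x ρ, π γ v = v}

variable [MeasurableSpace (G F)]

/-- `A` is the operator `π(f dγ) = ∫ f(γ) π(γ) dγ`. -/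
def IsHeckeOperator (π : Representation ℂ (G F) V) (dγ : Measure (G F)) (f : G F → ℂ)
    (A : V →ₗ[ℂ] V) : Prop :=
  ∀ (v : V) (l : Module.Dual ℂ V), l (A v) = ∫ γ, f γ * l (π γ v) ∂dγ

/-- For smooth `π` and `f` in `S(G)` the operator `π(f dγ)` exists. -/
theorem exists_isHeckeOperator [BorelSpace (G F)] (π : Representation ℂ (G F) V)
    (hπ : IsSmooth π) (dγ : Measure (G F)) [IsFiniteMeasureOnCompacts dγ]
    (f : schwartz (G F)) : ∃ A, IsHeckeOperator π dγ (f : G F → ℂ) A := by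
  have hlc : ∀ v : V, IsLocallyConstant fun γ : G F => π γ v := by
    intro v
    rw [IsLocallyConstant.iff_eventually_eq]
    intro γ
    have h1 : Filter.Tendsto (fun y : G F => γ⁻¹ * y) (𝓝 γ) (𝓝 1) := by
      have := (continuous_const_mul (γ⁻¹ : G F)).tendsto γ
      rwa [inv_mul_cancel] at this
    filter_upwards [h1.eventually (hπ v)] with y hy
    have h2 : π γ (π (γ⁻¹ * y) v) = π γ v := by rw [hy]
    rwa [← Module.End.mul_apply, ← map_mul, mul_inv_cancel_left] at h2
  have hF : ∀ v : V, IsLocallyConstant fun γ : G F => (f : G F → ℂ) γ • π γ v := fun v =>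
    (f.2.1.prodMk (hlc v)).comp (fun p : ℂ × V => p.1 • p.2)
  have hint : ∀ (v : V) (l : Module.Dual ℂ V),
      Integrable (fun γ => (f : G F → ℂ) γ * l (π γ v)) dγ := by
    intro v l
    refine Continuous.integrable_of_hasCompactSupport ?_ f.2.2.mul_right
    exact (f.2.1.mul ((hlc v).comp l)).continuous
  have hex : ∀ v : V, ∃ w : V, ∀ l : Module.Dual ℂ V,
      l w = ∫ γ, (f : G F → ℂ) γ * l (π γ v) ∂dγ := by
    intro v
    set H : G F → V := fun γ => (f : G F → ℂ) γ • π γ v with hH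
    have hsupp : Function.support H ⊆ tsupport (f : G F → ℂ) := by
      intro γ hγ
      refine subset_tsupport _ fun h0 => hγ ?_
      simp [hH, h0]
    have hfin : (H '' tsupport (f : G F → ℂ)).Finite := by
      let : TopologicalSpace V := ⊥
      have : DiscreteTopology V := ⟨rfl⟩
      exact (f.2.2.image (hF v).continuous).finite_of_discrete
    refine ⟨∑ w ∈ hfin.toFinset, ((dγ.real (H ⁻¹' {w} ∩ tsupport (f : G F → ℂ)) : ℂ)) • w,
      fun l => ?_⟩
    have hK : MeasurableSet (tsupport (f : G F → ℂ)) := (isClosed_tsupport _).measurableSet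
    have hm : ∀ w, MeasurableSet (H ⁻¹' {w} ∩ tsupport (f : G F → ℂ)) := fun w =>
      ((hF v).isOpen_fiber w).measurableSet.inter hK
    have hpt : ∀ γ, (f : G F → ℂ) γ * l (π γ v) = ∑ w ∈ hfin.toFinset,
        (H ⁻¹' {w} ∩ tsupport (f : G F → ℂ)).indicator (fun _ => l w) γ := by
      intro γ
      have hl : (f : G F → ℂ) γ * l (π γ v) = l (H γ) := by simp [hH]
      rw [hl]
      by_cases hγ : γ ∈ tsupport (f : G F → ℂ)
      · rw [Finset.sum_eq_single (H γ)]
        · rw [Set.indicator_of_mem (show γ ∈ H ⁻¹' {H γ} ∩ tsupport (f : G F → ℂ) from ⟨rfl, hγ⟩)]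
        · intro w _ hw
          exact Set.indicator_of_notMem (fun h => hw h.1.symm) _
        · intro h
          exact absurd (hfin.mem_toFinset.2 ⟨γ, hγ, rfl⟩) h
      · have h0 : H γ = 0 := by
          by_contra h
          exact hγ (hsupp h)
        rw [h0, map_zero, Finset.sum_eq_zero]
        intro w _
        exact Set.indicator_of_notMem (fun h => hγ h.2) _
    have hlt : ∀ w, dγ (H ⁻¹' {w} ∩ tsupport (f : G F → ℂ)) < ⊤ := fun w =>
      (measure_mono Set.inter_subset_right).trans_lt f.2.2.measure_lt_top
    simp_rw [hpt]
    rw [integral_finsetSum, map_sum]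
    · refine Finset.sum_congr rfl fun w _ => ?_
      rw [integral_indicator_const _ (hm w), map_smul, smul_eq_mul, Complex.real_smul]
    · intro w _
      exact (integrable_indicator_iff (hm w)).2 (integrableOn_const (hlt w).ne)
  choose A hA using hex
  have hsep : ∀ a b : V, (∀ l : Module.Dual ℂ V, l a = l b) → a = b := fun a b h => by
    rw [← sub_eq_zero, ← Module.forall_dual_apply_eq_zero_iff ℂ]
    intro l
    rw [map_sub, h l, sub_self]
  refine ⟨{ toFun := A, map_add' := ?_, map_smul' := ?_ }, fun v l => hA v l⟩
  · intro v v'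
    refine hsep _ _ fun l => ?_
    rw [map_add, hA, hA, hA, ← integral_add (hint v l) (hint v' l)]
    simp only [map_add, mul_add]
  · intro c v
    refine hsep _ _ fun l => ?_
    rw [RingHom.id_apply, map_smul, hA, hA, smul_eq_mul, ← integral_const_mul]
    refine integral_congr_ae (Filter.Eventually.of_forall fun γ => ?_)
    simp only [map_smul, smul_eq_mul]
    ring

open Classical in
/-- The operator `π(f dγ)`; see `exists_isHeckeOperator` for its existence. -/
def heckeOperator (π : Representation ℂ (G F) V) (dγ : Measure (G F)) (f : G F → ℂ) :
    V →ₗ[ℂ] V :=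
  if h : ∃ A, IsHeckeOperator π dγ f A then h.choose else 0

/-- The trace of an operator of finite rank. -/
def finiteRankTrace (A : V →ₗ[ℂ] V) : ℂ :=
  LinearMap.trace ℂ (LinearMap.range A) (A.rangeRestrict ∘ₗ (LinearMap.range A).subtype)

/-- The distribution character `f ↦ tr π(f dγ)`. -/
def charDist (π : Representation ℂ (G F) V) (dγ : Measure (G F)) : schwartz (G F) → ℂ :=
  fun f => finiteRankTrace (heckeOperator π dγ (f : G F → ℂ))

/-- The character of `π` as a function: the value at `γ` of the locally constant function that
represents the distribution character near `γ`. -/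
def character (π : Representation ℂ (G F) V) (dγ : Measure (G F)) (γ : G F) : ℂ :=
  valueAt dγ (charDist π dγ) γ

end Representations

end LocalField

end GLTwo

end

open GLTwo

/-! Homogeneity. Nilpotent matrices lie in every g_{s+}, so J(N) is contained in `JTilde`. For the
converse, each g_{x,(n/2)+} contains a conjugate of one fixed lattice L = `stdLat F n`
(`exists_stdLat_subset_lat`), so an invariant T is determined on `DPlus F (n / 2)` by its values on
the indicators of cosets X + L. If, seen from some x, such a coset misses g_{s+}, then T kills it.
Otherwise X is nilpotent to leading order, and an element stabilizing L conjugates it to a companion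
matrix with dominant upper right entry. Conjugation by diag(1 + z, 1) shows that T takes equal
values on all cosets of L that fill a coset of a lattice enlarged in the upper right direction, and
conjugation by diag(ϖ, 1) brings the enlarged coset closer to 0. This descent
(`apply_cosetInd_ball_eq_zero` at a vertex, `apply_cosetInd_iwahori_eq_zero` at the midpoint of an
edge) leaves only two values: on L and on E + L for one nonzero nilpotent E. There are two nilpotent
orbits, and their orbital integrals are independent on these two functions
(`exists_nilpotent_expansion`). The argument never divides by 2, whence no restriction on the
characteristics.

Character expansion. Put T(f) = tr π(φ), where φ is the Fourier transform of f on the set g_{0+},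
moved to G by γ ↦ γ - 1. The depth ρ is a half-integer and is attained (`exists_depth_eq`). If r <
-ρ, then T lies in `JTilde F r` (`charFourier_mem_JTilde`): for f the indicator of c + g_{x,r+}, φ
transforms under 1 + g_{x,-s} by the character Z ↦ Λ(tr(Zc)), and a nonzero π(φ) forces this
character to be trivial on the intersection with a group fixing a translate of the depth vector. By
lattice duality c then lies in g_{x,s+} + g_{y,-ρ}, hence in g_{s+}. Homogeneity applied at the
half-integer r = -ρ - 1/2, followed by Fourier inversion, gives the expansion on functions supported
in g_{x,ρ+} (`exists_local_expansion`).

Three inputs make this meaningful. Irreducible smooth representations are admissible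
(`isAdmissible_of_isIrreducible`): a zero Jacquet module is handled by the Cartan decomposition, a
nonzero one by an embedding in a principal series. The Fourier transform of a nilpotent orbital
integral is constant near a regular semisimple X (`exists_hasValueAt_fourierDist`), because X has a
commutator of controlled size with each nilpotent matrix, so oscillation kills the contribution from
infinity. Finally, γ ↦ γ - 1 takes Haar measure on G to a constant multiple of Haar measure near
each point of g_{0+} (`exists_integral_toG`). -/

set_option linter.unusedSectionVars false

/-! ### The absolute value and the fractional ideals of F. -/

namespace GLTwo

section Field

variable {F : Type*} [Field F] [ValuativeRel F] [TopologicalSpace F] [IsNonarchimedeanLocalField F]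

variable (F) in
theorem one_lt_q : 1 < q F := by
  unfold q
  exact_mod_cast Finite.one_lt_card (α := 𝓀[F])

variable (F) in
theorem q_pos : 0 < q F := one_pos.trans (one_lt_q F)

@[simp] theorem nabs_zero : nabs (0 : F) = 0 := if_pos rfl

theorem nabs_of_ne {a : F} (h : a ≠ 0) : nabs a = q F ^ (-val a) := if_neg h

theorem nabs_pos {a : F} (h : a ≠ 0) : 0 < nabs a := by
  rw [nabs_of_ne h]; exact zpow_pos (q_pos F) _

theorem nabs_nonneg (a : F) : 0 ≤ nabs a := by
  rcases eq_or_ne a 0 with rfl | h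
  · simp
  · exact (nabs_pos h).le

@[simp] theorem nabs_eq_zero {a : F} : nabs a = 0 ↔ a = 0 :=
  ⟨fun h => by_contra fun h' => (nabs_pos h').ne' h, fun h => by simp [h]⟩

theorem iso_ne_zero {a : F} (h : a ≠ 0) :
    IsNonarchimedeanLocalField.valueGroupWithZeroIsoInt F (valuation F a) ≠ 0 := by
  simpa using h

theorem nabs_le_nabs {a b : F} : nabs a ≤ nabs b ↔ valuation F a ≤ valuation F b := by
  rcases eq_or_ne a 0 with rfl | ha
  · simp [nabs_nonneg]
  rcases eq_or_ne b 0 with rfl | hb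
  · simp only [nabs_zero, map_zero, le_zero_iff, map_eq_zero]
    exact ⟨fun h => absurd h (not_le.2 (nabs_pos ha)), fun h => absurd h ha⟩
  rw [nabs_of_ne ha, nabs_of_ne hb, zpow_le_zpow_iff_right₀ (one_lt_q F)]
  unfold val
  rw [neg_neg, neg_neg, WithZero.log_le_log (iso_ne_zero ha) (iso_ne_zero hb)]
  exact map_le_map_iff _

theorem nabs_mul (a b : F) : nabs (a * b) = nabs a * nabs b := by
  rcases eq_or_ne a 0 with rfl | ha
  · simp
  rcases eq_or_ne b 0 with rfl | hb
  · simp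
  rw [nabs_of_ne ha, nabs_of_ne hb, nabs_of_ne (mul_ne_zero ha hb), ← zpow_add₀ (q_pos F).ne']
  unfold val
  rw [map_mul, map_mul, WithZero.log_mul (iso_ne_zero ha) (iso_ne_zero hb)]
  congr 1; ring

@[simp] theorem nabs_one : nabs (1 : F) = 1 := by
  have h := nabs_mul (1 : F) 1
  have h0 := nabs_pos (one_ne_zero (α := F))
  rw [one_mul] at h
  nlinarith

variable (F) in
/-- The normalized absolute value as a morphism of monoids with zero. -/
noncomputable def nabsHom : F →*₀ ℝ where
  toFun := nabs
  map_zero' := nabs_zero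
  map_one' := nabs_one
  map_mul' := nabs_mul

theorem nabs_inv (a : F) : nabs a⁻¹ = (nabs a)⁻¹ := map_inv₀ (nabsHom F) a

theorem nabs_zpow (a : F) (n : ℤ) : nabs (a ^ n) = nabs a ^ n := map_zpow₀ (nabsHom F) a n

theorem nabs_div (a b : F) : nabs (a / b) = nabs a / nabs b := map_div₀ (nabsHom F) a b

theorem nabs_add_le (a b : F) : nabs (a + b) ≤ max (nabs a) (nabs b) := by
  have h := (valuation F).map_add a b
  rcases le_total (valuation F a) (valuation F b) with hab | hab
  · rw [max_eq_right hab] at h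
    exact le_max_of_le_right (nabs_le_nabs.2 h)
  · rw [max_eq_left hab] at h
    exact le_max_of_le_left (nabs_le_nabs.2 h)

@[simp] theorem nabs_neg (a : F) : nabs (-a) = nabs a :=
  le_antisymm (nabs_le_nabs.2 (by simp)) (nabs_le_nabs.2 (by simp))

theorem nabs_le_one_iff {a : F} : nabs a ≤ 1 ↔ a ∈ 𝒪[F] := by
  rw [← nabs_one (F := F), nabs_le_nabs, map_one]; rfl

variable (F) in
theorem exists_uniformizer : ∃ ϖ : F, nabs ϖ = (q F)⁻¹ := by
  obtain ⟨a, ha⟩ := ValuativeRel.valuation_surjective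
    ((IsNonarchimedeanLocalField.valueGroupWithZeroIsoInt F).symm (WithZero.exp (-1 : ℤ)))
  have h0 : a ≠ 0 := by
    rintro rfl
    rw [map_zero] at ha
    have := congrArg (IsNonarchimedeanLocalField.valueGroupWithZeroIsoInt F) ha
    rw [map_zero, OrderMonoidIso.apply_symm_apply] at this
    exact WithZero.exp_ne_zero this.symm
  refine ⟨a, ?_⟩
  rw [nabs_of_ne h0]
  unfold val
  rw [ha, OrderMonoidIso.apply_symm_apply, WithZero.log_exp, neg_neg, zpow_neg_one]

variable (F) in
/-- A uniformizer. -/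
noncomputable def unif : F := (exists_uniformizer F).choose

@[simp] theorem nabs_unif : nabs (unif F) = (q F)⁻¹ := (exists_uniformizer F).choose_spec

variable (F) in
theorem unif_ne_zero : unif F ≠ 0 := by
  rw [Ne, ← nabs_eq_zero, nabs_unif, inv_eq_zero]
  exact (q_pos F).ne'

theorem nabs_unif_zpow (n : ℤ) : nabs (unif F ^ n) = q F ^ (-n) := by
  rw [nabs_zpow, nabs_unif, inv_zpow']

variable (F) in
/-- The fractional ideal of elements of valuation at least `n`. -/
def pw (n : ℤ) : AddSubgroup F where
  carrier := {a | nabs a ≤ q F ^ (-n)}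
  zero_mem' := by
    change nabs (0 : F) ≤ _
    rw [nabs_zero]; exact (zpow_pos (q_pos F) _).le
  add_mem' := fun ha hb => (nabs_add_le _ _).trans (max_le ha hb)
  neg_mem' := fun ha => (nabs_neg _).trans_le ha

theorem mem_pw {n : ℤ} {a : F} : a ∈ pw F n ↔ nabs a ≤ q F ^ (-n) := Iff.rfl

theorem mem_pw_iff_val {n : ℤ} {a : F} (h : a ≠ 0) : a ∈ pw F n ↔ n ≤ val a := by
  rw [mem_pw, nabs_of_ne h, zpow_le_zpow_iff_right₀ (one_lt_q F), neg_le_neg_iff]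

theorem pw_anti {m n : ℤ} (h : m ≤ n) : pw F n ≤ pw F m := fun _ ha =>
  ha.trans ((zpow_le_zpow_iff_right₀ (one_lt_q F)).2 (neg_le_neg h))

theorem mul_mem_pw {m n : ℤ} {a b : F} (ha : a ∈ pw F m) (hb : b ∈ pw F n) :
    a * b ∈ pw F (m + n) := by
  rw [mem_pw, nabs_mul, neg_add, zpow_add₀ (q_pos F).ne']
  exact mul_le_mul ha hb (nabs_nonneg _) (zpow_pos (q_pos F) _).le

theorem mul_mem_pw' {k m n : ℤ} {a b : F} (ha : a ∈ pw F m) (hb : b ∈ pw F n)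
    (h : k ≤ m + n := by omega) : a * b ∈ pw F k := pw_anti h (mul_mem_pw ha hb)

theorem unif_zpow_mem (n : ℤ) : unif F ^ n ∈ pw F n := (nabs_unif_zpow n).le

theorem one_mem_pw : (1 : F) ∈ pw F 0 := by simp [mem_pw]

theorem unif_zpow_mul_mem {k n : ℤ} {a : F} : unif F ^ k * a ∈ pw F n ↔ a ∈ pw F (n - k) := by
  constructor
  · intro h
    have := mul_mem_pw (unif_zpow_mem (-k)) h
    rwa [← mul_assoc, ← zpow_add₀ (unif_ne_zero F), neg_add_cancel, zpow_zero, one_mul,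
      neg_add_eq_sub] at this
  · intro h
    exact mul_mem_pw' (unif_zpow_mem k) h

/-- Throughout, `a ∉ pw F (n + 1)` is the way to say that a is nonzero of valuation at most n. -/
theorem inv_mem_pw {n : ℤ} {a : F} (h : a ∉ pw F (n + 1)) : a⁻¹ ∈ pw F (-n) := by
  have h0 : a ≠ 0 := fun h0 => h (h0 ▸ zero_mem _)
  rw [mem_pw_iff_val h0] at h
  rw [mem_pw, nabs_inv, nabs_of_ne h0, ← zpow_neg, zpow_le_zpow_iff_right₀ (one_lt_q F)]
  omega

theorem mem_pw_of_mul_mem {m n : ℤ} {a b : F} (hab : a * b ∈ pw F (m + n)) (ha : a ∉ pw F (m + 1)) :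
    b ∈ pw F n := by
  have h0 : a ≠ 0 := fun h0 => ha (h0 ▸ zero_mem _)
  have := mul_mem_pw (inv_mem_pw ha) hab
  rwa [inv_mul_cancel_left₀ h0, neg_add_cancel_left] at this

theorem exists_mem_pw (a : F) : ∃ n : ℤ, a ∈ pw F n := by
  rcases eq_or_ne a 0 with rfl | h
  · exact ⟨0, zero_mem _⟩
  · exact ⟨val a, (mem_pw_iff_val h).2 le_rfl⟩

theorem exists_notMem_pw {a : F} (h : a ≠ 0) : ∃ n : ℤ, a ∉ pw F n :=
  ⟨val a + 1, by rw [mem_pw_iff_val h]; omega⟩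

theorem mem_maximalIdeal_iff {a : F} (h : a ∈ pw F 1) : ∃ ha : a ∈ 𝒪[F], (⟨a, ha⟩ : 𝒪[F]) ∈ 𝓂[F] := by
  have h1 : nabs a < 1 := by
    refine lt_of_le_of_lt h ?_
    rw [zpow_neg_one]; exact inv_lt_one_of_one_lt₀ (one_lt_q F)
  refine ⟨nabs_le_one_iff.1 h1.le, ?_⟩
  rw [IsLocalRing.mem_maximalIdeal, mem_nonunits_iff]
  intro hu
  have h2 := (Valuation.integer.integers (valuation F)).isUnit_iff_valuation_eq_one.1 hu
  have h3 : nabs (1 : F) ≤ nabs a := nabs_le_nabs.2 (by rw [map_one]; exact h2.ge)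
  rw [nabs_one] at h3
  linarith

theorem mem_pw_zero_iff {a : F} : a ∈ pw F 0 ↔ a ∈ 𝒪[F] := by
  rw [← nabs_le_one_iff, mem_pw, neg_zero, zpow_zero]

theorem pw_eq_closedBall (n : ℤ) : (pw F n : Set F) = {x | valuation F x ≤ valuation F (unif F ^ n)} := by
  ext a
  rw [SetLike.mem_coe, mem_pw, ← nabs_unif_zpow, nabs_le_nabs]; rfl

theorem isCompact_pw (n : ℤ) : IsCompact (pw F n : Set F) := by
  rw [pw_eq_closedBall]
  exact IsNonarchimedeanLocalField.isCompact_closedBall F _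

theorem pw_mem_nhds (n : ℤ) : (pw F n : Set F) ∈ 𝓝 (0 : F) := by
  rw [(IsValuativeTopology.hasBasis_nhds_zero' F).mem_iff]
  refine ⟨valuation F (unif F ^ n), ?_, ?_⟩
  · rw [Ne, map_eq_zero]; exact zpow_ne_zero _ (unif_ne_zero F)
  · rw [pw_eq_closedBall]; exact fun x hx => show valuation F x ≤ _ from le_of_lt hx

theorem isOpen_pw (n : ℤ) : IsOpen (pw F n : Set F) :=
  AddSubgroup.isOpen_of_mem_nhds _ (pw_mem_nhds n)

theorem hasBasis_nhds_zero_pw : (𝓝 (0 : F)).HasBasis (fun _ : ℤ => True) (fun n => (pw F n : Set F)) := by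
  refine ⟨fun s => ⟨fun hs => ?_, fun ⟨n, _, h⟩ => Filter.mem_of_superset (pw_mem_nhds n) h⟩⟩
  obtain ⟨γ, hγ, h⟩ := (IsValuativeTopology.hasBasis_nhds_zero' F).mem_iff.1 hs
  obtain ⟨a, rfl⟩ := ValuativeRel.valuation_surjective γ
  have ha : a ≠ 0 := by simpa using hγ
  obtain ⟨n, hn⟩ := exists_notMem_pw ha
  refine ⟨n, trivial, fun x hx => h ?_⟩
  change valuation F x < valuation F a
  rw [lt_iff_not_ge, ← nabs_le_nabs]
  intro hxa
  exact hn (hxa.trans hx)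

theorem isClosed_pw (n : ℤ) : IsClosed (pw F n : Set F) :=
  AddSubgroup.isClosed_of_isOpen _ (isOpen_pw n)

instance : T2Space F := by
  have : T1Space F := by
    refine IsTopologicalAddGroup.t1Space F ?_
    rw [← isOpen_compl_iff, isOpen_iff_mem_nhds]
    intro a ha
    obtain ⟨n, hn⟩ := exists_notMem_pw (F := F) ha
    have : (fun x => a + x) '' (pw F n : Set F) ∈ 𝓝 a := by
      have h := (Homeomorph.addLeft a).isOpenMap.image_mem_nhds (pw_mem_nhds (F := F) n)
      simpa using h
    refine Filter.mem_of_superset this ?_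
    rintro _ ⟨x, hx, rfl⟩ h0
    refine hn ?_
    have : a = -x := eq_neg_of_add_eq_zero_left h0
    rw [this]; exact neg_mem hx
  infer_instance

instance : SigmaCompactSpace F := by
  refine ⟨⟨fun n : ℕ => (pw F (-n) : Set F), fun n => isCompact_pw _, ?_⟩⟩
  rw [Set.eq_univ_iff_forall]
  intro a
  obtain ⟨n, hn⟩ := exists_mem_pw a
  exact Set.mem_iUnion.2 ⟨n.natAbs, pw_anti (by omega) hn⟩

/-- Second countability makes product and Borel σ-algebras agree and allows countable covers of the
regular nilpotent orbit. -/
instance : SecondCountableTopology F := by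
  let := IsTopologicalAddGroup.rightUniformSpace F
  have := isUniformAddGroup_of_addCommGroup (G := F)
  have : (𝓝 (0 : F)).IsCountablyGenerated :=
    Filter.HasCountableBasis.isCountablyGenerated ⟨hasBasis_nhds_zero_pw, Set.to_countable _⟩
  have : (uniformity F).IsCountablyGenerated := IsUniformAddGroup.uniformity_countably_generated
  have : TopologicalSpace.SeparableSpace F := by
    let := UniformSpace.pseudoMetricSpace F
    infer_instance
  exact UniformSpace.secondCountable_of_separable F

end Field

end GLTwo

/-! ### The adjoint action and companion forms. -/

namespace GLTwo

section Adjoint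

variable {F : Type*} [Field F]

theorem Ad_one (X : g F) : Ad (1 : G F) X = X := by simp [Ad]

theorem Ad_mul (x y : G F) (X : g F) : Ad (x * y) X = Ad x (Ad y X) := by
  simp [Ad, mul_assoc]

@[simp] theorem Ad_inv_Ad (x : G F) (X : g F) : Ad x⁻¹ (Ad x X) = X := by
  rw [← Ad_mul, inv_mul_cancel, Ad_one]

@[simp] theorem Ad_Ad_inv (x : G F) (X : g F) : Ad x (Ad x⁻¹ X) = X := by
  rw [← Ad_mul, mul_inv_cancel, Ad_one]

theorem Ad_add (x : G F) (X Y : g F) : Ad x (X + Y) = Ad x X + Ad x Y := by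
  simp [Ad, mul_add, add_mul]

@[simp] theorem Ad_zero (x : G F) : Ad x (0 : g F) = 0 := by simp [Ad]

theorem Ad_neg (x : G F) (X : g F) : Ad x (-X) = -Ad x X := by simp [Ad]

theorem Ad_sub (x : G F) (X Y : g F) : Ad x (X - Y) = Ad x X - Ad x Y := by
  simp [sub_eq_add_neg, Ad_add, Ad_neg]

theorem Ad_mul_mat (x : G F) (X Y : g F) : Ad x (X * Y) = Ad x X * Ad x Y := by
  simp [Ad, mul_assoc]

theorem Ad_smul (x : G F) (c : F) (X : g F) : Ad x (c • X) = c • Ad x X := by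
  simp [Ad]

theorem Ad_eq_iff (x : G F) (X Y : g F) : Ad x X = Y ↔ (x : g F) * X = Y * (x : g F) := by
  unfold Ad
  constructor
  · rintro rfl; simp [mul_assoc]
  · intro h; rw [h]; simp [mul_assoc]

theorem trace_Ad (x : G F) (X : g F) : (Ad x X).trace = X.trace := by
  unfold Ad
  rw [Matrix.trace_mul_comm, ← mul_assoc]; simp

theorem det_Ad (x : G F) (X : g F) : (Ad x X).det = X.det := by
  unfold Ad
  rw [Matrix.det_mul, Matrix.det_mul, mul_right_comm, ← Matrix.det_mul]; simp

/-- The adjoint action as an additive automorphism. -/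
def AdEquiv (x : G F) : g F ≃+ g F where
  toFun := Ad x
  invFun := Ad x⁻¹
  left_inv := Ad_inv_Ad x
  right_inv := Ad_Ad_inv x
  map_add' := Ad_add x

/-- An invertible `2 × 2` matrix from its entries. -/
noncomputable def mkG (a b c d : F) (h : a * d - b * c ≠ 0) : G F :=
  Matrix.GeneralLinearGroup.mkOfDetNeZero !![a, b; c, d] (by rwa [Matrix.det_fin_two_of])

@[simp] theorem coe_mkG (a b c d : F) (h : a * d - b * c ≠ 0) :
    (mkG a b c d h : g F) = !![a, b; c, d] := rfl

theorem ext_g {R : Type*} {X Y : Matrix (Fin 2) (Fin 2) R} (h00 : X 0 0 = Y 0 0) (h01 : X 0 1 = Y 0 1) (h10 : X 1 0 = Y 1 0)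
    (h11 : X 1 1 = Y 1 1) : X = Y := by
  ext i j; fin_cases i <;> fin_cases j <;> assumption

/-- The matrix `!![0, u; -det X / u, tr X]` is conjugate to a non-scalar matrix. -/
theorem exists_companion (X : g F) (h : X 1 0 ≠ 0 ∨ X 0 1 ≠ 0 ∨ X 0 0 ≠ X 1 1) :
    ∃ k : G F, Ad k⁻¹ X = !![0, 1; -X.det, X.trace] := by
  have key : ∀ k : G F, X * (k : g F) = (k : g F) * !![0, 1; -X.det, X.trace] →
      Ad k⁻¹ X = !![0, 1; -X.det, X.trace] := by
    intro k hk
    unfold Ad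
    rw [inv_inv, mul_assoc, hk, ← mul_assoc]; simp
  -- The second column of k is a cyclic vector v for X, and the first one is (X - tr X)v. One of
  -- (1,1), (0,1), (1,0) is cyclic when X is not scalar.
  by_cases h1 : X 1 0 = 0
  · by_cases h2 : X 0 1 = 0
    · have h3 : X 0 0 ≠ X 1 1 := by tauto
      refine ⟨mkG (-X 1 1) 1 (-X 0 0) 1 (by
        rw [mul_one, one_mul, sub_neg_eq_add, neg_add_eq_sub]; exact sub_ne_zero.2 h3), key _ ?_⟩
      rw [coe_mkG, Matrix.det_fin_two, Matrix.trace_fin_two]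
      refine ext_g ?_ ?_ ?_ ?_ <;> simp [Matrix.mul_apply, Fin.sum_univ_two, h1, h2] <;> ring
    · refine ⟨mkG (X 0 1) 0 (-X 0 0) 1 (by simpa using h2), key _ ?_⟩
      rw [coe_mkG, Matrix.det_fin_two, Matrix.trace_fin_two]
      refine ext_g ?_ ?_ ?_ ?_ <;> simp [Matrix.mul_apply, Fin.sum_univ_two, h1] <;> ring
  · refine ⟨mkG (-X 1 1) 1 (X 1 0) 0 (by simpa using h1), key _ ?_⟩
    rw [coe_mkG, Matrix.det_fin_two, Matrix.trace_fin_two]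
    refine ext_g ?_ ?_ ?_ ?_ <;> simp [Matrix.mul_apply, Fin.sum_univ_two] <;> ring

theorem Ad_mkG_diag (a d : F) (h : a * d - 0 * 0 ≠ 0) (X : g F) :
    Ad (mkG a 0 0 d h) X = !![X 0 0, a * X 0 1 * d⁻¹; d * X 1 0 * a⁻¹, X 1 1] := by
  have ha : a ≠ 0 := by rintro rfl; simp at h
  have hd : d ≠ 0 := by rintro rfl; simp at h
  rw [Ad_eq_iff, coe_mkG]
  refine ext_g ?_ ?_ ?_ ?_ <;> simp [Matrix.mul_apply, Fin.sum_univ_two, ha, hd, mul_comm]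

theorem Ad_mem_iff_of_forall {k : G F} {L : AddSubgroup (g F)} (h : ∀ Y ∈ L, Ad k Y ∈ L)
    (h' : ∀ Y ∈ L, Ad k⁻¹ Y ∈ L) (Y : g F) : Ad k Y ∈ L ↔ Y ∈ L :=
  ⟨fun hY => by simpa using h' _ hY, h Y⟩

theorem coe_inv_mkG (a b c d : F) (h : a * d - b * c ≠ 0) : (((mkG a b c d h)⁻¹ : G F) : g F) =
    (a * d - b * c)⁻¹ • !![d, -b; -c, a] := by
  rw [Matrix.coe_units_inv, coe_mkG, Matrix.inv_def, Matrix.det_fin_two_of, Ring.inverse_eq_inv',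
    Matrix.adjugate_fin_two_of]

theorem Ad_inv_mem_iff {k : G F} {L : AddSubgroup (g F)} (h : ∀ Y, Ad k Y ∈ L ↔ Y ∈ L) (Y : g F) :
    Ad k⁻¹ Y ∈ L ↔ Y ∈ L := by rw [← h, Ad_Ad_inv]

end Adjoint

/-! ### The Moy–Prasad lattices in coordinates. -/

section Lattices

variable {F : Type*} [Field F] [ValuativeRel F] [TopologicalSpace F] [IsNonarchimedeanLocalField F]

theorem rpow_q_pos (x : ℝ) : 0 < q F ^ x := Real.rpow_pos_of_pos (q_pos F) x

theorem nabs_le_rpow {a : F} {x : ℝ} : nabs a ≤ q F ^ (-x) ↔ a ∈ pw F ⌈x⌉ := by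
  rcases eq_or_ne a 0 with rfl | h
  · simp [(rpow_q_pos (F := F) (-x)).le]
  rw [mem_pw_iff_val h, nabs_of_ne h, ← Real.rpow_intCast, Real.rpow_le_rpow_left_iff (one_lt_q F),
    Int.ceil_le]
  push_cast
  exact neg_le_neg_iff

/-- The split norm whose unit vectors are the columns of `h`, with weights `q ^ t i`. -/
noncomputable def splitNorm (h : G F) (t : Fin 2 → ℝ) : SplitNorm F where
  toFun v := max (nabs ((((h⁻¹ : G F) : g F) *ᵥ v) 0) * q F ^ t 0)
    (nabs ((((h⁻¹ : G F) : g F) *ᵥ v) 1) * q F ^ t 1)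
  split := by
    let e : (Fin 2 → F) ≃ₗ[F] (Fin 2 → F) := Matrix.toLin'OfInv (M := (h : g F))
      (M' := ((h⁻¹ : G F) : g F)) (by simp) (by simp)
    refine ⟨Module.Basis.ofEquivFun e, fun i => q F ^ t i, fun i => rpow_q_pos _, fun v => ?_⟩
    simp [e, Module.Basis.ofEquivFun]

/-- The point of the building given by `splitNorm`. -/
noncomputable def pt (h : G F) (t : Fin 2 → ℝ) : Building F := Quotient.mk _ (splitNorm h t)

theorem exists_splitNorm (α : SplitNorm F) : ∃ (h : G F) (t : Fin 2 → ℝ),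
    α.toFun = (splitNorm h t).toFun := by
  obtain ⟨b, w, hw, hα⟩ := α.split
  have hinv : (Pi.basisFun F (Fin 2)).toMatrix b * b.toMatrix (Pi.basisFun F (Fin 2)) = 1 :=
    Module.Basis.toMatrix_mul_toMatrix_flip _ _
  have hinv' : b.toMatrix (Pi.basisFun F (Fin 2)) * (Pi.basisFun F (Fin 2)).toMatrix b = 1 :=
    Module.Basis.toMatrix_mul_toMatrix_flip _ _
  refine ⟨⟨_, _, hinv, hinv'⟩, fun i => Real.logb (q F) (w i), ?_⟩
  funext v
  rw [hα]
  have h1 : ∀ i, q F ^ Real.logb (q F) (w i) = w i := fun i =>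
    Real.rpow_logb (q_pos F) (one_lt_q F).ne' (hw i)
  have h2 : b.toMatrix (Pi.basisFun F (Fin 2)) *ᵥ v = b.repr v := by
    have := Module.Basis.toMatrix_mulVec_repr (Pi.basisFun F (Fin 2)) b v
    exact this
  unfold splitNorm
  simp only [h1, Units.inv_mk, h2]

theorem exists_pt (x : Building F) : ∃ h t, x = pt h t := by
  induction x using Quotient.ind with
  | _ α =>
    obtain ⟨h, t, e⟩ := exists_splitNorm α
    exact ⟨h, t, Quotient.sound ⟨1, one_pos, fun v => by rw [e, one_mul]⟩⟩

/-- By the ultrametric inequality, the bound on the norm needs to be tested only on the basis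
vectors, where it becomes one condition for each matrix entry. -/
theorem mem_lat_pt {h : G F} {t : Fin 2 → ℝ} {s : ℝ} {Y : g F} :
    Y ∈ lat (pt h t) s ↔ ∀ i j, (Ad h⁻¹ Y) i j ∈ pw F ⌈s + t i - t j⌉ := by
  set M := Ad h⁻¹ Y with hM
  have hY : Y = Ad h M := by simp [hM]
  set N : (Fin 2 → F) → ℝ := fun u => max (nabs (u 0) * q F ^ t 0) (nabs (u 1) * q F ^ t 1) with hN
  have h1 : Y ∈ lat (pt h t) s ↔ ∀ u, N (M *ᵥ u) ≤ q F ^ (-s) * N u := by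
    change (∀ v, (splitNorm h t).toFun (Y *ᵥ v) ≤ q F ^ (-s) * (splitNorm h t).toFun v) ↔ _
    constructor
    · intro H u
      have := H ((h : g F) *ᵥ u)
      simp only [splitNorm, Matrix.mulVec_mulVec] at this
      rw [hY, Ad] at this
      simpa [mul_assoc, hN] using this
    · intro H v
      have := H (((h⁻¹ : G F) : g F) *ᵥ v)
      simp only [splitNorm, Matrix.mulVec_mulVec]
      rw [Matrix.mulVec_mulVec] at this
      have e : ((h⁻¹ : G F) : g F) * Y = M * ((h⁻¹ : G F) : g F) := by
        rw [hM, Ad, inv_inv]; simp [mul_assoc]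
      rw [e]
      exact this
  have h2 : ∀ i j, M i j ∈ pw F ⌈s + t i - t j⌉ ↔ nabs (M i j) * q F ^ t i ≤ q F ^ (-s) * q F ^ t j := by
    intro i j
    rw [← nabs_le_rpow, ← Real.rpow_add (q_pos F), ← le_div_iff₀ (rpow_q_pos _),
      ← Real.rpow_sub (q_pos F)]
    have : -(s + t i - t j) = -s + t j - t i := by ring
    rw [this]
  simp_rw [h1, h2]
  have hle : ∀ (u : Fin 2 → F) i, nabs (u i) * q F ^ t i ≤ N u := by
    intro u i; fin_cases i
    · exact le_max_left _ _
    · exact le_max_right _ _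
  constructor
  · intro H i j
    have := (hle _ i).trans (H (Pi.single j 1))
    have hs : N (Pi.single j 1) = q F ^ t j := by
      fin_cases j <;> simp [hN, (rpow_q_pos _).le]
    rw [hs] at this
    simpa using this
  · intro H u
    have hi : ∀ i, nabs ((M *ᵥ u) i) * q F ^ t i ≤ q F ^ (-s) * N u := by
      intro i
      have hj : ∀ j, nabs (M i j * u j) * q F ^ t i ≤ q F ^ (-s) * N u := by
        intro j
        calc nabs (M i j * u j) * q F ^ t i = (nabs (M i j) * q F ^ t i) * nabs (u j) := by
              rw [nabs_mul]; ring
          _ ≤ (q F ^ (-s) * q F ^ t j) * nabs (u j) :=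
              mul_le_mul_of_nonneg_right (H i j) (nabs_nonneg _)
          _ = q F ^ (-s) * (nabs (u j) * q F ^ t j) := by ring
          _ ≤ _ := mul_le_mul_of_nonneg_left (hle u j) (rpow_q_pos _).le
      have : (M *ᵥ u) i = M i 0 * u 0 + M i 1 * u 1 := by
        simp [Matrix.mulVec, dotProduct, Fin.sum_univ_two]
      rw [this]
      refine (mul_le_mul_of_nonneg_right (nabs_add_le _ _) (rpow_q_pos _).le).trans ?_
      rw [max_mul_of_nonneg _ _ (rpow_q_pos _).le]
      exact max_le (hj 0) (hj 1)
    exact max_le (hi 0) (hi 1)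

theorem mem_latPlus_pt {h : G F} {t : Fin 2 → ℝ} {s : ℝ} {Y : g F} :
    Y ∈ latPlus (pt h t) s ↔ ∀ i j, (Ad h⁻¹ Y) i j ∈ pw F (⌊s + t i - t j⌋ + 1) := by
  unfold latPlus
  simp only [Set.mem_iUnion, exists_prop, mem_lat_pt]
  constructor
  · rintro ⟨s', hs', H⟩ i j
    refine pw_anti ?_ (H i j)
    rw [← Int.lt_iff_add_one_le, Int.lt_ceil]
    refine (Int.floor_le _).trans_lt ?_
    linarith
  · intro H
    -- Only four entries occur, so one ε raises s without any of the four thresholds passing the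
    -- next integer.
    obtain ⟨ε, hε, hle⟩ : ∃ ε : ℝ, 0 < ε ∧ ∀ i j, ε ≤ (⌊s + t i - t j⌋ + 1 : ℝ) - (s + t i - t j) := by
      let f : Fin 2 × Fin 2 → ℝ := fun p => (⌊s + t p.1 - t p.2⌋ + 1 : ℝ) - (s + t p.1 - t p.2)
      obtain ⟨p, hp⟩ := Finite.exists_min f
      exact ⟨f p, sub_pos.2 (Int.lt_floor_add_one _), fun i j => hp (i, j)⟩
    refine ⟨s + ε, by simpa using hε, fun i j => pw_anti ?_ (H i j)⟩
    rw [Int.ceil_le]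
    push_cast
    linarith [hle i j]

theorem lat_anti (x : Building F) {s s' : ℝ} (h : s ≤ s') : lat x s' ⊆ lat x s := by
  obtain ⟨k, t, rfl⟩ := exists_pt x
  intro Y hY
  rw [mem_lat_pt] at hY ⊢
  exact fun i j => pw_anti (Int.ceil_mono (by linarith)) (hY i j)

theorem lat_subset_latPlus (x : Building F) {s s' : ℝ} (h : s < s') : lat x s' ⊆ latPlus x s :=
  Set.subset_biUnion_of_mem (u := fun s => lat x s) h

theorem latPlus_subset_lat (x : Building F) (s : ℝ) : latPlus x s ⊆ lat x s :=
  Set.iUnion₂_subset fun _ hs' => lat_anti x (le_of_lt hs')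

theorem latPlus_anti (x : Building F) {s s' : ℝ} (h : s ≤ s') : latPlus x s' ⊆ latPlus x s :=
  Set.iUnion₂_subset fun _ hs' => lat_subset_latPlus x (lt_of_le_of_lt h hs')

theorem mul_mem_lat {x : Building F} {s s' : ℝ} {X Y : g F} (hX : X ∈ lat x s) (hY : Y ∈ lat x s') :
    X * Y ∈ lat x (s + s') := by
  induction x using Quotient.ind with
  | _ α =>
    intro v
    have h1 := hX (Y *ᵥ v)
    have h2 := mul_le_mul_of_nonneg_left (hY v) (rpow_q_pos (F := F) (-s)).le
    rw [Matrix.mulVec_mulVec] at h1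
    rw [neg_add, Real.rpow_add (q_pos F), mul_assoc]
    exact h1.trans h2

theorem mul_mem_latPlus_right {x : Building F} {s s' : ℝ} {X Y : g F} (hX : X ∈ lat x s)
    (hY : Y ∈ latPlus x s') : X * Y ∈ latPlus x (s + s') := by
  simp only [latPlus, Set.mem_iUnion, exists_prop] at hY
  obtain ⟨a, ha, hY⟩ := hY
  exact lat_subset_latPlus x (by simpa using ha) (mul_mem_lat hX hY)

theorem trace_mem_of_mem_latPlus {x : Building F} {s : ℝ} {X : g F} (hX : X ∈ latPlus x s) :
    X.trace ∈ pw F (⌊s⌋ + 1) := by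
  obtain ⟨k, t, rfl⟩ := exists_pt x
  rw [mem_latPlus_pt] at hX
  rw [← trace_Ad k⁻¹ X, Matrix.trace_fin_two]
  have h0 := hX 0 0
  have h1 := hX 1 1
  rw [add_sub_cancel_right] at h0 h1
  exact add_mem h0 h1

theorem det_mem_of_mem_latPlus {x : Building F} {s : ℝ} {X : g F} (hX : X ∈ latPlus x s) :
    X.det ∈ pw F (⌊2 * s⌋ + 1) := by
  obtain ⟨k, t, rfl⟩ := exists_pt x
  rw [mem_latPlus_pt] at hX
  rw [← det_Ad k⁻¹ X, Matrix.det_fin_two]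
  have key : ∀ c c' : ℝ, c + c' = 2 * s → ⌊2 * s⌋ + 1 ≤ (⌊c⌋ + 1) + (⌊c'⌋ + 1) := by
    intro c c' h
    rw [← h]
    have := Int.le_floor_add_floor c c'
    linarith
  exact sub_mem (mul_mem_pw' (hX 0 0) (hX 1 1) (key _ _ (by ring)))
    (mul_mem_pw' (hX 0 1) (hX 1 0) (key _ _ (by ring)))

/-- This is the Newton polygon criterion that both eigenvalues have valuation above s. It replaces
the union over the building by two conditions on invariants. -/
theorem mem_gPlus_iff {s : ℝ} {X : g F} :
    X ∈ gPlus F s ↔ X.trace ∈ pw F (⌊s⌋ + 1) ∧ X.det ∈ pw F (⌊2 * s⌋ + 1) := by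
  constructor
  · intro h
    obtain ⟨x, hx⟩ := Set.mem_iUnion.1 h
    exact ⟨trace_mem_of_mem_latPlus hx, det_mem_of_mem_latPlus hx⟩
  · rintro ⟨ht, hd⟩
    refine Set.mem_iUnion.2 ?_
    by_cases h : X 1 0 ≠ 0 ∨ X 0 1 ≠ 0 ∨ X 0 0 ≠ X 1 1
    · obtain ⟨k, hk⟩ := exists_companion X h
      -- At the weight s + ε the entry 1 of the companion matrix has room ε, and the entry -det
      -- needs ⌊2s + ε⌋ ≤ ⌊2s⌋; half of the gap to the next integer serves both.
      set ε : ℝ := (⌊2 * s⌋ + 1 - 2 * s) / 2 with hε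
      have hlt := Int.lt_floor_add_one (2 * s)
      have h0 : 0 < ε := by rw [hε]; linarith
      refine ⟨pt k ![0, s + ε], mem_latPlus_pt.2 fun i j => ?_⟩
      rw [hk]
      fin_cases i <;> fin_cases j
      · simp [zero_mem]
      · refine pw_anti ?_ (one_mem_pw (F := F))
        have : ⌊s + ![0, s + ε] 0 - ![0, s + ε] 1⌋ < 0 := by
          rw [Int.floor_lt]; simp [h0]
        simpa using Int.lt_iff_add_one_le.1 this
      · refine pw_anti ?_ (neg_mem hd)
        have : ⌊s + ![0, s + ε] 1 - ![0, s + ε] 0⌋ < ⌊2 * s⌋ + 1 := by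
          rw [Int.floor_lt]; simp; linarith
        simpa using Int.lt_iff_add_one_le.1 this
      · simpa using ht
    · push Not at h
      obtain ⟨h10, h01, h11⟩ := h
      refine ⟨pt 1 ![0, 0], mem_latPlus_pt.2 fun i j => ?_⟩
      have ha : X 0 0 ∈ pw F (⌊s⌋ + 1) := by
        by_contra hn
        have h2 := mem_pw_of_mul_mem (m := ⌊s⌋) (n := ⌊2 * s⌋ + 1 - ⌊s⌋) (a := X 0 0) (b := X 0 0)
          (by rw [Matrix.det_fin_two, h10, h01, ← h11] at hd
              simpa using hd) hn
        refine hn (pw_anti ?_ h2)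
        have := Int.le_floor_add_floor s s
        have h3 : 2 * ⌊s⌋ ≤ ⌊2 * s⌋ := by
          rw [Int.le_floor]; push_cast; linarith [Int.floor_le s]
        omega
      rw [inv_one, Ad_one]
      fin_cases i <;> fin_cases j <;> simp [h10, h01, zero_mem, ← h11, ha]

theorem nilCone_subset_gPlus (s : ℝ) : nilCone F ⊆ gPlus F s := by
  intro X hX
  have ht : X.trace = 0 := (Matrix.isNilpotent_trace_of_isNilpotent hX).eq_zero
  have hd : X.det = 0 := by
    obtain ⟨n, hn⟩ := hX
    have h : X.det ^ (n + 1) = 0 := by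
      rw [← Matrix.det_pow, pow_succ, hn, zero_mul, Matrix.det_zero]
    exact (pow_eq_zero_iff (Nat.succ_ne_zero n)).1 h
  rw [mem_gPlus_iff, ht, hd]
  exact ⟨zero_mem _, zero_mem _⟩

end Lattices

end GLTwo

namespace GLTwo

/-! ### Lattices given by entrywise conditions and the standard points. -/

section Boxes

variable {F : Type*} [Field F] [ValuativeRel F] [TopologicalSpace F] [IsNonarchimedeanLocalField F]

variable (F) in
/-- The lattice of matrices with diagonal entries in `P ^ a`, upper right entry in `P ^ b` and
lower left entry in `P ^ c`. -/
def box (a b c : ℤ) : AddSubgroup (g F) where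
  carrier := {X | X 0 0 ∈ pw F a ∧ X 0 1 ∈ pw F b ∧ X 1 0 ∈ pw F c ∧ X 1 1 ∈ pw F a}
  zero_mem' := ⟨zero_mem _, zero_mem _, zero_mem _, zero_mem _⟩
  add_mem' := fun hX hY => ⟨add_mem hX.1 hY.1, add_mem hX.2.1 hY.2.1, add_mem hX.2.2.1 hY.2.2.1,
    add_mem hX.2.2.2 hY.2.2.2⟩
  neg_mem' := fun hX => ⟨neg_mem hX.1, neg_mem hX.2.1, neg_mem hX.2.2.1, neg_mem hX.2.2.2⟩

theorem mem_box {a b c : ℤ} {X : g F} : X ∈ box F a b c ↔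
    X 0 0 ∈ pw F a ∧ X 0 1 ∈ pw F b ∧ X 1 0 ∈ pw F c ∧ X 1 1 ∈ pw F a := Iff.rfl

theorem box_mono {a b c a' b' c' : ℤ} (ha : a ≤ a' := by omega) (hb : b ≤ b' := by omega)
    (hc : c ≤ c' := by omega) : box F a' b' c' ≤ box F a b c := fun _ h =>
  ⟨pw_anti ha h.1, pw_anti hb h.2.1, pw_anti hc h.2.2.1, pw_anti ha h.2.2.2⟩

theorem mul_mem_box {a b c a' b' c' u v w : ℤ} {X Y : g F} (hX : X ∈ box F a b c)
    (hY : Y ∈ box F a' b' c') (h1 : u ≤ a + a' := by omega) (h2 : u ≤ b + c' := by omega)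
    (h3 : u ≤ c + b' := by omega) (h4 : v ≤ a + b' := by omega) (h5 : v ≤ b + a' := by omega)
    (h6 : w ≤ c + a' := by omega) (h7 : w ≤ a + c' := by omega) : X * Y ∈ box F u v w := by
  obtain ⟨x1, x2, x3, x4⟩ := hX
  obtain ⟨y1, y2, y3, y4⟩ := hY
  refine ⟨?_, ?_, ?_, ?_⟩ <;> rw [Matrix.mul_apply, Fin.sum_univ_two]
  · exact add_mem (mul_mem_pw' x1 y1 h1) (mul_mem_pw' x2 y3 h2)
  · exact add_mem (mul_mem_pw' x1 y2 h4) (mul_mem_pw' x2 y4 h5)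
  · exact add_mem (mul_mem_pw' x3 y1 h6) (mul_mem_pw' x4 y3 h7)
  · exact add_mem (mul_mem_pw' x3 y2 h3) (mul_mem_pw' x4 y4 h1)

theorem continuous_entry {R : Type*} [TopologicalSpace R] (i j : Fin 2) :
    Continuous fun X : Matrix (Fin 2) (Fin 2) R => X i j :=
  (continuous_apply j).comp (continuous_apply i)

theorem isOpen_box (a b c : ℤ) : IsOpen (box F a b c : Set (g F)) := by
  have h : ∀ (i j : Fin 2) (n : ℤ), IsOpen {X : g F | X i j ∈ pw F n} := fun i j n =>
    (isOpen_pw n).preimage (continuous_entry i j)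
  exact (h 0 0 a).inter ((h 0 1 b).inter ((h 1 0 c).inter (h 1 1 a)))

theorem isClosed_box (a b c : ℤ) : IsClosed (box F a b c : Set (g F)) :=
  AddSubgroup.isClosed_of_isOpen _ (isOpen_box a b c)

theorem isCompact_ball (n : ℤ) : IsCompact (box F n n n : Set (g F)) := by
  have h : IsCompact (Set.univ.pi fun _ : Fin 2 => Set.univ.pi fun _ : Fin 2 => (pw F n : Set F)) :=
    isCompact_univ_pi fun _ => isCompact_univ_pi fun _ => isCompact_pw n
  refine h.of_isClosed_subset (isClosed_box n n n) ?_
  rintro X ⟨h1, h2, h3, h4⟩ i _ j _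
  fin_cases i <;> fin_cases j <;> assumption

theorem isCompact_box (a b c : ℤ) : IsCompact (box F a b c : Set (g F)) :=
  (isCompact_ball (min a (min b c))).of_isClosed_subset (isClosed_box a b c)
    (box_mono (by omega) (by omega) (by omega))

theorem exists_ball_mem (X : g F) : ∃ n : ℤ, X ∈ box F n n n := by
  choose n hn using fun p : Fin 2 × Fin 2 => exists_mem_pw (X p.1 p.2)
  obtain ⟨p, hp⟩ := Finite.exists_min n
  exact ⟨n p, pw_anti (hp _) (hn (0, 0)), pw_anti (hp _) (hn (0, 1)), pw_anti (hp _) (hn (1, 0)),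
    pw_anti (hp _) (hn (1, 1))⟩

theorem hasBasis_nhds_zero_ball :
    (𝓝 (0 : g F)).HasBasis (fun _ : ℤ => True) (fun n => (box F n n n : Set (g F))) := by
  refine ⟨fun s => ⟨fun hs => ?_, fun ⟨n, _, h⟩ =>
    Filter.mem_of_superset ((isOpen_box n n n).mem_nhds (zero_mem _)) h⟩⟩
  have key : ∀ s : Set (Fin 2 → Fin 2 → F), s ∈ 𝓝 0 →
      ∃ n, ∀ X : Fin 2 → Fin 2 → F, (∀ i j, X i j ∈ pw F n) → X ∈ s := by
    intro s hs
    rw [nhds_pi, Filter.mem_pi] at hs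
    obtain ⟨I, -, u, hu, hs⟩ := hs
    have hv : ∀ i, ∃ v : Fin 2 → Set F, (∀ j, v j ∈ 𝓝 (0 : F)) ∧ Set.univ.pi v ⊆ u i := by
      intro i
      have hi := hu i
      rw [nhds_pi, Filter.mem_pi] at hi
      obtain ⟨J, -, v, hv, h⟩ := hi
      exact ⟨v, hv, (Set.pi_mono' (fun _ _ => subset_rfl) (Set.subset_univ J)).trans h⟩
    choose v hv hvu using hv
    choose n hn using fun p : Fin 2 × Fin 2 => hasBasis_nhds_zero_pw.mem_iff.1 (hv p.1 p.2)
    obtain ⟨p, hp⟩ := Finite.exists_max n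
    exact ⟨n p, fun X hX => hs fun i _ => hvu i fun j _ => (hn (i, j)).2 (pw_anti (hp _) (hX i j))⟩
  obtain ⟨n, hn⟩ := key s hs
  refine ⟨n, trivial, fun X ⟨h1, h2, h3, h4⟩ => hn X fun i j => ?_⟩
  fin_cases i <;> fin_cases j <;> assumption

instance : SecondCountableTopology (g F) :=
  inferInstanceAs (SecondCountableTopology (Fin 2 → Fin 2 → F))

instance : T2Space (g F) := inferInstanceAs (T2Space (Fin 2 → Fin 2 → F))

instance : LocallyCompactSpace (g F) := inferInstanceAs (LocallyCompactSpace (Fin 2 → Fin 2 → F))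

theorem continuous_Ad (x : G F) : Continuous (Ad x) := by
  unfold Ad; fun_prop

/-- Conjugation by `diag(ϖ ^ k, 1)`. -/
noncomputable def dg (k : ℤ) : G F := mkG (unif F ^ k) 0 0 1 (by
  simpa using zpow_ne_zero k (unif_ne_zero F))

theorem Ad_dg (k : ℤ) (X : g F) :
    Ad (dg k) X = !![X 0 0, unif F ^ k * X 0 1; unif F ^ (-k) * X 1 0, X 1 1] := by
  rw [dg, Ad_mkG_diag, inv_one, mul_one, one_mul, zpow_neg, mul_comm (X 1 0)]

theorem Ad_dg_mem_box {k a b c : ℤ} {X : g F} :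
    Ad (dg k) X ∈ box F a b c ↔ X ∈ box F a (b - k) (c + k) := by
  rw [Ad_dg, mem_box, mem_box]
  simp only [Matrix.of_apply, Matrix.cons_val', Matrix.cons_val_zero, Matrix.cons_val_one,
    unif_zpow_mul_mem, sub_neg_eq_add, Matrix.cons_val_fin_one]

variable (F) in
/-- The standard lattice `latPlus x (n / 2)` for the standard vertex (`n` even) or the midpoint of the
standard edge (`n` odd). -/
def stdLat (n : ℤ) : AddSubgroup (g F) := box F ((n + 2) / 2) ((n + 2) / 2) (n + 2 - (n + 2) / 2)

/-- Every lattice `lat x ((n + 1) / 2)` contains a conjugate of the standard lattice. -/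
theorem exists_stdLat_subset_lat (x : Building F) (n : ℤ) :
    ∃ k : G F, ∀ Y ∈ stdLat F n, Ad k Y ∈ lat x ((n + 1) / 2) := by
  obtain ⟨h, t, rfl⟩ := exists_pt x
  set τ : ℝ := t 0 - t 1 with hτ
  set m := (n + 2) / 2 with hm
  -- k is the least shift that makes the upper right entry deep enough. The off-diagonal exponents
  -- of `stdLat` add up to n + 2, one more than the n + 1 needed, and this unit absorbs the rounding
  -- in the lower left entry.
  set k : ℤ := ⌈(n + 1) / 2 + τ - m⌉ with hk
  refine ⟨h * dg k, fun Y hY => mem_lat_pt.2 ?_⟩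
  rw [Ad_mul, Ad_inv_Ad]
  have hY' : Ad (dg k) Y ∈ box F m (m + k) (n + 2 - m - k) := by
    rw [Ad_dg_mem_box, add_sub_cancel_right, sub_add_cancel]; exact hY
  obtain ⟨h1, h2, h3, h4⟩ := hY'
  have hm1 : (n + 1 : ℝ) / 2 ≤ m := by
    have : n + 1 ≤ 2 * m := by omega
    have : (n + 1 : ℝ) ≤ 2 * m := by exact_mod_cast this
    linarith
  have hc1 := Int.le_ceil ((n + 1 : ℝ) / 2 + τ - m)
  have hc2 := Int.ceil_lt_add_one ((n + 1 : ℝ) / 2 + τ - m)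
  rw [← hk] at hc1 hc2
  intro i j
  fin_cases i <;> fin_cases j
  · refine pw_anti ?_ h1; rw [Int.ceil_le]; simpa using hm1
  · refine pw_anti ?_ h2
    rw [Int.ceil_le]; push_cast; simp; linarith
  · refine pw_anti ?_ h3
    rw [Int.ceil_le]; push_cast; simp; linarith
  · refine pw_anti ?_ h4; rw [Int.ceil_le]; simpa using hm1

variable (F) in
/-- The standard vertex. -/
noncomputable def vtx : Building F := pt 1 ![0, 0]

variable (F) in
/-- The midpoint of the standard edge. -/
noncomputable def mid : Building F := pt 1 ![0, 1 / 2]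

theorem mem_lat_std {t s : ℝ} {X : g F} :
    X ∈ lat (pt 1 ![0, t]) s ↔ X ∈ box F ⌈s⌉ ⌈s - t⌉ ⌈s + t⌉ := by
  rw [mem_lat_pt, inv_one, Ad_one, mem_box]
  simp [Fin.forall_fin_two, and_assoc]

theorem mem_latPlus_std {t s : ℝ} {X : g F} :
    X ∈ latPlus (pt 1 ![0, t]) s ↔ X ∈ box F (⌊s⌋ + 1) (⌊s - t⌋ + 1) (⌊s + t⌋ + 1) := by
  rw [mem_latPlus_pt, inv_one, Ad_one, mem_box]
  simp [Fin.forall_fin_two, and_assoc]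

theorem lat_vtx (j : ℤ) : lat (vtx F) j = box F j j j := by
  ext X; rw [vtx, mem_lat_std]; simp

theorem latPlus_vtx (j : ℤ) : latPlus (vtx F) j = box F (j + 1) (j + 1) (j + 1) := by
  ext X; rw [vtx, mem_latPlus_std]; simp

theorem ceil_add_half (j : ℤ) : ⌈(j : ℝ) + 1 / 2⌉ = j + 1 := by
  rw [Int.ceil_eq_iff]; push_cast; constructor <;> linarith

theorem floor_add_half (j : ℤ) : ⌊(j : ℝ) + 1 / 2⌋ = j := by
  rw [Int.floor_eq_iff]; constructor <;> linarith

theorem lat_mid_int (j : ℤ) : lat (mid F) j = box F j j (j + 1) := by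
  ext X
  have h : ⌈(j : ℝ) - 1 / 2⌉ = j := by
    rw [Int.ceil_eq_iff]; constructor <;> linarith
  rw [mid, mem_lat_std, ceil_add_half, h]; simp

theorem lat_mid_half (j : ℤ) : lat (mid F) (j + 1 / 2) = box F (j + 1) j (j + 1) := by
  ext X
  have h : (j : ℝ) + 1 / 2 + 1 / 2 = (j + 1 : ℤ) := by push_cast; ring
  rw [mid, mem_lat_std, ceil_add_half, add_sub_cancel_right, h, Int.ceil_intCast, Int.ceil_intCast]
  rfl

theorem latPlus_mid_int (j : ℤ) : latPlus (mid F) j = box F (j + 1) j (j + 1) := by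
  ext X
  have h : ⌊(j : ℝ) - 1 / 2⌋ = j - 1 := by
    rw [Int.floor_eq_iff]; push_cast; constructor <;> linarith
  rw [mid, mem_latPlus_std, floor_add_half, h]; simp

theorem latPlus_mid_half (j : ℤ) : latPlus (mid F) (j + 1 / 2) = box F (j + 1) (j + 1) (j + 2) := by
  ext X
  have h : (j : ℝ) + 1 / 2 + 1 / 2 = (j + 1 : ℤ) := by push_cast; ring
  rw [mid, mem_latPlus_std, floor_add_half, add_sub_cancel_right, h, Int.floor_intCast,
    Int.floor_intCast, add_assoc, show (1 : ℤ) + 1 = 2 from rfl]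
  rfl

/-- `stdLat n` is the lattice `latPlus x (n / 2)` of a point of the building. -/
theorem exists_latPlus_eq_stdLat (n : ℤ) : ∃ x : Building F, latPlus x (n / 2) = stdLat F n := by
  rcases Int.even_or_odd' n with ⟨j, rfl | rfl⟩
  · refine ⟨vtx F, ?_⟩
    have h : ((2 * j : ℤ) : ℝ) / 2 = j := by push_cast; ring
    rw [h, latPlus_vtx, stdLat]
    congr 2 <;> omega
  · refine ⟨mid F, ?_⟩
    have h : ((2 * j + 1 : ℤ) : ℝ) / 2 = j + 1 / 2 := by push_cast; ring
    rw [h, latPlus_mid_half, stdLat]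
    congr 2 <;> omega

theorem Ad_mem_latPlus_pt {k h : G F} {t : Fin 2 → ℝ} {s : ℝ} {Y : g F} :
    Ad k Y ∈ latPlus (pt (k * h) t) s ↔ Y ∈ latPlus (pt h t) s := by
  simp only [mem_latPlus_pt, mul_inv_rev, Ad_mul, Ad_inv_Ad]

theorem zero_mem_lat (x : Building F) (s : ℝ) : (0 : g F) ∈ lat x s := by
  obtain ⟨h, t, rfl⟩ := exists_pt x
  rw [mem_lat_pt, Ad_zero]
  exact fun i j => zero_mem _

variable (F) in
/-- `lat x s` as an additive subgroup. -/
def latGrp (x : Building F) (s : ℝ) : AddSubgroup (g F) where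
  carrier := lat x s
  zero_mem' := zero_mem_lat x s
  add_mem' := by
    obtain ⟨h, t, rfl⟩ := exists_pt x
    intro a b ha hb
    rw [mem_lat_pt] at ha hb ⊢
    rw [Ad_add]
    exact fun i j => add_mem (ha i j) (hb i j)
  neg_mem' := by
    obtain ⟨h, t, rfl⟩ := exists_pt x
    intro a ha
    rw [mem_lat_pt] at ha ⊢
    rw [Ad_neg]
    exact fun i j => neg_mem (ha i j)

variable (F) in
/-- `latPlus x s` as an additive subgroup. -/
def latPlusGrp (x : Building F) (s : ℝ) : AddSubgroup (g F) where
  carrier := latPlus x s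
  zero_mem' := lat_subset_latPlus x (lt_add_one s) (zero_mem_lat x _)
  add_mem' := by
    obtain ⟨h, t, rfl⟩ := exists_pt x
    intro a b ha hb
    rw [mem_latPlus_pt] at ha hb ⊢
    rw [Ad_add]
    exact fun i j => add_mem (ha i j) (hb i j)
  neg_mem' := by
    obtain ⟨h, t, rfl⟩ := exists_pt x
    intro a ha
    rw [mem_latPlus_pt] at ha ⊢
    rw [Ad_neg]
    exact fun i j => neg_mem (ha i j)

/-- Every lattice of the building contains a ball. -/
theorem exists_ball_subset_lat (x : Building F) (s : ℝ) :
    ∃ n : ℤ, (box F n n n : Set (g F)) ⊆ lat x s := by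
  obtain ⟨k, hk⟩ := exists_stdLat_subset_lat x ⌈2 * s⌉
  have h0 : (stdLat F ⌈2 * s⌉ : Set (g F)) ∈ 𝓝 (Ad k⁻¹ (0 : g F)) := by
    rw [Ad_zero]; exact (isOpen_box _ _ _).mem_nhds (zero_mem _)
  obtain ⟨n, -, hn⟩ := hasBasis_nhds_zero_ball.mem_iff.1 ((continuous_Ad k⁻¹).continuousAt h0)
  refine ⟨n, fun X hX => lat_anti x ?_ ((Ad_Ad_inv k X) ▸ hk _ (hn hX))⟩
  linarith [Int.le_ceil (2 * s)]

theorem exists_ball_subset_latPlus (x : Building F) (s : ℝ) :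
    ∃ n : ℤ, (box F n n n : Set (g F)) ⊆ latPlus x s := by
  obtain ⟨n, hn⟩ := exists_ball_subset_lat x (s + 1)
  exact ⟨n, hn.trans (lat_subset_latPlus x (lt_add_one s))⟩

theorem isOpen_latPlus (x : Building F) (s : ℝ) : IsOpen (latPlus x s) := by
  obtain ⟨n, hn⟩ := exists_ball_subset_latPlus x s
  exact AddSubgroup.isOpen_of_mem_nhds (latPlusGrp F x s)
    (Filter.mem_of_superset ((isOpen_box n n n).mem_nhds (zero_mem _)) hn)

theorem isOpen_lat (x : Building F) (s : ℝ) : IsOpen (lat x s) := by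
  obtain ⟨n, hn⟩ := exists_ball_subset_lat x s
  exact AddSubgroup.isOpen_of_mem_nhds (latGrp F x s)
    (Filter.mem_of_superset ((isOpen_box n n n).mem_nhds (zero_mem _)) hn)

theorem isClosed_lat (x : Building F) (s : ℝ) : IsClosed (lat x s) :=
  AddSubgroup.isClosed_of_isOpen (latGrp F x s) (isOpen_lat x s)

theorem isCompact_lat (x : Building F) (s : ℝ) : IsCompact (lat x s) := by
  obtain ⟨h, t, rfl⟩ := exists_pt x
  choose n hn using fun p : Fin 2 × Fin 2 => (⟨⌈s + t p.1 - t p.2⌉, rfl⟩ : ∃ n : ℤ, n = ⌈s + t p.1 - t p.2⌉)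
  obtain ⟨p, hp⟩ := Finite.exists_min n
  have hK := (isCompact_ball (F := F) (n p)).image (continuous_Ad h)
  refine hK.of_isClosed_subset (isClosed_lat _ _) fun X hX => ⟨Ad h⁻¹ X, ?_, Ad_Ad_inv _ _⟩
  rw [mem_lat_pt] at hX
  refine ⟨pw_anti ?_ (hX 0 0), pw_anti ?_ (hX 0 1), pw_anti ?_ (hX 1 0), pw_anti ?_ (hX 1 1)⟩
  · rw [← hn (0, 0)]; exact hp _
  · rw [← hn (0, 1)]; exact hp _
  · rw [← hn (1, 0)]; exact hp _
  · rw [← hn (1, 1)]; exact hp _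

end Boxes

end GLTwo

namespace GLTwo

/-! ### Schwartz functions as sums of indicators of cosets. -/

section Indicators

variable {Y : Type*} [TopologicalSpace Y]

open Classical in
/-- The indicator function of a compact open set. -/
noncomputable def ind [T2Space Y] (S : Set Y) : schwartz Y :=
  if h : IsOpen S ∧ IsCompact S then
    ⟨S.indicator 1, (LocallyConstant.charFn ℂ ⟨h.2.isClosed, h.1⟩).isLocallyConstant,
      HasCompactSupport.intro h.2 fun _ hx => Set.indicator_of_notMem hx _⟩
  else 0

theorem coe_ind [T2Space Y] {S : Set Y} (h : IsOpen S) (h' : IsCompact S) :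
    (ind S : Y → ℂ) = S.indicator 1 := by
  rw [ind, dif_pos ⟨h, h'⟩]

theorem isCompact_support_schwartz (f : schwartz Y) : IsCompact (Function.support (f : Y → ℂ)) := by
  have hc : IsClosed (Function.support (f : Y → ℂ)) := (f.2.1.isClopen_fiber 0).compl.1
  have := f.2.2
  rwa [HasCompactSupport, tsupport, hc.closure_eq] at this

end Indicators

section Cosets

variable {F : Type*} [Field F] [ValuativeRel F] [TopologicalSpace F] [IsNonarchimedeanLocalField F]

/-- The indicator function of the coset `X + L`. -/
noncomputable def cosetInd (X : g F) (L : AddSubgroup (g F)) : schwartz (g F) := ind {Y | Y - X ∈ L}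

/-- `L` is a lattice: a compact open subgroup. -/
structure IsLat (L : AddSubgroup (g F)) : Prop where
  isOpen : IsOpen (L : Set (g F))
  isCompact : IsCompact (L : Set (g F))

theorem isLat_box (a b c : ℤ) : IsLat (box F a b c) := ⟨isOpen_box a b c, isCompact_box a b c⟩

theorem isLat_latGrp (x : Building F) (s : ℝ) : IsLat (latGrp F x s) :=
  ⟨isOpen_lat x s, isCompact_lat x s⟩

theorem isLat_latPlusGrp (x : Building F) (s : ℝ) : IsLat (latPlusGrp F x s) :=
  ⟨isOpen_latPlus x s, (isCompact_lat x s).of_isClosed_subset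
    (AddSubgroup.isClosed_of_isOpen (latPlusGrp F x s) (isOpen_latPlus x s)) (latPlus_subset_lat x s)⟩

theorem IsLat.map {L : AddSubgroup (g F)} (h : IsLat L) (k : G F) :
    IsLat (L.map (AdEquiv k).toAddMonoidHom) := by
  have hcoe : (L.map (AdEquiv k).toAddMonoidHom : Set (g F)) = Ad k⁻¹ ⁻¹' (L : Set (g F)) := by
    ext X
    constructor
    · rintro ⟨Z, hZ, rfl⟩
      change Ad k⁻¹ (Ad k Z) ∈ L
      rwa [Ad_inv_Ad]
    · intro hX
      exact ⟨Ad k⁻¹ X, hX, Ad_Ad_inv k X⟩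
  refine ⟨?_, ?_⟩
  · rw [hcoe]; exact h.isOpen.preimage (continuous_Ad _)
  · exact h.isCompact.image (continuous_Ad k)

theorem isOpen_coset {L : AddSubgroup (g F)} (h : IsLat L) (X : g F) : IsOpen {Y | Y - X ∈ L} :=
  h.isOpen.preimage (continuous_id.sub continuous_const)

theorem isCompact_coset {L : AddSubgroup (g F)} (h : IsLat L) (X : g F) :
    IsCompact {Y | Y - X ∈ L} := by
  convert h.isCompact.image (continuous_add_const X) using 1
  ext Y
  simp [sub_eq_add_neg]

open Classical in
theorem cosetInd_apply {L : AddSubgroup (g F)} (h : IsLat L) (X Y : g F) :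
    (cosetInd X L : g F → ℂ) Y = if Y - X ∈ L then 1 else 0 := by
  rw [cosetInd, coe_ind (isOpen_coset h X) (isCompact_coset h X), Set.indicator_apply]
  rfl

theorem cosetInd_apply_ne_zero {L : AddSubgroup (g F)} (h : IsLat L) {X Y : g F} :
    (cosetInd X L : g F → ℂ) Y ≠ 0 ↔ Y - X ∈ L := by
  classical
  rw [cosetInd_apply h]; split_ifs with h' <;> simp [h']

theorem cosetInd_congr {L : AddSubgroup (g F)} {X X' : g F} (h : X - X' ∈ L) :
    cosetInd X L = cosetInd X' L := by
  unfold cosetInd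
  congr 1; ext Y
  change Y - X ∈ L ↔ Y - X' ∈ L
  constructor
  · intro hY
    have := add_mem hY h
    rwa [sub_add_sub_cancel] at this
  · intro hY
    have := sub_mem hY h
    rwa [sub_sub_sub_cancel_right] at this

theorem cosetInd_mem_transInv {L : AddSubgroup (g F)} (h : IsLat L) (X : g F) :
    cosetInd X L ∈ transInv (L : Set (g F)) := by
  classical
  intro Y Z hZ
  rw [cosetInd_apply h, cosetInd_apply h]
  congr 1
  rw [add_sub_right_comm, AddSubgroup.add_mem_cancel_right L hZ]

/-- A function invariant under a lattice is a finite sum of indicators of cosets. -/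
theorem exists_sum_cosetInd {L : AddSubgroup (g F)} (h : IsLat L) {f : schwartz (g F)}
    (hf : f ∈ transInv (L : Set (g F))) : ∃ R : Finset (g F), (∀ c ∈ R, (f : g F → ℂ) c ≠ 0) ∧
      f = ∑ c ∈ R, (f : g F → ℂ) c • cosetInd c L := by
  classical
  have hd : DiscreteTopology (g F ⧸ L) := QuotientAddGroup.discreteTopology h.isOpen
  set π : g F → g F ⧸ L := fun X => (X : g F ⧸ L) with hπ
  have hfin : (π '' Function.support (f : g F → ℂ)).Finite :=
    ((isCompact_support_schwartz f).image continuous_quotient_mk').finite_of_discrete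
  have hcongr : ∀ X X', X - X' ∈ L → (f : g F → ℂ) X = (f : g F → ℂ) X' := by
    intro X X' hX
    have := hf X' _ hX
    rwa [add_sub_cancel] at this
  have hout : ∀ X, X - (π X).out ∈ L := by
    intro X
    have h1 : ((π X).out : g F ⧸ L) = X := Quotient.out_eq _
    rw [QuotientAddGroup.eq] at h1
    rwa [neg_add_eq_sub] at h1
  refine ⟨hfin.toFinset.image Quotient.out, ?_, ?_⟩
  · intro c hc
    obtain ⟨z, hz, rfl⟩ := Finset.mem_image.1 hc
    obtain ⟨X, hX, rfl⟩ := hfin.mem_toFinset.1 hz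
    rw [← hcongr _ _ (hout X)]; exact hX
  · rw [Finset.sum_image fun _ _ _ _ h => Quotient.out_injective h]
    ext Y
    rw [Submodule.coe_sum, Finset.sum_apply]
    simp only [Submodule.coe_smul, Pi.smul_apply, smul_eq_mul, cosetInd_apply h]
    by_cases hY : (f : g F → ℂ) Y = 0
    · rw [hY, Finset.sum_eq_zero]
      intro z _
      split_ifs with h'
      · rw [← hcongr _ _ h', hY, zero_mul]
      · rw [mul_zero]
    · refine ((Finset.sum_eq_single (π Y) ?_ ?_).trans ?_).symm
      · intro z _ hz
        rw [if_neg, mul_zero]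
        intro h'
        refine hz ?_
        have h1 : (z.out : g F ⧸ L) = Y := by
          rw [QuotientAddGroup.eq, neg_add_eq_sub]; exact h'
        exact (Quotient.out_eq z).symm.trans h1
      · intro h'
        exact absurd (hfin.mem_toFinset.2 ⟨Y, hY, rfl⟩) h'
      · rw [if_pos (hout Y), mul_one, hcongr _ _ (hout Y)]

theorem exists_cosetInd_eq_sum {L L' : AddSubgroup (g F)} (h : IsLat L) (h' : IsLat L') (hL : L ≤ L')
    (X : g F) : ∃ R : Finset (g F), R.Nonempty ∧ (∀ c ∈ R, c - X ∈ L') ∧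
      cosetInd X L' = ∑ c ∈ R, cosetInd c L := by
  classical
  have hf : cosetInd X L' ∈ transInv (L : Set (g F)) := fun Y Z hZ =>
    cosetInd_mem_transInv h' X Y Z (hL hZ)
  obtain ⟨R, hR, e⟩ := exists_sum_cosetInd h hf
  have hR' : ∀ c ∈ R, c - X ∈ L' := fun c hc => (cosetInd_apply_ne_zero h').1 (hR c hc)
  have e' : cosetInd X L' = ∑ c ∈ R, cosetInd c L := by
    refine e.trans (Finset.sum_congr rfl fun c hc => ?_)
    rw [cosetInd_apply h', if_pos (hR' c hc), one_smul]
  refine ⟨R, ?_, hR', e'⟩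
  rw [Finset.nonempty_iff_ne_empty]
  rintro rfl
  have : (cosetInd X L' : g F → ℂ) X ≠ 0 := (cosetInd_apply_ne_zero h').2 (by simp [zero_mem])
  exact this (by rw [e']; rfl)

variable {T : Module.Dual ℂ (schwartz (g F))}

theorem apply_cosetInd_Ad (hT : T ∈ invDist F) {L L' : AddSubgroup (g F)} (h : IsLat L)
    (h' : IsLat L') (k : G F) (hk : ∀ Y, Ad k Y ∈ L' ↔ Y ∈ L) (X : g F) :
    T (cosetInd X L) = T (cosetInd (Ad k X) L') := by
  classical
  refine hT k (cosetInd (Ad k X) L') (cosetInd X L) fun Y => ?_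
  rw [cosetInd_apply h, cosetInd_apply h', ← Ad_sub]
  simp only [hk]

/-- If all cosets of `L` in `X + L'` give the same value, it is zero when the value of `X + L'` is. -/
theorem apply_cosetInd_eq_zero_of_average {L L' : AddSubgroup (g F)} (h : IsLat L) (h' : IsLat L')
    (hL : L ≤ L') {X : g F} (hc : ∀ c, c - X ∈ L' → T (cosetInd c L) = T (cosetInd X L))
    (h0 : T (cosetInd X L') = 0) : T (cosetInd X L) = 0 := by
  obtain ⟨R, hne, hR, e⟩ := exists_cosetInd_eq_sum h h' hL X
  rw [e, map_sum, Finset.sum_congr rfl fun c hc' => hc c (hR c hc'), Finset.sum_const,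
    nsmul_eq_mul] at h0
  exact (mul_eq_zero.1 h0).resolve_left (by exact_mod_cast hne.card_pos.ne')

theorem apply_cosetInd_eq_zero_of_refine {L L' : AddSubgroup (g F)} (h : IsLat L) (h' : IsLat L')
    (hL : L ≤ L') {X : g F} (hc : ∀ c, c - X ∈ L' → T (cosetInd c L) = 0) :
    T (cosetInd X L') = 0 := by
  obtain ⟨R, -, hR, e⟩ := exists_cosetInd_eq_sum h h' hL X
  rw [e, map_sum, Finset.sum_eq_zero fun c hc' => hc c (hR c hc')]

theorem mem_JTilde_iff {r : ℝ} : T ∈ JTilde F r ↔ T ∈ invDist F ∧ ∀ (x : Building F) (s : ℝ), s ≤ r →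
    ∀ f ∈ latFun (lat x s) (latPlus x r), Disjoint (gPlus F s) (Function.support (f : g F → ℂ)) →
      T f = 0 := by
  simp only [JTilde, Submodule.mem_iInf]
  constructor
  · intro H
    exact ⟨(H (vtx F) r le_rfl).1, fun x s hs f hf hd => (H x s hs).2 f ⟨hf, hd⟩⟩
  · rintro ⟨hT, H⟩ x s hs
    exact ⟨hT, fun f hf => H x s hs f hf.1 hf.2⟩

theorem JTilde_anti {r r' : ℝ} (h : r ≤ r') : JTilde F r' ≤ JTilde F r := by
  intro T hT
  rw [mem_JTilde_iff] at hT ⊢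
  exact ⟨hT.1, fun x s hs f hf hd => hT.2 x s (hs.trans h) f
    ⟨fun X Z hZ => hf.1 X Z (latPlus_anti x h hZ), hf.2⟩ hd⟩

/-- Membership in `gPlus s` only depends on the coset modulo `latPlus x s`. -/
theorem mem_gPlus_of_sub_mem {x : Building F} {s : ℝ} {X X' : g F} (hX : X ∈ lat x s)
    (hX' : X' ∈ gPlus F s) (h : X - X' ∈ latPlus x s) : X ∈ gPlus F s := by
  rw [mem_gPlus_iff] at hX' ⊢
  set Z := X - X' with hZ
  have hXe : X' = X - Z := by rw [hZ]; abel
  have ht := trace_mem_of_mem_latPlus h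
  have hd := det_mem_of_mem_latPlus h
  have hp := trace_mem_of_mem_latPlus (mul_mem_latPlus_right hX h)
  rw [← two_mul] at hp
  have htX : X.trace ∈ pw F (⌊s⌋ + 1) := by
    have : X = X' + Z := by rw [hZ]; abel
    rw [this, Matrix.trace_add]; exact add_mem hX'.1 ht
  refine ⟨htX, ?_⟩
  -- Polarization of the determinant: each correction term has valuation above 2s, the mixed trace
  -- because X * Z lies in g_{x,(2s)+}.
  have e : X.det = X'.det - Z.det + (X.trace * Z.trace - (X * Z).trace) := by
    rw [hXe]
    simp only [Matrix.det_fin_two, Matrix.trace_fin_two, Matrix.mul_apply, Fin.sum_univ_two,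
      Matrix.sub_apply]
    ring
  rw [e]
  refine add_mem (sub_mem hX'.2 hd) (sub_mem (mul_mem_pw' htX ht ?_) hp)
  have := Int.le_floor_add_floor s s
  rw [← two_mul] at this
  omega

/-- The form in which the defining condition of `JTilde` enters the descent. Membership in g_{s+} is
constant on X + L when L lies in g_{x,s+}, so testing X alone suffices. -/
theorem apply_cosetInd_eq_zero_of_notMem {r : ℝ} (hT : T ∈ JTilde F r) {L : AddSubgroup (g F)}
    (hL : IsLat L) (x : Building F) {s : ℝ} (hs : s ≤ r) {X : g F} (hX : X ∈ lat x s)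
    (hXs : X ∉ gPlus F s) (h : latPlus x r ⊆ L) (h' : (L : Set (g F)) ⊆ latPlus x s) :
    T (cosetInd X L) = 0 := by
  rw [mem_JTilde_iff] at hT
  refine hT.2 x s hs _ ⟨fun Y Z hZ => cosetInd_mem_transInv hL X Y Z (h hZ), fun Y hY => ?_⟩ ?_
  · have h1 := latPlus_subset_lat x s (h' ((cosetInd_apply_ne_zero hL).1 hY))
    have := (latGrp F x s).add_mem h1 hX
    rwa [sub_add_cancel] at this
  · rw [Set.disjoint_left]
    intro Y hY hY'
    have h1 := h' ((cosetInd_apply_ne_zero hL).1 hY')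
    refine hXs (mem_gPlus_of_sub_mem hX hY ?_)
    rw [← neg_sub]; exact (latPlusGrp F x s).neg_mem h1

end Cosets

end GLTwo

namespace GLTwo

/-! ### Descent of cosets towards zero. -/

section Descent

variable {F : Type*} [Field F] [ValuativeRel F] [TopologicalSpace F] [IsNonarchimedeanLocalField F]

theorem inv_mem_pw_zero {u : F} (hu : u ∉ pw F 1) : u⁻¹ ∈ pw F 0 := by
  have := inv_mem_pw (F := F) (n := 0) (a := u) (by simpa using hu)
  simpa using this

/-- Conjugation by an element of `GL(2, O)` preserves the balls. -/
theorem Ad_mkG_mem_ball {a b c d : F} (h : a * d - b * c ∉ pw F 1) (ha : a ∈ pw F 0)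
    (hb : b ∈ pw F 0) (hc : c ∈ pw F 0) (hd : d ∈ pw F 0) (m : ℤ) (h0 : a * d - b * c ≠ 0) (Y : g F) :
    Ad (mkG a b c d h0) Y ∈ box F m m m ↔ Y ∈ box F m m m := by
  have h1 : (mkG a b c d h0 : g F) ∈ box F 0 0 0 := ⟨ha, hb, hc, hd⟩
  have h2 : (((mkG a b c d h0)⁻¹ : G F) : g F) ∈ box F 0 0 0 := by
    rw [coe_inv_mkG]
    have hu := inv_mem_pw_zero h
    exact ⟨mul_mem_pw' hu hd, mul_mem_pw' hu (neg_mem hb), mul_mem_pw' hu (neg_mem hc),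
      mul_mem_pw' hu ha⟩
  refine Ad_mem_iff_of_forall (fun Y hY => ?_) (fun Y hY => ?_) Y
  · exact mul_mem_box (mul_mem_box h1 hY (u := m) (v := m) (w := m)) h2
  · unfold Ad
    rw [inv_inv]
    exact mul_mem_box (mul_mem_box h2 hY (u := m) (v := m) (w := m)) h1

/-- Conjugation by a unit of the Iwahori order preserves its filtration. -/
theorem Ad_mkG_mem_iwahori {a b c d : F} (h : a * d - b * c ∉ pw F 1) (ha : a ∈ pw F 0)
    (hb : b ∈ pw F 0) (hc : c ∈ pw F 1) (hd : d ∈ pw F 0) (m : ℤ) (h0 : a * d - b * c ≠ 0) (Y : g F) :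
    Ad (mkG a b c d h0) Y ∈ box F m m (m + 1) ↔ Y ∈ box F m m (m + 1) := by
  have h1 : (mkG a b c d h0 : g F) ∈ box F 0 0 1 := ⟨ha, hb, hc, hd⟩
  have h2 : (((mkG a b c d h0)⁻¹ : G F) : g F) ∈ box F 0 0 1 := by
    rw [coe_inv_mkG]
    have hu := inv_mem_pw_zero h
    exact ⟨mul_mem_pw' hu hd, mul_mem_pw' hu (neg_mem hb), mul_mem_pw' hu (neg_mem hc),
      mul_mem_pw' hu ha⟩
  refine Ad_mem_iff_of_forall (fun Y hY => ?_) (fun Y hY => ?_) Y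
  · exact mul_mem_box (mul_mem_box h1 hY (u := m) (v := m) (w := m + 1)) h2
  · unfold Ad
    rw [inv_inv]
    exact mul_mem_box (mul_mem_box h2 hY (u := m) (v := m) (w := m + 1)) h1

theorem ne_zero_of_notMem {n : ℤ} {a : F} (h : a ∉ pw F n) : a ≠ 0 := fun h0 => h (h0 ▸ zero_mem _)

theorem unif_zpow_ne_zero (n : ℤ) : unif F ^ n ≠ 0 := zpow_ne_zero n (unif_ne_zero F)

/-- The scaled companion form of a matrix with a unit upper right entry. -/
theorem Ad_inv_eq_companion {j : ℤ} (X : g F) (k : G F)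
    (h : X * (k : g F) = (k : g F) * !![0, unif F ^ j; -(unif F ^ (-j) * X.det), X.trace]) :
    Ad k⁻¹ X = !![0, unif F ^ j; -(unif F ^ (-j) * X.det), X.trace] := by
  unfold Ad
  rw [inv_inv, mul_assoc, h, ← mul_assoc]; simp

theorem scaled_det_notMem {j : ℤ} {b : F} (hb : b ∉ pw F (j + 1)) : unif F ^ (-j) * b ∉ pw F 1 := by
  rw [unif_zpow_mul_mem]; simpa [add_comm] using hb

/-- Rescaled by ϖ^(-j), the change of basis of `exists_companion` is a unit of the Iwahori order,
since the upper right entry has exact valuation j and the upper left one a larger valuation. Hence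
the cosets of the lattices concerned are preserved. -/
theorem exists_companion_iwahori {j : ℤ} {X : g F} (h00 : X 0 0 ∈ pw F (j + 1))
    (h01 : X 0 1 ∈ pw F j) (h : X 0 1 ∉ pw F (j + 1)) : ∃ k : G F,
      (∀ m Y, Ad k Y ∈ box F m m (m + 1) ↔ Y ∈ box F m m (m + 1)) ∧
      Ad k⁻¹ X = !![0, unif F ^ j; -(unif F ^ (-j) * X.det), X.trace] := by
  have hu := scaled_det_notMem h
  have hd : unif F ^ (-j) * X 0 1 * 1 - 0 * -(unif F ^ (-j) * X 0 0) = unif F ^ (-j) * X 0 1 := by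
    ring
  have h0 : unif F ^ (-j) * X 0 1 * 1 - 0 * -(unif F ^ (-j) * X 0 0) ≠ 0 := by
    rw [hd]; exact ne_zero_of_notMem hu
  refine ⟨mkG (unif F ^ (-j) * X 0 1) 0 (-(unif F ^ (-j) * X 0 0)) 1 h0, fun m Y =>
    Ad_mkG_mem_iwahori (by rwa [hd]) (unif_zpow_mul_mem.2 (by simpa using h01)) (zero_mem _)
      (neg_mem (unif_zpow_mul_mem.2 (pw_anti (by omega) h00))) one_mem_pw m h0 Y,
    Ad_inv_eq_companion _ _ ?_⟩
  have hz := unif_zpow_ne_zero (F := F) j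
  rw [coe_mkG, Matrix.det_fin_two, Matrix.trace_fin_two]
  refine ext_g ?_ ?_ ?_ ?_ <;>
    simp only [Matrix.mul_apply, Fin.sum_univ_two, Matrix.of_apply, Matrix.cons_val', zpow_neg,
      Matrix.cons_val_zero, Matrix.cons_val_one, Matrix.cons_val_fin_one] <;> field_simp <;> ring

/-- An off-diagonal entry of exact valuation j makes a standard basis vector cyclic over the
integers, so the change of basis lies in GL(2, O). -/
theorem exists_companion_ball {j : ℤ} {X : g F} (hX : X ∈ box F j j j)
    (h : X 1 0 ∉ pw F (j + 1) ∨ X 0 1 ∉ pw F (j + 1)) : ∃ k : G F,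
      (∀ m Y, Ad k Y ∈ box F m m m ↔ Y ∈ box F m m m) ∧
      Ad k⁻¹ X = !![0, unif F ^ j; -(unif F ^ (-j) * X.det), X.trace] := by
  obtain ⟨h00, h01, h10, h11⟩ := hX
  have hz := unif_zpow_ne_zero (F := F) j
  have hs : ∀ {a : F}, a ∈ pw F j → unif F ^ (-j) * a ∈ pw F 0 := fun ha =>
    unif_zpow_mul_mem.2 (by simpa using ha)
  rcases h with h | h
  · have hu := scaled_det_notMem h
    have hd : -(unif F ^ (-j) * X 1 1) * 0 - 1 * (unif F ^ (-j) * X 1 0) =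
        -(unif F ^ (-j) * X 1 0) := by ring
    have hu' : -(unif F ^ (-j) * X 1 1) * 0 - 1 * (unif F ^ (-j) * X 1 0) ∉ pw F 1 := by
      rwa [hd, neg_mem_iff]
    refine ⟨mkG (-(unif F ^ (-j) * X 1 1)) 1 (unif F ^ (-j) * X 1 0) 0 (ne_zero_of_notMem hu'),
      fun m Y => Ad_mkG_mem_ball hu' (neg_mem (hs h11)) one_mem_pw (hs h10) (zero_mem _) m _ Y,
      Ad_inv_eq_companion _ _ ?_⟩
    rw [coe_mkG, Matrix.det_fin_two, Matrix.trace_fin_two]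
    refine ext_g ?_ ?_ ?_ ?_ <;>
      simp only [Matrix.mul_apply, Fin.sum_univ_two, Matrix.of_apply, Matrix.cons_val', zpow_neg,
        Matrix.cons_val_zero, Matrix.cons_val_one, Matrix.cons_val_fin_one] <;> field_simp <;> ring
  · have hu := scaled_det_notMem h
    have hd : unif F ^ (-j) * X 0 1 * 1 - 0 * -(unif F ^ (-j) * X 0 0) = unif F ^ (-j) * X 0 1 := by
      ring
    have hu' : unif F ^ (-j) * X 0 1 * 1 - 0 * -(unif F ^ (-j) * X 0 0) ∉ pw F 1 := by
      rwa [hd]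
    refine ⟨mkG (unif F ^ (-j) * X 0 1) 0 (-(unif F ^ (-j) * X 0 0)) 1 (ne_zero_of_notMem hu'),
      fun m Y => Ad_mkG_mem_ball hu' (hs h01) (zero_mem _) (neg_mem (hs h00)) one_mem_pw m _ Y,
      Ad_inv_eq_companion _ _ ?_⟩
    rw [coe_mkG, Matrix.det_fin_two, Matrix.trace_fin_two]
    refine ext_g ?_ ?_ ?_ ?_ <;>
      simp only [Matrix.mul_apply, Fin.sum_univ_two, Matrix.of_apply, Matrix.cons_val', zpow_neg,
        Matrix.cons_val_zero, Matrix.cons_val_one, Matrix.cons_val_fin_one] <;> field_simp <;> ring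

theorem Ad_diag_mem_box {u : F} (hu : u ∈ pw F 0) (hu' : u ∉ pw F 1) (h : u * 1 - 0 * 0 ≠ 0)
    (a b c : ℤ) (Y : g F) : Ad (mkG u 0 0 1 h) Y ∈ box F a b c ↔ Y ∈ box F a b c := by
  have hi := inv_mem_pw_zero hu'
  have h0 := ne_zero_of_notMem hu'
  rw [Ad_mkG_diag, mem_box, mem_box]
  simp only [Matrix.of_apply, Matrix.cons_val', Matrix.cons_val_zero, Matrix.cons_val_one,
    Matrix.cons_val_fin_one, inv_one, mul_one, one_mul]
  have e1 : u * Y 0 1 ∈ pw F b ↔ Y 0 1 ∈ pw F b := by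
    refine ⟨fun hY => ?_, fun hY => mul_mem_pw' hu hY⟩
    have := mul_mem_pw' hi hY (k := b)
    rwa [inv_mul_cancel_left₀ h0] at this
  have e2 : Y 1 0 * u⁻¹ ∈ pw F c ↔ Y 1 0 ∈ pw F c := by
    refine ⟨fun hY => ?_, fun hY => mul_mem_pw' hY hi⟩
    have := mul_mem_pw' hY hu (k := c)
    rwa [inv_mul_cancel_right₀ h0] at this
  rw [e1, e2]

variable {T : Module.Dual ℂ (schwartz (g F))}

theorem one_add_unit {z : F} (hz : z ∈ pw F 1) : 1 + z ∈ pw F 0 ∧ 1 + z ∉ pw F 1 := by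
  refine ⟨add_mem one_mem_pw (pw_anti (by norm_num) hz), fun h => ?_⟩
  have h1 : (1 : F) ∈ pw F 1 := by simpa using sub_mem h hz
  rw [mem_pw, nabs_one, zpow_neg_one] at h1
  exact absurd h1 (not_le.2 (inv_lt_one_of_one_lt₀ (one_lt_q F)))

/-- Enlarging the lattice in the direction of the upper right entry. -/
theorem apply_companion_eq_zero (hT : T ∈ invDist F) {j m l : ℤ} (hj : j + 1 < m) {γ δ : F}
    (hγ : γ ∈ pw F (l - (m - 1 - j)))
    (h0 : T (cosetInd !![0, unif F ^ j; γ, δ] (box F m (m - 1) l)) = 0) :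
    T (cosetInd !![0, unif F ^ j; γ, δ] (box F m m l)) = 0 := by
  refine apply_cosetInd_eq_zero_of_average (isLat_box _ _ _) (isLat_box _ _ _) box_mono ?_ h0
  rintro c ⟨c1, c2, c3, c4⟩
  simp only [Matrix.sub_apply, Matrix.of_apply, Matrix.cons_val', Matrix.cons_val_zero,
    Matrix.cons_val_one, Matrix.cons_val_fin_one] at c1 c2 c3 c4
  -- z is chosen so that (1 + z)ϖ^j is the upper right entry of c. Conjugation by diag(1 + z, 1)
  -- then carries one coset to the other; the lower left entry moves by γ z / (1 + z), which `hγ`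
  -- puts in P^l. The condition j + 1 < m makes 1 + z a unit.
  set z := unif F ^ (-j) * (c 0 1 - unif F ^ j) with hz
  have hzm : z ∈ pw F (m - 1 - j) := unif_zpow_mul_mem.2 (pw_anti (by omega) c2)
  obtain ⟨u1, u2⟩ := one_add_unit (pw_anti (by omega) hzm)
  have hu0 := ne_zero_of_notMem u2
  have hne : (1 + z) * 1 - 0 * 0 ≠ 0 := by simpa using hu0
  rw [apply_cosetInd_Ad hT (isLat_box m m l) (isLat_box m m l) (mkG (1 + z) 0 0 1 hne)
    (Ad_diag_mem_box u1 u2 hne m m l) !![0, unif F ^ j; γ, δ]]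
  congr 1
  refine cosetInd_congr ?_
  have hzj : z * unif F ^ j = c 0 1 - unif F ^ j := by
    rw [hz, mul_right_comm, ← zpow_add₀ (unif_ne_zero F), neg_add_cancel, zpow_zero, one_mul]
  rw [Ad_mkG_diag]
  refine ⟨?_, ?_, ?_, ?_⟩ <;>
    simp only [Matrix.sub_apply, Matrix.of_apply, Matrix.cons_val', Matrix.cons_val_zero,
      Matrix.cons_val_one, Matrix.cons_val_fin_one, inv_one, mul_one, one_mul]
  · exact c1
  · rw [add_mul, one_mul, hzj]; simp [zero_mem]
  · have e : c 1 0 - γ * (1 + z)⁻¹ = (c 1 0 - γ) + γ * z * (1 + z)⁻¹ := by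
      field_simp; ring
    rw [e]
    exact add_mem c3 (mul_mem_pw' (mul_mem_pw hγ hzm) (inv_mem_pw_zero u2))
  · exact c4

/-- If one number had valuation at most j, the product would make the other deeper and the sum would
then exclude this. No square root or division by 2 is involved. -/
theorem mem_pw_of_sum_of_prod {j : ℤ} {a d : F} (ht : a + d ∈ pw F (j + 1))
    (hp : a * d ∈ pw F (2 * j + 1)) : a ∈ pw F (j + 1) ∧ d ∈ pw F (j + 1) := by
  have key : ∀ a d : F, a + d ∈ pw F (j + 1) → a * d ∈ pw F (2 * j + 1) → a ∈ pw F (j + 1) := by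
    intro a d ht hp
    by_contra hn
    have hd := mem_pw_of_mul_mem (m := j) (n := j + 1) (by convert hp using 2; ring) hn
    exact hn (by simpa using sub_mem ht hd)
  exact ⟨key a d ht hp, key d a (add_comm a d ▸ ht) (mul_comm a d ▸ hp)⟩

/-- Induction on how far X lies outside of the ball of exponent m. At leading order X is either not
nilpotent, and T kills the coset, or nonzero nilpotent, and the coset is traded for cosets one step
closer to zero. -/
theorem apply_cosetInd_ball_eq_zero {m : ℤ} (hT : T ∈ JTilde F ((m - 1 : ℤ) : ℝ))
    (h1 : T (cosetInd 0 (box F m m m)) = 0)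
    (h2 : T (cosetInd !![0, unif F ^ (m - 1); 0, 0] (box F m m m)) = 0) (X : g F) :
    T (cosetInd X (box F m m m)) = 0 := by
  have hinv : T ∈ invDist F := (mem_JTilde_iff.1 hT).1
  suffices H : ∀ (n : ℕ) (X : g F), X ∈ box F (m - n) (m - n) (m - n) →
      T (cosetInd X (box F m m m)) = 0 by
    obtain ⟨n, hn⟩ := exists_ball_mem X
    exact H (m - n).toNat X (box_mono (by omega) (by omega) (by omega) hn)
  intro n
  induction n with
  | zero =>
    intro X hX
    rw [cosetInd_congr (X' := 0) (by simpa using hX), h1]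
  | succ n ih =>
    intro X hX
    obtain ⟨j, hj⟩ : ∃ j : ℤ, j = m - (n + 1 : ℕ) := ⟨_, rfl⟩
    rw [← hj] at hX
    have hj' : m - n = j + 1 := by rw [hj]; push_cast; ring
    rw [hj'] at ih
    have hjm : j + 1 ≤ m := by omega
    by_cases hX1 : X ∈ box F (j + 1) (j + 1) (j + 1)
    · exact ih X hX1
    by_cases hXs : X ∈ gPlus F (j : ℝ)
    swap
    · refine apply_cosetInd_eq_zero_of_notMem hT (isLat_box _ _ _) (vtx F) (s := (j : ℝ)) ?_ ?_ hXs ?_ ?_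
      · exact_mod_cast (by omega : j ≤ m - 1)
      · rw [lat_vtx]; exact hX
      · rw [latPlus_vtx]; exact box_mono
      · rw [latPlus_vtx]; exact box_mono
    rw [mem_gPlus_iff, Int.floor_intCast,
      show (2 * (j : ℝ)) = ((2 * j : ℤ) : ℝ) by push_cast; ring, Int.floor_intCast] at hXs
    obtain ⟨ht, hd⟩ := hXs
    -- The reduction ϖ^(-j)X is nilpotent and nonzero over the residue field, so it has a nonzero
    -- off-diagonal entry.
    have hprim : X 1 0 ∉ pw F (j + 1) ∨ X 0 1 ∉ pw F (j + 1) := by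
      by_contra hcon
      push Not at hcon
      have hp : X 0 0 * X 1 1 ∈ pw F (2 * j + 1) := by
        have := add_mem hd (mul_mem_pw' hcon.2 hcon.1 (k := 2 * j + 1))
        rwa [Matrix.det_fin_two, sub_add_cancel] at this
      rw [Matrix.trace_fin_two] at ht
      obtain ⟨ha, hd'⟩ := mem_pw_of_sum_of_prod ht hp
      exact hX1 ⟨ha, hcon.2, hcon.1, hd'⟩
    obtain ⟨k, hk, hkX⟩ := exists_companion_ball hX hprim
    rw [apply_cosetInd_Ad hinv (isLat_box m m m) (isLat_box m m m) k⁻¹ (Ad_inv_mem_iff (hk m)), hkX]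
    set γ := -(unif F ^ (-j) * X.det) with hγ
    set δ := X.trace with hδ
    have hγ1 : γ ∈ pw F (j + 1) := neg_mem (unif_zpow_mul_mem.2 (pw_anti (by omega) hd))
    rcases hjm.eq_or_lt with hjm | hjm
    · have : j = m - 1 := by omega
      subst this
      rw [cosetInd_congr (X' := !![0, unif F ^ (m - 1); 0, 0]), h2]
      refine ⟨?_, ?_, ?_, ?_⟩ <;> simp [zero_mem]
      · simpa using hγ1
      · simpa using ht
    refine apply_companion_eq_zero hinv hjm (pw_anti (by omega) hγ1) ?_
    -- If γ is deep, diag(ϖ, 1) balances the two off-diagonal entries and carries the pieces into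
    -- the ball of exponent j + 1. If not, the determinant has exact valuation 2j + 1, and the
    -- midpoint of the edge at depth j + 1/2 detects that the matrix is not nilpotent to leading
    -- order.
    by_cases hγ2 : γ ∈ pw F (j + 2)
    · refine apply_cosetInd_eq_zero_of_refine (isLat_box m (m - 1) (m + 1)) (isLat_box _ _ _)
        box_mono fun c hc => ?_
      rw [apply_cosetInd_Ad hinv (isLat_box m (m - 1) (m + 1)) (isLat_box m m m) (dg 1)
        fun Y => Ad_dg_mem_box]
      refine ih _ (Ad_dg_mem_box.2 ?_)
      have hX' : (!![0, unif F ^ j; γ, δ] : g F) ∈ box F (j + 1) (j + 1 - 1) (j + 1 + 1) :=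
        ⟨zero_mem _, by simpa using unif_zpow_mem j, pw_anti (by omega) hγ2, ht⟩
      have := add_mem (box_mono (F := F) (by omega) (by omega) (by omega) hc) hX'
      rwa [sub_add_cancel] at this
    · refine apply_cosetInd_eq_zero_of_notMem hT (isLat_box _ _ _) (mid F) (s := j + 1 / 2) ?_ ?_ ?_ ?_ ?_
      · have : (j : ℝ) + 1 ≤ (m - 1 : ℤ) := by exact_mod_cast (by omega : j + 1 ≤ m - 1)
        linarith
      · rw [lat_mid_half]
        exact ⟨zero_mem _, unif_zpow_mem j, hγ1, ht⟩
      · rw [mem_gPlus_iff, show 2 * ((j : ℝ) + 1 / 2) = ((2 * j + 1 : ℤ) : ℝ) by push_cast; ring,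
          Int.floor_intCast, Matrix.det_fin_two_of, zero_mul, zero_sub, neg_mem_iff]
        rintro ⟨-, h⟩
        rw [unif_zpow_mul_mem] at h
        exact hγ2 (pw_anti (by omega) h)
      · rw [latPlus_mid_int]; exact box_mono
      · rw [latPlus_mid_half]; exact box_mono

/-- The element that normalizes the standard Iwahori subgroup. -/
noncomputable def iwFlip : G F := mkG 0 1 (unif F) 0 (by simpa using unif_ne_zero F)

theorem Ad_flip (X : g F) :
    Ad iwFlip X = !![X 1 1, (unif F)⁻¹ * X 1 0; unif F * X 0 1, X 0 0] := by
  have h0 := unif_ne_zero F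
  rw [Ad_eq_iff, iwFlip, coe_mkG]
  refine ext_g ?_ ?_ ?_ ?_ <;> simp [Matrix.mul_apply, Fin.sum_univ_two, h0, mul_comm]

theorem Ad_flip_mem_box {a b c : ℤ} {X : g F} :
    Ad iwFlip X ∈ box F a b c ↔ X ∈ box F a (c - 1) (b + 1) := by
  rw [Ad_flip, mem_box, mem_box]
  have e1 : (unif F)⁻¹ * X 1 0 ∈ pw F b ↔ X 1 0 ∈ pw F (b + 1) := by
    rw [← zpow_neg_one, unif_zpow_mul_mem, sub_neg_eq_add]
  have e2 : unif F * X 0 1 ∈ pw F c ↔ X 0 1 ∈ pw F (c - 1) := by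
    have := unif_zpow_mul_mem (F := F) (k := 1) (n := c) (a := X 0 1)
    rwa [zpow_one] at this
  simp only [Matrix.of_apply, Matrix.cons_val', Matrix.cons_val_zero, Matrix.cons_val_one,
    Matrix.cons_val_fin_one, e1, e2]
  tauto

theorem apply_cosetInd_flip (hT : T ∈ invDist F) (m : ℤ) (X : g F) :
    T (cosetInd X (box F m m (m + 1))) = T (cosetInd (Ad iwFlip X) (box F m m (m + 1))) :=
  apply_cosetInd_Ad hT (isLat_box _ _ _) (isLat_box _ _ _) iwFlip (fun Y => by
    rw [Ad_flip_mem_box, add_sub_cancel_right]) X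

-- At the midpoint of an edge there are two nilpotent directions, exchanged by `iwFlip`. The vertex
-- case supplies vanishing on all cosets of the ball; since a conjugate of that ball contains the
-- Iwahori lattice, one enlargement finishes each nilpotent case.
set_option maxHeartbeats 1000000 in
theorem apply_cosetInd_iwahori_eq_zero {m : ℤ} (hT : T ∈ JTilde F ((m - 1 : ℤ) + 1 / 2 : ℝ))
    (h1 : T (cosetInd 0 (box F m m (m + 1))) = 0)
    (h2 : T (cosetInd !![0, unif F ^ (m - 1); 0, 0] (box F m m (m + 1))) = 0) (X : g F) :
    T (cosetInd X (box F m m (m + 1))) = 0 := by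
  have hinv : T ∈ invDist F := (mem_JTilde_iff.1 hT).1
  have hT' : T ∈ JTilde F ((m - 1 : ℤ) : ℝ) := JTilde_anti (by linarith) hT
  -- Diagonal units rescale E to any upper right entry of exact valuation m - 1, so the two given
  -- values cover all of these cosets.
  have hbase : ∀ Y ∈ box F m (m - 1) (m + 1), T (cosetInd Y (box F m m (m + 1))) = 0 := by
    rintro Y ⟨y1, y2, y3, y4⟩
    by_cases hY : Y 0 1 ∈ pw F m
    · rw [cosetInd_congr (X' := 0), h1]
      exact ⟨by simpa using y1, by simpa using hY, by simpa using y3, by simpa using y4⟩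
    have hY' : Y 0 1 ∉ pw F (m - 1 + 1) := by simpa using hY
    have hu := scaled_det_notMem hY'
    have hu1 : unif F ^ (-(m - 1)) * Y 0 1 ∈ pw F 0 := unif_zpow_mul_mem.2 (by simpa using y2)
    have hne : unif F ^ (-(m - 1)) * Y 0 1 * 1 - 0 * 0 ≠ 0 := by simpa using ne_zero_of_notMem hu
    rw [cosetInd_congr (X' := Ad (mkG _ 0 0 1 hne) !![0, unif F ^ (m - 1); 0, 0]),
      ← apply_cosetInd_Ad hinv (isLat_box _ _ _) (isLat_box _ _ _) _
        (Ad_diag_mem_box hu1 hu hne m m (m + 1)), h2]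
    rw [Ad_mkG_diag]
    refine ⟨by simpa using y1, ?_, by simpa using y3, by simpa using y4⟩
    have e : unif F ^ (-(m - 1)) * Y 0 1 * unif F ^ (m - 1) = Y 0 1 := by
      rw [mul_right_comm, ← zpow_add₀ (unif_ne_zero F), neg_add_cancel, zpow_zero, one_mul]
    simp only [Matrix.sub_apply, Matrix.of_apply, Matrix.cons_val', Matrix.cons_val_zero,
      Matrix.cons_val_one, Matrix.cons_val_fin_one, inv_one, mul_one, e, sub_self]
    exact zero_mem _
  -- The two initial values of the vertex case are sums over Iwahori cosets. Each piece is a base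
  -- coset up to the flip, or it has both off-diagonal entries nonzero at leading order and is
  -- killed at depth m - 1/2.
  have hball : ∀ X, T (cosetInd X (box F m m m)) = 0 := by
    refine apply_cosetInd_ball_eq_zero hT' ?_ ?_
    · refine apply_cosetInd_eq_zero_of_refine (isLat_box m m (m + 1)) (isLat_box _ _ _) box_mono
        fun c hc => ?_
      rw [sub_zero] at hc
      rw [apply_cosetInd_flip hinv]
      refine hbase _ (Ad_flip_mem_box.2 (box_mono (by omega) (by omega) (by omega) hc))
    · refine apply_cosetInd_eq_zero_of_refine (isLat_box m m (m + 1)) (isLat_box _ _ _) box_mono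
        fun c hc => ?_
      have hE : (!![0, unif F ^ (m - 1); 0, 0] : g F) ∈ box F m (m - 1) m :=
        ⟨zero_mem _, unif_zpow_mem _, zero_mem _, zero_mem _⟩
      have hcm : c ∈ box F m (m - 1) m := by
        have := add_mem (box_mono (F := F) (by omega) (by omega) (by omega) hc) hE
        rwa [sub_add_cancel] at this
      by_cases h10 : c 1 0 ∈ pw F (m + 1)
      · exact hbase c ⟨hcm.1, hcm.2.1, h10, hcm.2.2.2⟩
      have h01 : c 0 1 ∉ pw F m := by
        intro h
        have h3 := sub_mem h hc.2.1
        simp only [Matrix.sub_apply, Matrix.of_apply, Matrix.cons_val', Matrix.cons_val_zero,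
          Matrix.cons_val_one, Matrix.cons_val_fin_one, sub_sub_cancel] at h3
        rw [← mul_one (unif F ^ (m - 1)), unif_zpow_mul_mem, sub_sub_cancel] at h3
        have h4 := (one_add_unit (zero_mem (pw F 1))).2
        rw [add_zero] at h4
        exact h4 h3
      refine apply_cosetInd_eq_zero_of_notMem hT (isLat_box _ _ _) (mid F) le_rfl ?_ ?_ ?_ ?_
      · rw [lat_mid_half]
        exact box_mono (by omega) (by omega) (by omega) hcm
      · rw [mem_gPlus_iff, show 2 * (((m - 1 : ℤ) : ℝ) + 1 / 2) = ((2 * m - 1 : ℤ) : ℝ) by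
          push_cast; ring, Int.floor_intCast]
        rintro ⟨-, h⟩
        have h5 : c 0 1 * c 1 0 ∈ pw F (m - 1 + (m + 1)) := by
          have := sub_mem (mul_mem_pw hcm.1 hcm.2.2.2) (pw_anti (by omega) h)
          rw [Matrix.det_fin_two, sub_sub_cancel] at this
          exact pw_anti (by omega) this
        exact h10 (mem_pw_of_mul_mem h5 (by simpa using h01))
      · rw [latPlus_mid_half]; exact box_mono
      · rw [latPlus_mid_half]; exact box_mono
  -- The upper right entry dominates here. After passing to companion form, the lattice enlarged in
  -- this direction is the conjugate by `dg 1` of a ball, where `hball` applies.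
  have hstep : ∀ (j : ℤ) (X : g F), j + 1 ≤ m → X ∈ box F (j + 1) j (j + 2) → X 0 1 ∉ pw F (j + 1) →
      T (cosetInd X (box F m m (m + 1))) = 0 := by
    intro j X hjm hX h01
    rcases hjm.eq_or_lt with hjm | hjm
    · exact hbase X (box_mono (by omega) (by omega) (by omega) hX)
    obtain ⟨k, hk, hkX⟩ := exists_companion_iwahori hX.1 hX.2.1 h01
    rw [apply_cosetInd_Ad hinv (isLat_box m m (m + 1)) (isLat_box m m (m + 1)) k⁻¹
      (Ad_inv_mem_iff (hk m)), hkX]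
    have hd : X.det ∈ pw F (2 * j + 2) := by
      rw [Matrix.det_fin_two]
      exact sub_mem (mul_mem_pw' hX.1 hX.2.2.2) (mul_mem_pw' hX.2.1 hX.2.2.1)
    refine apply_companion_eq_zero hinv hjm
      (neg_mem (unif_zpow_mul_mem.2 (pw_anti (by omega) hd))) ?_
    rw [apply_cosetInd_Ad hinv (isLat_box m (m - 1) (m + 1)) (isLat_box m m m) (dg 1)
        fun Y => Ad_dg_mem_box]
    exact hball _
  suffices H : ∀ (n : ℕ) (X : g F), X ∈ box F (m - n) (m - n) (m - n + 1) →
      T (cosetInd X (box F m m (m + 1))) = 0 by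
    obtain ⟨n, hn⟩ := exists_ball_mem X
    exact H (m + 1 - n).toNat X (box_mono (by omega) (by omega) (by omega) hn)
  intro n
  induction n with
  | zero =>
    intro X hX
    rw [cosetInd_congr (X' := 0) (by simpa using hX), h1]
  | succ n ih =>
    intro X hX
    obtain ⟨j, hj⟩ : ∃ j : ℤ, j = m - (n + 1 : ℕ) := ⟨_, rfl⟩
    rw [← hj] at hX
    have hj' : m - n = j + 1 := by rw [hj]; push_cast; ring
    rw [hj'] at ih
    have hjm : j + 1 ≤ m := by omega
    have hjr : (j : ℝ) ≤ (m - 1 : ℤ) := by exact_mod_cast (by omega : j ≤ m - 1)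
    by_cases hXs : X ∈ gPlus F (j : ℝ)
    swap
    · refine apply_cosetInd_eq_zero_of_notMem hT (isLat_box _ _ _) (mid F) (s := (j : ℝ)) ?_ ?_ hXs ?_ ?_
      · linarith
      · rw [lat_mid_int]; exact hX
      · rw [latPlus_mid_half]; exact box_mono
      · rw [latPlus_mid_int]; exact box_mono
    rw [mem_gPlus_iff, Int.floor_intCast,
      show (2 * (j : ℝ)) = ((2 * j : ℤ) : ℝ) by push_cast; ring, Int.floor_intCast] at hXs
    obtain ⟨ht, hd⟩ := hXs
    obtain ⟨ha, hd'⟩ : X 0 0 ∈ pw F (j + 1) ∧ X 1 1 ∈ pw F (j + 1) := by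
      rw [Matrix.trace_fin_two] at ht
      refine mem_pw_of_sum_of_prod ht ?_
      have := add_mem hd (mul_mem_pw' hX.2.1 hX.2.2.1 (k := 2 * j + 1))
      rwa [Matrix.det_fin_two, sub_add_cancel] at this
    by_cases hXs : X ∈ gPlus F (j + 1 / 2 : ℝ)
    swap
    · refine apply_cosetInd_eq_zero_of_notMem hT (isLat_box _ _ _) (mid F) (s := (j + 1 / 2 : ℝ))
        ?_ ?_ hXs ?_ ?_
      · linarith
      · rw [lat_mid_half]; exact ⟨ha, hX.2.1, hX.2.2.1, hd'⟩
      · rw [latPlus_mid_half]; exact box_mono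
      · rw [latPlus_mid_half]; exact box_mono
    rw [mem_gPlus_iff, show 2 * ((j : ℝ) + 1 / 2) = ((2 * j + 1 : ℤ) : ℝ) by push_cast; ring,
          Int.floor_intCast] at hXs
    -- At depth j + 1/2 nilpotency to leading order is the vanishing of the product of the two
    -- off-diagonal leading terms, so at most one of them survives.
    have hbc : X 0 1 * X 1 0 ∈ pw F (j + (j + 2)) := by
      have := sub_mem (mul_mem_pw' ha hd' (k := 2 * j + 1 + 1)) hXs.2
      rw [Matrix.det_fin_two, sub_sub_cancel] at this
      exact pw_anti (by omega) this
    by_cases hb : X 0 1 ∈ pw F (j + 1)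
    · by_cases hc : X 1 0 ∈ pw F (j + 2)
      · exact ih X ⟨ha, hb, pw_anti (by omega) hc, hd'⟩
      · rw [apply_cosetInd_flip hinv]
        refine hstep j _ hjm (Ad_flip_mem_box.2 ⟨ha, pw_anti (by omega) hb, hX.2.2.1, hd'⟩) ?_
        rw [Ad_flip]
        simp only [Matrix.of_apply, Matrix.cons_val', Matrix.cons_val_zero, Matrix.cons_val_one,
          Matrix.cons_val_fin_one]
        rw [← zpow_neg_one, unif_zpow_mul_mem]
        exact fun h => hc (pw_anti (by omega) h)
    · exact hstep j X hjm ⟨ha, hX.2.1, mem_pw_of_mul_mem hbc hb, hd'⟩ hb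

/-- A distribution in `JTilde (n / 2)` that vanishes on the indicators of `L` and of a coset `E + L`
of a nonzero nilpotent, where `L = stdLat n`, vanishes on `DPlus (n / 2)`. -/
theorem apply_eq_zero_of_mem_DPlus {n : ℤ} (hT : T ∈ JTilde F (n / 2))
    (h1 : T (cosetInd 0 (stdLat F n)) = 0)
    (h2 : T (cosetInd !![0, unif F ^ (n / 2); 0, 0] (stdLat F n)) = 0)
    {f : schwartz (g F)} (hf : f ∈ DPlus F (n / 2)) : T f = 0 := by
  have hinv : T ∈ invDist F := (mem_JTilde_iff.1 hT).1
  have hc : ∀ X, T (cosetInd X (stdLat F n)) = 0 := by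
    rcases Int.even_or_odd' n with ⟨j, rfl | rfl⟩
    · have e1 : ((2 * j : ℤ) : ℝ) / 2 = ((j + 1 - 1 : ℤ) : ℝ) := by push_cast; ring
      have e2 : stdLat F (2 * j) = box F (j + 1) (j + 1) (j + 1) := by
        unfold stdLat; congr 1 <;> omega
      have e3 : 2 * j / 2 = j + 1 - 1 := by omega
      rw [e1] at hT
      rw [e2] at h1 h2 ⊢
      rw [e3] at h2
      exact apply_cosetInd_ball_eq_zero hT h1 h2
    · have e1 : ((2 * j + 1 : ℤ) : ℝ) / 2 = ((j + 1 - 1 : ℤ) : ℝ) + 1 / 2 := by push_cast; ring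
      have e2 : stdLat F (2 * j + 1) = box F (j + 1) (j + 1) (j + 1 + 1) := by
        unfold stdLat; congr 1 <;> omega
      have e3 : (2 * j + 1) / 2 = j + 1 - 1 := by omega
      rw [e1] at hT
      rw [e2] at h1 h2 ⊢
      rw [e3] at h2
      exact apply_cosetInd_iwahori_eq_zero hT h1 h2
  -- A function invariant under g_{x,(n/2)+} is invariant under a conjugate of `stdLat F n`, hence a
  -- combination of conjugates of its cosets, on which the invariant T vanishes.
  have hle : DPlus F (n / 2) ≤ LinearMap.ker T := by
    refine iSup_le fun x f hf => ?_
    obtain ⟨k, hk⟩ := exists_stdLat_subset_lat x n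
    have hL : IsLat (stdLat F n) := isLat_box _ _ _
    have hLk := hL.map k
    obtain ⟨R, -, e⟩ := exists_sum_cosetInd hLk (f := f) (by
      rintro X _ ⟨Z, hZ, rfl⟩
      exact hf X _ (lat_subset_latPlus x (by linarith) (hk Z hZ)))
    rw [LinearMap.mem_ker, e, map_sum]
    refine Finset.sum_eq_zero fun c _ => ?_
    rw [map_smul, ← Ad_Ad_inv k c, ← apply_cosetInd_Ad hinv hL hLk k _ (Ad k⁻¹ c), hc, smul_zero]
    intro Y
    exact (AddSubgroup.mem_map_iff_mem (AdEquiv k).injective (x := Y))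
  exact hle hf

end Descent

end GLTwo

namespace GLTwo

/-! ### The two nilpotent orbits. -/

section Orbits

variable {F : Type*} [Field F]

theorem mem_nilCone_iff {X : g F} : X ∈ nilCone F ↔ X.trace = 0 ∧ X.det = 0 := by
  constructor
  · intro hX
    refine ⟨(Matrix.isNilpotent_trace_of_isNilpotent hX).eq_zero, ?_⟩
    obtain ⟨n, hn⟩ := hX
    have h : X.det ^ (n + 1) = 0 := by
      rw [← Matrix.det_pow, pow_succ, hn, zero_mul, Matrix.det_zero]
    exact (pow_eq_zero_iff (Nat.succ_ne_zero n)).1 h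
  · rintro ⟨ht, hd⟩
    refine ⟨2, ?_⟩
    rw [Matrix.trace_fin_two] at ht
    rw [Matrix.det_fin_two] at hd
    have h11 : X 1 1 = -X 0 0 := (neg_eq_of_add_eq_zero_right ht).symm
    rw [h11] at hd
    rw [pow_two]
    refine ext_g ?_ ?_ ?_ ?_ <;> simp [Matrix.mul_apply, Fin.sum_univ_two, h11] <;>
      first | ring1 | linear_combination -hd

variable (F) in
/-- The zero orbit. -/
def orbZero : NilOrbit F := ⟨{0}, 0, mem_nilCone_iff.2 (by simp), by
  ext X; simp⟩

/-- A nonzero nilpotent matrix is conjugate to the standard one. -/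
theorem exists_Ad_eq_of_mem_nilCone {X : g F} (hX : X ∈ nilCone F) (h0 : X ≠ 0) :
    ∃ k : G F, X = Ad k !![0, 1; 0, 0] := by
  rw [mem_nilCone_iff] at hX
  have h : X 1 0 ≠ 0 ∨ X 0 1 ≠ 0 ∨ X 0 0 ≠ X 1 1 := by
    by_contra hcon
    push Not at hcon
    obtain ⟨h10, h01, h11⟩ := hcon
    have hd := hX.2
    rw [Matrix.det_fin_two, h10, h01, ← h11, mul_zero, sub_zero, mul_self_eq_zero] at hd
    exact h0 (ext_g hd h01 h10 (h11 ▸ hd))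
  obtain ⟨k, hk⟩ := exists_companion X h
  refine ⟨k, ?_⟩
  rw [hX.1, hX.2, neg_zero] at hk
  rw [← hk, Ad_Ad_inv]

variable (F) in
/-- The regular nilpotent orbit. -/
def orbReg : NilOrbit F := ⟨{X | X ∈ nilCone F ∧ X ≠ 0}, !![0, 1; 0, 0],
  mem_nilCone_iff.2 (by simp [Matrix.trace_fin_two, Matrix.det_fin_two]), by
    ext X
    constructor
    · rintro ⟨hX, h0⟩
      obtain ⟨k, hk⟩ := exists_Ad_eq_of_mem_nilCone hX h0
      exact ⟨k, hk.symm⟩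
    · rintro ⟨k, rfl⟩
      refine ⟨mem_nilCone_iff.2 ?_, fun h => ?_⟩
      · simp only [trace_Ad, det_Ad]
        simp [Matrix.trace_fin_two, Matrix.det_fin_two]
      · have := congrArg (Ad k⁻¹) h
        simp only [Ad_inv_Ad, Ad_zero] at this
        have := congrFun (congrFun this 0) 1
        simp at this⟩

theorem mem_orbReg {X : g F} : X ∈ (orbReg F).1 ↔ X ∈ nilCone F ∧ X ≠ 0 := Iff.rfl

theorem nilOrbit_eq (O : NilOrbit F) : O = orbZero F ∨ O = orbReg F := by
  obtain ⟨_, X, hX, rfl⟩ := O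
  by_cases h0 : X = 0
  · left
    refine Subtype.ext ?_
    subst h0
    ext Y; simp [orbZero]
  · right
    refine Subtype.ext (Set.ext fun Y => ?_)
    rw [mem_orbReg]
    constructor
    · rintro ⟨k, rfl⟩
      rw [mem_nilCone_iff] at hX ⊢
      simp only [trace_Ad, det_Ad]
      refine ⟨hX, fun h => h0 ?_⟩
      simpa using congrArg (Ad k⁻¹) h
    · rintro ⟨hY, hY0⟩
      obtain ⟨k, rfl⟩ := exists_Ad_eq_of_mem_nilCone hX h0
      obtain ⟨l, rfl⟩ := exists_Ad_eq_of_mem_nilCone hY hY0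
      exact ⟨l * k⁻¹, by simp [← Ad_mul]⟩

theorem orbZero_ne_orbReg : orbZero F ≠ orbReg F := by
  intro h
  have h0 : (0 : g F) ∈ (orbReg F).1 := by
    rw [← h]; exact Set.mem_singleton _
  exact h0.2 rfl

theorem orbit_subset_nilCone (O : NilOrbit F) : O.1 ⊆ nilCone F := by
  rcases nilOrbit_eq O with rfl | rfl
  · rintro X rfl
    exact mem_nilCone_iff.2 (by simp)
  · exact fun X hX => hX.1

end Orbits

/-- The easy inclusion: a function whose support misses g_{s+} has support disjoint from the
nilpotent cone. -/
theorem invDistOn_nilCone_le_JTilde {F : Type*} [Field F] [ValuativeRel F] [TopologicalSpace F]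
    [IsNonarchimedeanLocalField F] (r : ℝ) : invDistOn F (nilCone F) ≤ JTilde F r := by
  intro T hT
  rw [mem_JTilde_iff]
  exact ⟨hT.1, fun x s _ f _ hd => hT.2 f (hd.mono_left (nilCone_subset_gPlus s))⟩

/-! ### Orbital integrals and the nilpotent expansion. -/

section OrbitalMeasures

variable {F : Type*} [Field F] [ValuativeRel F] [TopologicalSpace F] [IsNonarchimedeanLocalField F]
  [MeasurableSpace (g F)] [BorelSpace (g F)]

theorem integrable_schwartz {Y : Type*} [TopologicalSpace Y] [MeasurableSpace Y] [BorelSpace Y]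
    (μ : Measure Y) (hμ : ∀ K, IsCompact K → μ K < ⊤) (f : schwartz Y) :
    Integrable (f : Y → ℂ) μ := by
  have : IsFiniteMeasureOnCompacts μ := ⟨fun {K} hK => hμ K hK⟩
  exact f.2.1.continuous.integrable_of_hasCompactSupport f.2.2

/-- The distribution given by a measure. -/
noncomputable def measDist (μ : Measure (g F)) (hμ : ∀ K, IsCompact K → μ K < ⊤) :
    Module.Dual ℂ (schwartz (g F)) where
  toFun f := ∫ X, (f : g F → ℂ) X ∂μ
  map_add' f f' := integral_add (integrable_schwartz μ hμ f) (integrable_schwartz μ hμ f')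
  map_smul' c _ := integral_const_mul c _

theorem measDist_apply (μ : Measure (g F)) (hμ : ∀ K, IsCompact K → μ K < ⊤) (f : schwartz (g F)) :
    measDist μ hμ f = ∫ X, (f : g F → ℂ) X ∂μ := rfl

theorem integral_cosetInd (μ : Measure (g F)) {L : AddSubgroup (g F)} (hL : IsLat L) (X : g F) :
    ∫ Y, (cosetInd X L : g F → ℂ) Y ∂μ = μ.real {Y | Y - X ∈ L} := by
  rw [cosetInd, coe_ind (isOpen_coset hL X) (isCompact_coset hL X)]
  have := integral_indicator_const (μ := μ) (1 : ℂ) (isOpen_coset hL X).measurableSet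
  rw [Complex.real_smul, mul_one] at this
  exact this

variable {O : NilOrbit F} {μ : Measure (g F)}

theorem IsOrbitalMeasure.measDist_mem (h : IsOrbitalMeasure O μ) :
    measDist μ h.finite ∈ invDistOn F (nilCone F) := by
  refine ⟨fun x f f' hf => ?_, fun f hf => ?_⟩
  · rw [measDist_apply, measDist_apply]
    simp_rw [hf]
    conv_rhs => rw [← h.invariant x]
    rw [integral_map (continuous_Ad x).measurable.aemeasurable
      f.2.1.continuous.aestronglyMeasurable]
  · rw [measDist_apply]
    refine integral_eq_zero_of_ae ?_
    have : ∀ᵐ X ∂μ, X ∈ O.1 := h.carried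
    filter_upwards [this] with X hX
    by_contra h0
    exact Set.disjoint_left.1 hf (orbit_subset_nilCone O hX) h0

/-- The preimages of U under conjugation cover the orbit, and countably many of them suffice; a null
U would make the whole measure zero. -/
theorem IsOrbitalMeasure.pos_of_isOpen (h : IsOrbitalMeasure (orbReg F) μ) {U : Set (g F)}
    (hU : IsOpen U) {X : g F} (hX : X ∈ (orbReg F).1) (hXU : X ∈ U) : 0 < μ U := by
  rw [pos_iff_ne_zero]
  intro h0
  have hx : ∀ x : G F, μ (Ad x ⁻¹' U) = 0 := by
    intro x
    have := h.invariant x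
    rw [← this, Measure.map_apply (continuous_Ad x).measurable hU.measurableSet] at h0
    exact h0
  obtain ⟨s, hs, hs'⟩ := TopologicalSpace.isOpen_iUnion_countable (fun x : G F => Ad x ⁻¹' U)
    (fun x => hU.preimage (continuous_Ad x))
  refine h.ne_zero (Measure.measure_univ_eq_zero.1 ?_)
  have hcov : (Set.univ : Set (g F)) ⊆ (orbReg F).1ᶜ ∪ ⋃ x ∈ s, Ad x ⁻¹' U := by
    intro Y _
    by_cases hY : Y ∈ (orbReg F).1
    · right
      rw [hs']
      obtain ⟨k, rfl⟩ := exists_Ad_eq_of_mem_nilCone hX.1 hX.2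
      obtain ⟨l, rfl⟩ := exists_Ad_eq_of_mem_nilCone hY.1 hY.2
      refine Set.mem_iUnion.2 ⟨k * l⁻¹, ?_⟩
      simpa [← Ad_mul] using hXU
    · exact Or.inl hY
  refine measure_mono_null hcov (measure_union_null h.carried ?_)
  exact (measure_biUnion_null_iff hs).2 fun x _ => hx x

/-- On `DPlus (n / 2)`, every distribution of `JTilde (n / 2)` is a combination of the two nilpotent
orbital integrals. -/
theorem exists_nilpotent_expansion {n : ℤ} {T : Module.Dual ℂ (schwartz (g F))}
    (hT : T ∈ JTilde F (n / 2)) {μ₀ μ₁ : Measure (g F)} (h₀ : IsOrbitalMeasure (orbZero F) μ₀)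
    (h₁ : IsOrbitalMeasure (orbReg F) μ₁) : ∃ a b : ℂ, ∀ f ∈ DPlus F (n / 2),
      T f = a * ∫ X, (f : g F → ℂ) X ∂μ₀ + b * ∫ X, (f : g F → ℂ) X ∂μ₁ := by
  have hL : IsLat (stdLat F n) := isLat_box _ _ _
  set E : g F := !![0, unif F ^ (n / 2); 0, 0] with hE
  set D₀ := measDist μ₀ h₀.finite with hD₀
  set D₁ := measDist μ₁ h₁.finite with hD₁
  have hE0 : (0 : g F) - E ∉ stdLat F n := by
    rintro ⟨-, h, -⟩
    simp only [hE, Matrix.sub_apply, Matrix.of_apply, Matrix.cons_val', Matrix.cons_val_zero,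
      Matrix.cons_val_one, Matrix.cons_val_fin_one, Matrix.zero_apply, zero_sub, neg_mem_iff] at h
    rw [← mul_one (unif F ^ (n / 2)), unif_zpow_mul_mem,
      show (n + 2) / 2 - n / 2 = 1 by omega] at h
    have h4 := (one_add_unit (zero_mem (pw F 1))).2
    rw [add_zero] at h4
    exact h4 h
  -- The values of the two orbital integrals on E + L and on L form a triangular system: E + L
  -- misses 0, each integral is nonzero on its own coset. So b is solved from E + L, and then a from
  -- L.
  have e01 : D₀ (cosetInd 0 (stdLat F n)) ≠ 0 := by
    rw [hD₀, measDist_apply, integral_cosetInd _ hL]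
    have hne : μ₀ {Y | Y - 0 ∈ stdLat F n} ≠ 0 := by
      intro h
      refine h₀.ne_zero (Measure.measure_univ_eq_zero.1 ?_)
      refine measure_mono_null (fun Y _ => ?_) (measure_union_null h h₀.carried)
      by_cases hY : Y = 0
      · left
        change Y - 0 ∈ stdLat F n
        rw [hY, sub_zero]; exact zero_mem _
      · exact Or.inr hY
    exact_mod_cast (ENNReal.toReal_pos hne (h₀.finite _ (isCompact_coset hL 0)).ne).ne'
  have e02 : D₀ (cosetInd E (stdLat F n)) = 0 := by
    rw [hD₀, measDist_apply, integral_cosetInd _ hL, measureReal_def, measure_mono_null _ h₀.carried]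
    · simp
    · rintro Y hY rfl
      exact hE0 hY
  have e12 : D₁ (cosetInd E (stdLat F n)) ≠ 0 := by
    rw [hD₁, measDist_apply, integral_cosetInd _ hL]
    have hne : μ₁ {Y | Y - E ∈ stdLat F n} ≠ 0 := by
      refine (h₁.pos_of_isOpen (isOpen_coset hL E) (X := E) ?_ ?_).ne'
      · refine ⟨mem_nilCone_iff.2 (by simp [hE, Matrix.trace_fin_two, Matrix.det_fin_two]), fun h => ?_⟩
        exact hE0 (by rw [h, sub_zero]; exact zero_mem _)
      · change E - E ∈ stdLat F n
        rw [sub_self]; exact zero_mem _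
    exact_mod_cast (ENNReal.toReal_pos hne (h₁.finite _ (isCompact_coset hL E)).ne).ne'
  set b := T (cosetInd E (stdLat F n)) / D₁ (cosetInd E (stdLat F n)) with hb
  set a := (T (cosetInd 0 (stdLat F n)) - b * D₁ (cosetInd 0 (stdLat F n))) /
    D₀ (cosetInd 0 (stdLat F n)) with ha
  refine ⟨a, b, fun f hf => ?_⟩
  have hmem : T - (a • D₀ + b • D₁) ∈ JTilde F (n / 2) :=
    sub_mem hT (invDistOn_nilCone_le_JTilde _ (add_mem (Submodule.smul_mem _ _ h₀.measDist_mem)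
      (Submodule.smul_mem _ _ h₁.measDist_mem)))
  have := apply_eq_zero_of_mem_DPlus hmem ?_ ?_ hf
  · simp only [LinearMap.sub_apply, LinearMap.add_apply, LinearMap.smul_apply, smul_eq_mul] at this
    exact sub_eq_zero.1 this
  · simp only [LinearMap.sub_apply, LinearMap.add_apply, LinearMap.smul_apply, smul_eq_mul]
    rw [ha, div_mul_cancel₀ _ e01]; ring
  · simp only [LinearMap.sub_apply, LinearMap.add_apply, LinearMap.smul_apply, smul_eq_mul]
    rw [← hE, e02, hb, div_mul_cancel₀ _ e12]; ring

end OrbitalMeasures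

end GLTwo

namespace GLTwo

/-! ### Generators of GL(2, F). -/

section Generators

variable {F : Type*} [Field F]

/-- The lower unipotent matrices. -/
noncomputable def lowU (u : F) : G F := mkG 1 0 u 1 (by simp)

/-- The diagonal matrices. -/
noncomputable def diagG (s t : Fˣ) : G F := mkG s 0 0 t (by simp)

variable (F) in
/-- The permutation matrix. -/
noncomputable def weyl : G F := mkG 0 1 1 0 (by simp)

/-- A nonzero upper left entry gives a factorization lower · diagonal · upper, where the upper
unipotent factor is a Weyl conjugate of a lower one. Otherwise a Weyl element is split off
beforehand. -/
theorem GL2_induction {P : G F → Prop} (hmul : ∀ x y, P x → P y → P (x * y)) (hdiag : ∀ s t, P (diagG s t))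
    (hlow : ∀ u, P (lowU u)) (hw : P (weyl F)) (x : G F) : P x := by
  have main : ∀ x : G F, (x : g F) 0 0 ≠ 0 → P x := by
    intro x ha
    have hdet : (x : g F).det ≠ 0 := x.isUnit.map Matrix.detMonoidHom |>.ne_zero
    have hd : (x : g F).det / (x : g F) 0 0 ≠ 0 := div_ne_zero hdet ha
    have e : x = lowU ((x : g F) 1 0 / (x : g F) 0 0) *
        diagG (Units.mk0 _ ha) (Units.mk0 _ hd) *
        (weyl F * lowU ((x : g F) 0 1 / (x : g F) 0 0) * weyl F) := by
      refine Units.ext ?_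
      simp only [Units.val_mul, lowU, diagG, weyl, coe_mkG, Units.val_mk0, Matrix.det_fin_two]
      refine ext_g ?_ ?_ ?_ ?_ <;> simp [Matrix.mul_apply, Fin.sum_univ_two] <;> field_simp
      ring
    rw [e]
    exact hmul _ _ (hmul _ _ (hlow _) (hdiag _ _)) (hmul _ _ (hmul _ _ hw (hlow _)) hw)
  by_cases ha : (x : g F) 0 0 = 0
  · have e : x = weyl F * (weyl F * x) := by
      rw [← mul_assoc]
      have : weyl F * weyl F = 1 := by
        refine Units.ext ?_
        simp only [Units.val_mul, weyl, coe_mkG, Units.val_one]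
        refine ext_g ?_ ?_ ?_ ?_ <;> simp [Matrix.mul_apply, Fin.sum_univ_two]
      rw [this, one_mul]
    rw [e]
    refine hmul _ _ hw (main _ ?_)
    have hdet : (x : g F).det ≠ 0 := x.isUnit.map Matrix.detMonoidHom |>.ne_zero
    rw [Matrix.det_fin_two, ha, zero_mul, zero_sub, neg_ne_zero] at hdet
    simpa [weyl, Matrix.mul_apply, Fin.sum_univ_two] using right_ne_zero_of_mul hdet
  · exact main x ha

end Generators

/-! ### The invariant measure on the regular nilpotent orbit. -/

section RegularOrbit

variable {F : Type*} [Field F] [ValuativeRel F] [TopologicalSpace F] [IsNonarchimedeanLocalField F]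

theorem isOpenEmbedding_units_val : IsOpenEmbedding (Units.val : Fˣ → F) := by
  refine ⟨Units.isEmbedding_val₀, ?_⟩
  have : Set.range (Units.val : Fˣ → F) = {0}ᶜ := by
    ext a
    exact ⟨fun ⟨u, hu⟩ => hu ▸ u.ne_zero, fun ha => ⟨Units.mk0 a ha, rfl⟩⟩
  rw [this]
  exact isOpen_compl_singleton

instance : LocallyCompactSpace Fˣ := isOpenEmbedding_units_val.locallyCompactSpace

instance : SecondCountableTopology Fˣ := isOpenEmbedding_units_val.isEmbedding.secondCountableTopology

/-- The chart of the regular nilpotent orbit by the two upper entries. -/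
noncomputable def nilChart (p : Fˣ × F) : g F := !![p.2, p.1; -(p.2 ^ 2 * ((p.1⁻¹ : Fˣ) : F)), -p.2]

theorem continuous_nilChart : Continuous (nilChart (F := F)) := by
  unfold nilChart
  refine continuous_matrix fun i j => ?_
  fin_cases i <;> fin_cases j
  · exact continuous_snd
  · exact Units.continuous_val.comp continuous_fst
  · exact ((continuous_snd.pow 2).mul
      (Units.continuous_val.comp (continuous_inv.comp continuous_fst))).neg
  · exact continuous_snd.neg

theorem nilChart_mem (p : Fˣ × F) : nilChart p ∈ (orbReg F).1 := by
  refine ⟨mem_nilCone_iff.2 ⟨?_, ?_⟩, fun h => ?_⟩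
  · simp [nilChart, Matrix.trace_fin_two]
  · have : ((p.1 : Fˣ) : F) ≠ 0 := p.1.ne_zero
    simp only [nilChart, Matrix.det_fin_two_of, Units.val_inv_eq_inv_val]
    field_simp; ring
  · have := congrFun (congrFun h 0) 1
    simp [nilChart] at this

section Measure

theorem exists_ball_superset {K : Set (g F)} (hK : IsCompact K) :
    ∃ n : ℤ, K ⊆ (box F n n n : Set (g F)) := by
  have hmono : Monotone fun n : ℕ => (box F (-n) (-n) (-n) : Set (g F)) := fun a b h =>
    box_mono (by omega) (by omega) (by omega)
  obtain ⟨n, hn⟩ := hK.elim_directed_cover (fun n : ℕ => (box F (-n) (-n) (-n) : Set (g F)))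
    (fun n => isOpen_box _ _ _) (fun X _ => by
      obtain ⟨n, hn⟩ := exists_ball_mem X
      exact Set.mem_iUnion.2 ⟨n.natAbs, box_mono (by omega) (by omega) (by omega) hn⟩)
    hmono.directed_le
  exact ⟨_, hn⟩

variable [MeasurableSpace F] [BorelSpace F] [MeasurableSpace Fˣ] [BorelSpace Fˣ]
  [MeasurableSpace (g F)] [BorelSpace (g F)]
  (ν : Measure F) [ν.IsAddHaarMeasure] (η : Measure Fˣ) [η.IsHaarMeasure]

/-- The invariant measure on the regular nilpotent orbit. -/
noncomputable def regMeasure : Measure (g F) := (η.prod ν).map nilChart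

variable {ν η}

/-- Equality almost everywhere is needed because the Weyl element takes the points with a = 0 out of
the chart. -/
theorem map_Ad_regMeasure_of {x : G F} {ψ : Fˣ × F → Fˣ × F}
    (hψ : MeasurePreserving ψ (η.prod ν) (η.prod ν))
    (h : ∀ᵐ p ∂η.prod ν, Ad x (nilChart p) = nilChart (ψ p)) :
    (regMeasure ν η).map (Ad x) = regMeasure ν η := by
  unfold regMeasure
  rw [Measure.map_map (continuous_Ad x).measurable continuous_nilChart.measurable,
    Measure.map_congr (show Ad x ∘ nilChart =ᵐ[η.prod ν] nilChart ∘ ψ from h),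
    ← Measure.map_map continuous_nilChart.measurable hψ.measurable, hψ.map_eq]

/-- P^n contains the two disjoint cosets of 0 and ϖ^n modulo P^(n+1). The exact index q is not
needed: a factor 2 already makes the series below converge. -/
theorem pw_add_one_measure (ν : Measure F) [ν.IsAddHaarMeasure] (n : ℤ) :
    2 * ν (pw F (n + 1) : Set F) ≤ ν (pw F n : Set F) := by
  have hd : Disjoint (pw F (n + 1) : Set F) ((fun x => unif F ^ n + x) '' (pw F (n + 1) : Set F)) := by
    rw [Set.disjoint_left]
    rintro _ h ⟨x, hx, rfl⟩
    have h2 := (AddSubgroup.add_mem_cancel_right _ hx).1 h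
    rw [← mul_one (unif F ^ n), unif_zpow_mul_mem, add_sub_cancel_left] at h2
    have h4 := (one_add_unit (zero_mem (pw F 1))).2
    rw [add_zero] at h4
    exact h4 h2
  have hm : MeasurableSet ((fun x => unif F ^ n + x) '' (pw F (n + 1) : Set F)) := by
    have := (Homeomorph.addLeft (unif F ^ n)).isOpenMap _ (isOpen_pw (F := F) (n + 1))
    exact this.measurableSet
  have h1 := measure_union (μ := ν) hd hm
  have h2 : ν ((fun x => unif F ^ n + x) '' (pw F (n + 1) : Set F)) = ν (pw F (n + 1) : Set F) := by
    simp
  rw [h2, ← two_mul] at h1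
  rw [← h1]
  refine measure_mono (Set.union_subset (pw_anti (by omega)) ?_)
  rintro _ ⟨x, hx, rfl⟩
  exact add_mem (unif_zpow_mem n) (pw_anti (by omega) hx)

theorem pw_add_nat_measure (ν : Measure F) [ν.IsAddHaarMeasure] (n : ℤ) (l : ℕ) :
    ν (pw F (n + l) : Set F) ≤ (2⁻¹ : ENNReal) ^ l * ν (pw F n : Set F) := by
  induction l with
  | zero => simp
  | succ l ih =>
    have h := pw_add_one_measure ν (n + l)
    have h2 : ν (pw F (n + l + 1) : Set F) ≤ 2⁻¹ * ν (pw F (n + l) : Set F) := by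
      rw [mul_comm] at h
      rw [mul_comm, ← div_eq_mul_inv]
      exact (ENNReal.le_div_iff_mul_le (by simp) (by simp)).2 h
    push_cast
    rw [← add_assoc, pow_succ', mul_assoc]
    exact h2.trans (by gcongr)

-- In the chart the ball requires b and a²/b to lie in P^n. If val b is n + 2l or n + 2l + 1, then
-- val a ≥ n + l. The sets of such b all have the same finite multiplicative measure, while the
-- measure of P^(n+l) decays geometrically.
variable (ν η) in
theorem regMeasure_ball_lt_top (n : ℤ) : regMeasure ν η (box F n n n : Set (g F)) < ⊤ := by
  set Bl : ℕ → Set Fˣ := fun l => {b | (b : F) ∈ pw F (n + 2 * l) ∧ (b : F) ∉ pw F (n + 2 * l + 2)}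
    with hBl
  have hcov : nilChart ⁻¹' (box F n n n : Set (g F)) ⊆ ⋃ l : ℕ, Bl l ×ˢ (pw F (n + l) : Set F) := by
    rintro ⟨b, a⟩ ⟨-, hb, hc, -⟩
    simp only [nilChart, Matrix.of_apply, Matrix.cons_val', Matrix.cons_val_zero,
      Matrix.cons_val_one, Matrix.cons_val_fin_one, neg_mem_iff] at hb hc
    have hv := (mem_pw_iff_val b.ne_zero).1 hb
    refine Set.mem_iUnion.2 ⟨((val (b : F) - n) / 2).toNat, ?_, ?_⟩
    · rw [hBl]
      refine ⟨(mem_pw_iff_val b.ne_zero).2 (by omega), fun h => ?_⟩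
      rw [mem_pw_iff_val b.ne_zero] at h
      omega
    · by_cases ha : a = 0
      · rw [ha]; exact zero_mem _
      have hc' := mul_mem_pw hc ((mem_pw_iff_val b.ne_zero).2 le_rfl)
      rw [Units.inv_mul_cancel_right] at hc'
      by_contra hcon
      rw [SetLike.mem_coe, mem_pw_iff_val ha] at hcon
      have hn : a ∉ pw F (val a + 1) := by rw [mem_pw_iff_val ha]; omega
      have := mem_pw_of_mul_mem (m := val a) (n := n + val (b : F) - val a) (a := a) (b := a)
        (by rw [← pow_two]; convert hc' using 2; ring) hn
      rw [mem_pw_iff_val ha] at this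
      omega
  have hBm : ∀ l, η (Bl l) = η (Bl 0) := by
    intro l
    have h1 : Bl 0 = (fun b => Units.mk0 _ (unif_zpow_ne_zero (F := F) (2 * l)) * b) ⁻¹' Bl l := by
      ext b
      change ((b : F) ∈ pw F (n + 2 * (0 : ℕ)) ∧ (b : F) ∉ pw F (n + 2 * (0 : ℕ) + 2)) ↔
        (unif F ^ (2 * l : ℤ) * (b : F) ∈ pw F (n + 2 * l) ∧
          unif F ^ (2 * l : ℤ) * (b : F) ∉ pw F (n + 2 * l + 2))
      rw [unif_zpow_mul_mem, unif_zpow_mul_mem, show n + 2 * ((0 : ℕ) : ℤ) = n + 2 * l - 2 * l by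
        push_cast; ring, show n + 2 * (l : ℤ) + 2 - 2 * l = n + 2 * l - 2 * l + 2 by ring]
    rw [h1, measure_preimage_mul]
  have hB0 : η (Bl 0) < ⊤ := by
    refine IsCompact.measure_lt_top ?_
    have hemb := (isOpenEmbedding_units_val (F := F)).isInducing
    rw [hemb.isCompact_iff]
    have : Units.val '' Bl 0 = (pw F n : Set F) ∩ (pw F (n + 2) : Set F)ᶜ := by
      ext a
      constructor
      · rintro ⟨b, ⟨h1, h2⟩, rfl⟩
        exact ⟨by simpa using h1, by simpa using h2⟩
      · rintro ⟨h1, h2⟩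
        exact ⟨Units.mk0 a (ne_zero_of_notMem h2), ⟨by simpa using h1, by simpa using h2⟩, rfl⟩
    rw [this]
    exact (isCompact_pw n).inter_right (isOpen_pw (n + 2)).isClosed_compl
  unfold regMeasure
  rw [Measure.map_apply continuous_nilChart.measurable (isOpen_box n n n).measurableSet]
  refine (measure_mono hcov).trans_lt ((measure_iUnion_le _).trans_lt ?_)
  have hle : ∀ l : ℕ, (η.prod ν) (Bl l ×ˢ (pw F (n + l) : Set F)) ≤
      (η (Bl 0) * ν (pw F n : Set F)) * (2⁻¹ : ENNReal) ^ l := by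
    intro l
    rw [Measure.prod_prod, hBm, mul_assoc, mul_comm (ν _)]
    gcongr
    exact pw_add_nat_measure ν n l
  refine (ENNReal.tsum_le_tsum hle).trans_lt ?_
  rw [ENNReal.tsum_mul_left, ENNReal.tsum_geometric]
  have hν : ν (pw F n : Set F) < ⊤ := (isCompact_pw n).measure_lt_top
  refine ENNReal.mul_lt_top (ENNReal.mul_lt_top hB0 hν) ?_
  norm_num

variable (F) in
/-- `a ↦ -a²` as a map to the units. -/
noncomputable def negSq (a : F) : Fˣ := by
  classical exact if h : a = 0 then 1 else -Units.mk0 a h * Units.mk0 a h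

theorem measurable_negSq : Measurable (negSq F) := by
  classical
  rw [← (isOpenEmbedding_units_val (F := F)).measurableEmbedding.measurable_comp_iff]
  have : Units.val ∘ negSq F = fun a : F => if a = 0 then 1 else -a * a := by
    funext a
    simp only [Function.comp, negSq]
    split_ifs <;> simp
  rw [this]
  exact Measurable.ite (measurableSet_singleton 0) measurable_const
    (continuous_neg.mul continuous_id).measurable

variable (ν η) in
theorem isOrbitalMeasure_regMeasure : IsOrbitalMeasure (orbReg F) (regMeasure ν η) where
  ne_zero := by
    intro h
    have h1 := congrArg (fun m => m Set.univ) h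
    simp only [regMeasure, Measure.coe_zero, Pi.zero_apply] at h1
    rw [Measure.map_apply continuous_nilChart.measurable MeasurableSet.univ, Set.preimage_univ,
      ← Set.univ_prod_univ, Measure.prod_prod, mul_eq_zero, Measure.measure_univ_eq_zero,
      Measure.measure_univ_eq_zero] at h1
    rcases h1 with h1 | h1
    · exact NeZero.ne η h1
    · exact NeZero.ne ν h1
  carried := by
    have hcl : MeasurableSet ((orbReg F).1ᶜ) := by
      have h1 : MeasurableSet (nilCone F) := by
        have : nilCone F = (fun X : g F => (X.trace, X.det)) ⁻¹' {(0, 0)} := by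
          ext X; rw [mem_nilCone_iff]; simp
        rw [this]
        refine (isClosed_singleton.preimage ?_).measurableSet
        exact (Continuous.matrix_trace continuous_id).prodMk (Continuous.matrix_det continuous_id)
      exact (h1.inter (measurableSet_singleton 0).compl).compl
    rw [regMeasure, Measure.map_apply continuous_nilChart.measurable hcl]
    convert measure_empty (μ := η.prod ν)
    ext p
    simpa using nilChart_mem p
  invariant := by
    refine GL2_induction (fun x y hx hy => ?_) (fun s t => ?_) (fun u => ?_) ?_
    · have : Ad (x * y) = Ad x ∘ Ad y := funext (Ad_mul x y)
      rw [this, ← Measure.map_map (continuous_Ad x).measurable (continuous_Ad y).measurable, hy, hx]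
    · refine map_Ad_regMeasure_of (ψ := Prod.map (fun b => s * t⁻¹ * b) id)
        ((measurePreserving_mul_left η (s * t⁻¹)).prod (MeasurePreserving.id ν))
        (Filter.Eventually.of_forall fun p => ?_)
      rw [diagG, Ad_mkG_diag]
      refine ext_g ?_ ?_ ?_ ?_ <;> simp [nilChart] <;> ring
    -- A lower unipotent element acts as a shear: for fixed b it translates a.
    · refine map_Ad_regMeasure_of (ψ := fun p => (p.1, p.2 + -(u * (p.1 : F)))) ?_
        (Filter.Eventually.of_forall fun p => ?_)
      · refine MeasurePreserving.skew_product (MeasurePreserving.id η)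
          (g := fun (b : Fˣ) a => a + -(u * (b : F))) ?_ ?_
        · refine Continuous.measurable ?_
          exact continuous_snd.add
            (continuous_const.mul (Units.continuous_val.comp continuous_fst)).neg
        · exact Filter.Eventually.of_forall fun b => (measurePreserving_add_right ν _).map_eq
      · rw [Ad_eq_iff, lowU, coe_mkG]
        have : ((p.1 : Fˣ) : F) ≠ 0 := p.1.ne_zero
        refine ext_g ?_ ?_ ?_ ?_ <;> simp [nilChart, Matrix.mul_apply, Fin.sum_univ_two] <;>
          field_simp <;> ring
    -- The Weyl element sends (b, a) to (-a²/b, -a). For fixed a ≠ 0 this is inversion followed by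
    -- multiplication in the unit group, which preserves η; the swaps put a in the place of the base
    -- variable.
    · have : T2Space Fˣ := (isOpenEmbedding_units_val (F := F)).isEmbedding.t2Space
      have : η.IsInvInvariant := Measure.IsHaarMeasure.isInvInvariant_of_regular η
      have hψ : MeasurePreserving (fun p : F × Fˣ => (-p.1, negSq F p.1 * p.2⁻¹)) (ν.prod η)
          (ν.prod η) := by
        refine MeasurePreserving.skew_product (g := fun a b => negSq F a * b⁻¹)
          (Measure.measurePreserving_neg ν) ?_ ?_
        · exact (measurable_negSq.comp measurable_fst).mul measurable_snd.inv
        · exact Filter.Eventually.of_forall fun a => ((measurePreserving_mul_left η (negSq F a)).comp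
            (Measure.measurePreserving_inv η)).map_eq
      refine map_Ad_regMeasure_of (ψ := Prod.swap ∘ (fun p : F × Fˣ => (-p.1, negSq F p.1 * p.2⁻¹)) ∘
        Prod.swap) (Measure.measurePreserving_swap.comp (hψ.comp Measure.measurePreserving_swap)) ?_
      have h0 : ν {0} = 0 := by
        refine le_antisymm (le_of_forall_gt fun ε hε => ?_) bot_le
        have hlim : Filter.Tendsto (fun l : ℕ => (2⁻¹ : ENNReal) ^ l * ν (pw F 0 : Set F))
            Filter.atTop (𝓝 (0 * ν (pw F 0 : Set F))) :=
          ENNReal.Tendsto.mul_const (ENNReal.tendsto_pow_atTop_nhds_zero_of_lt_one (by norm_num))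
            (Or.inr (isCompact_pw 0).measure_lt_top.ne)
        rw [zero_mul] at hlim
        obtain ⟨l, hl⟩ := (hlim.eventually (gt_mem_nhds hε)).exists
        refine lt_of_le_of_lt ?_ (lt_of_le_of_lt (pw_add_nat_measure ν 0 l) hl)
        exact measure_mono (Set.singleton_subset_iff.2 (zero_mem _))
      have hae : ∀ᵐ p ∂η.prod ν, p.2 ≠ 0 := by
        rw [ae_iff]
        have : {p : Fˣ × F | ¬p.2 ≠ 0} = Set.univ ×ˢ {0} := by ext p; simp
        rw [this, Measure.prod_prod, h0, mul_zero]
      filter_upwards [hae] with p hp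
      rw [Ad_eq_iff, weyl, coe_mkG]
      have : ((p.1 : Fˣ) : F) ≠ 0 := p.1.ne_zero
      refine ext_g ?_ ?_ ?_ ?_ <;>
        simp [nilChart, Matrix.mul_apply, Fin.sum_univ_two, negSq, hp]
      · ring
      · field_simp
  finite := by
    intro K hK
    obtain ⟨n, hn⟩ := exists_ball_superset hK
    exact (measure_mono hn).trans_lt (regMeasure_ball_lt_top ν η n)

end Measure

theorem exists_isOrbitalMeasure [MeasurableSpace (g F)] [BorelSpace (g F)] (O : NilOrbit F) :
    ∃ μ : Measure (g F), IsOrbitalMeasure O μ := by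
  rcases nilOrbit_eq O with rfl | rfl
  · refine ⟨Measure.dirac 0, ⟨IsProbabilityMeasure.ne_zero _, ?_, fun x => ?_, fun K hK => ?_⟩⟩
    · change Measure.dirac (0 : g F) {0}ᶜ = 0
      rw [Measure.dirac_apply' _ (measurableSet_singleton (0 : g F)).compl]
      simp
    · rw [Measure.map_dirac' (continuous_Ad x).measurable, Ad_zero]
    · exact measure_lt_top _ _
  · let : MeasurableSpace F := borel F
    have : BorelSpace F := ⟨rfl⟩
    let : MeasurableSpace Fˣ := borel Fˣ
    have : BorelSpace Fˣ := ⟨rfl⟩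
    exact ⟨_, isOrbitalMeasure_regMeasure Measure.addHaar Measure.haar⟩

theorem map_JTilde_eq (k : ℤ) : (JTilde F (k / 2)).map (DPlus F (k / 2)).dualRestrict =
    (invDistOn F (nilCone F)).map (DPlus F (k / 2)).dualRestrict := by
  refine le_antisymm ?_ (Submodule.map_mono (invDistOn_nilCone_le_JTilde _))
  rintro _ ⟨T, hT, rfl⟩
  let : MeasurableSpace (g F) := borel (g F)
  have : BorelSpace (g F) := ⟨rfl⟩
  obtain ⟨μ₀, h₀⟩ := exists_isOrbitalMeasure (orbZero F)
  obtain ⟨μ₁, h₁⟩ := exists_isOrbitalMeasure (orbReg F)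
  obtain ⟨a, b, hab⟩ := exists_nilpotent_expansion hT h₀ h₁
  refine ⟨a • measDist μ₀ h₀.finite + b • measDist μ₁ h₁.finite,
    add_mem (Submodule.smul_mem _ _ h₀.measDist_mem) (Submodule.smul_mem _ _ h₁.measDist_mem), ?_⟩
  ext ⟨f, hf⟩
  exact (hab f hf).symm

end RegularOrbit

end GLTwo

namespace GLTwo

/-! ### Uniform local constancy and the elements 1 + X. -/

section UniformlyLocallyConstant

variable {F : Type*} [Field F] [ValuativeRel F] [TopologicalSpace F] [IsNonarchimedeanLocalField F]

theorem mem_nhds_iff_ball {X : g F} {S : Set (g F)} :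
    S ∈ 𝓝 X ↔ ∃ n : ℤ, ∀ Z ∈ box F n n n, X + Z ∈ S := by
  constructor
  · intro h
    have h1 : (fun Z => X + Z) ⁻¹' S ∈ 𝓝 (0 : g F) :=
      (continuous_const_add X).continuousAt (by simpa using h)
    obtain ⟨n, -, hn⟩ := hasBasis_nhds_zero_ball.mem_iff.1 h1
    exact ⟨n, fun Z hZ => hn hZ⟩
  · rintro ⟨n, hn⟩
    have := isOpen_coset (isLat_box (F := F) n n n) X
    refine Filter.mem_of_superset (this.mem_nhds (by simp [zero_mem])) fun Y hY => ?_
    simpa using hn _ hY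

/-- Every function in `S(g)` is invariant under translation by a ball. -/
theorem exists_mem_transInv_ball (f : schwartz (g F)) :
    ∃ n : ℤ, f ∈ transInv (box F n n n : Set (g F)) := by
  have hloc : ∀ X : g F, ∃ n : ℤ, ∀ Z ∈ box F n n n, (f : g F → ℂ) (X + Z) = (f : g F → ℂ) X := fun X =>
    mem_nhds_iff_ball.1 ((IsLocallyConstant.iff_eventually_eq _).1 f.2.1 X)
  choose n hn using hloc
  obtain ⟨t, -, ht⟩ := (isCompact_support_schwartz f).elim_nhds_subcover
    (fun X => {Y | Y - X ∈ box F (n X) (n X) (n X)})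
    (fun X _ => (isOpen_coset (isLat_box _ _ _) X).mem_nhds (by simp [zero_mem]))
  obtain ⟨M, hM⟩ : ∃ M : ℤ, ∀ X ∈ t, n X ≤ M := by
    obtain ⟨M, hM⟩ := (t.image n).bddAbove
    exact ⟨M, fun X hX => hM (by simpa using ⟨X, hX, rfl⟩)⟩
  have key : ∀ Y Z, (f : g F → ℂ) Y ≠ 0 → Z ∈ box F M M M →
      (f : g F → ℂ) (Y + Z) = (f : g F → ℂ) Y := by
    intro Y Z hY hZ
    obtain ⟨X, hX, hYX⟩ := Set.mem_iUnion₂.1 (ht hY)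
    have h1 := hn X _ hYX
    have h2 := hn X (Y - X + Z) (add_mem hYX (box_mono (hM X hX) (hM X hX) (hM X hX) hZ))
    rw [add_sub_cancel] at h1
    rw [← add_assoc, add_sub_cancel] at h2
    rw [h1, h2]
  refine ⟨M, fun Y Z hZ => ?_⟩
  by_cases hY : (f : g F → ℂ) Y = 0
  · by_contra hne
    rw [hY] at hne
    have := key (Y + Z) (-Z) hne (neg_mem hZ)
    rw [add_neg_cancel_right, hY] at this
    exact hne this.symm
  · exact key Y Z hY hZ

theorem trace_mem_pw {a b c : ℤ} {X : g F} (hX : X ∈ box F a b c) : X.trace ∈ pw F a := by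
  rw [Matrix.trace_fin_two]; exact add_mem hX.1 hX.2.2.2

theorem one_mem_ball : (1 : g F) ∈ box F 0 0 0 :=
  ⟨by simpa using one_mem_pw, by simp [zero_mem], by simp [zero_mem], by simpa using one_mem_pw⟩

theorem mul_mem_ball {m n : ℤ} {X Y : g F} (hX : X ∈ box F m m m) (hY : Y ∈ box F n n n) :
    X * Y ∈ box F (m + n) (m + n) (m + n) := mul_mem_box hX hY

/-- `1 + X` is invertible if `X` is topologically nilpotent. -/
theorem det_one_add {X : g F} (ht : X.trace ∈ pw F 1) (hd : X.det ∈ pw F 1) :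
    (1 + X).det ∈ pw F 0 ∧ (1 + X).det ∉ pw F 1 := by
  have e : (1 + X).det = 1 + (X.trace + X.det) := by
    simp only [Matrix.det_fin_two, Matrix.trace_fin_two, Matrix.add_apply, Matrix.one_apply_eq,
      Matrix.one_apply_ne (by decide : (0 : Fin 2) ≠ 1), Matrix.one_apply_ne (by decide : (1 : Fin 2) ≠ 0)]
    ring
  rw [e]
  exact one_add_unit (add_mem ht hd)

open Classical in
/-- The element `1 + X` of `G`, if it is invertible (and `1` if not). -/
noncomputable def onePlus (X : g F) : G F :=
  if h : (1 + X).det ≠ 0 then Matrix.GeneralLinearGroup.mkOfDetNeZero (1 + X) h else 1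

theorem coe_onePlus {X : g F} (ht : X.trace ∈ pw F 1) (hd : X.det ∈ pw F 1) :
    (onePlus X : g F) = 1 + X := by
  rw [onePlus, dif_pos (ne_zero_of_notMem (det_one_add ht hd).2)]; rfl

theorem det_mem_pw_of_mem_ball {n : ℤ} {X : g F} (hX : X ∈ box F n n n) : X.det ∈ pw F (n + n) := by
  rw [Matrix.det_fin_two]
  exact sub_mem (mul_mem_pw hX.1 hX.2.2.2) (mul_mem_pw hX.2.1 hX.2.2.1)

theorem coe_onePlus_of_mem_ball {X : g F} (hX : X ∈ box F 1 1 1) : (onePlus X : g F) = 1 + X :=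
  coe_onePlus (trace_mem_pw hX) (pw_anti (by norm_num) (det_mem_pw_of_mem_ball hX))

/-- The inverse of an integral matrix with unit determinant is integral. -/
theorem inv_mem_ball {k : G F} (hk : (k : g F) ∈ box F 0 0 0) (hd : (k : g F).det ∉ pw F 1) :
    ((k⁻¹ : G F) : g F) ∈ box F 0 0 0 := by
  have hu := inv_mem_pw_zero hd
  obtain ⟨h1, h2, h3, h4⟩ := hk
  rw [Matrix.coe_units_inv, Matrix.inv_def, Ring.inverse_eq_inv', Matrix.adjugate_fin_two]
  exact ⟨mul_mem_pw' hu h4, mul_mem_pw' hu (neg_mem h2), mul_mem_pw' hu (neg_mem h3),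
      mul_mem_pw' hu h1⟩

theorem inv_onePlus_mem_ball {X : g F} (hX : X ∈ box F 1 1 1) :
    (((onePlus X)⁻¹ : G F) : g F) ∈ box F 0 0 0 := by
  refine inv_mem_ball ?_ ?_ <;> rw [coe_onePlus_of_mem_ball hX]
  · exact add_mem one_mem_ball (box_mono (by omega) (by omega) (by omega) hX)
  · exact (det_one_add (trace_mem_pw hX) (pw_anti (by norm_num) (det_mem_pw_of_mem_ball hX))).2

theorem Ad_mem_ball_iff {k : G F} (hk : (k : g F) ∈ box F 0 0 0)
    (hk' : ((k⁻¹ : G F) : g F) ∈ box F 0 0 0) (m : ℤ) (Y : g F) :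
    Ad k Y ∈ box F m m m ↔ Y ∈ box F m m m := by
  refine Ad_mem_iff_of_forall (fun Y hY => ?_) (fun Y hY => ?_) Y
  · exact mul_mem_box (mul_mem_box hk hY (u := m) (v := m) (w := m)) hk'
  · unfold Ad
    rw [inv_inv]
    exact mul_mem_box (mul_mem_box hk' hY (u := m) (v := m) (w := m)) hk

end UniformlyLocallyConstant

/-! ### Commutators with regular semisimple matrices, and additive characters. -/

section Commutator

variable {F : Type*} [Field F]

/-- A regular semisimple matrix does not commute with a nonzero nilpotent one. -/
theorem IsRegSemisimple.commutator_ne_zero {X Y : g F} (hX : IsRegSemisimple X) (hY : Y ∈ nilCone F)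
    (h0 : Y ≠ 0) : Y * X - X * Y ≠ 0 := by
  intro h
  obtain ⟨k, rfl⟩ := exists_Ad_eq_of_mem_nilCone hY h0
  set M := Ad k⁻¹ X with hM
  have hXM : X = Ad k M := by simp [hM]
  rw [hXM, ← Ad_mul_mat, ← Ad_mul_mat, ← Ad_sub] at h
  have h' : !![0, 1; 0, 0] * M - M * !![0, 1; 0, 0] = 0 := by
    simpa using congrArg (Ad k⁻¹) h
  have e1 := congrFun (congrFun h' 0) 0
  have e2 := congrFun (congrFun h' 0) 1
  simp only [Matrix.sub_apply, Matrix.mul_apply, Fin.sum_univ_two] at e1 e2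
  simp at e1 e2
  -- Commuting with the standard nilpotent makes M upper triangular with equal diagonal entries, so
  -- the characteristic polynomial is a square.
  have ht : X.trace = 2 * M 0 0 := by
    rw [hXM, trace_Ad, Matrix.trace_fin_two, sub_eq_zero.1 e2]; ring
  have hd : X.det = M 0 0 ^ 2 := by
    rw [hXM, det_Ad, Matrix.det_fin_two, sub_eq_zero.1 e2, e1]; ring
  have hc : X.charpoly = (Polynomial.X - Polynomial.C (M 0 0)) * (Polynomial.X - Polynomial.C (M 0 0)) := by
    rw [Matrix.charpoly_fin_two, ht, hd]
    simp only [map_mul, map_pow, map_ofNat]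
    ring
  unfold IsRegSemisimple at hX
  rw [hc] at hX
  have hu := (Polynomial.Separable.squarefree hX) _ dvd_rfl
  exact Polynomial.not_isUnit_X_sub_C _ hu

end Commutator

section Character

variable {F : Type*} [Field F] [ValuativeRel F] [TopologicalSpace F] [IsNonarchimedeanLocalField F]

/-- An additive character trivial on `P` and nontrivial on `O`. -/
structure IsLevelOne (Λ : AddChar F Circle) : Prop where
  trivial : ∀ a ∈ pw F 1, Λ a = 1
  nontrivial : ∃ a ∈ pw F 0, Λ a ≠ 1

variable {Λ : AddChar F Circle}

theorem IsLevelOne.isLocallyConstant (h : IsLevelOne Λ) : IsLocallyConstant fun a => (Λ a : ℂ) := by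
  rw [IsLocallyConstant.iff_eventually_eq]
  intro a
  have : (fun x => x - a) ⁻¹' (pw F 1 : Set F) ∈ 𝓝 a :=
    (continuous_id.sub continuous_const).continuousAt (by simpa using pw_mem_nhds (F := F) 1)
  filter_upwards [this] with x hx
  have : Λ x = Λ (x - a) * Λ a := by rw [← AddChar.map_add_eq_mul, sub_add_cancel]
  rw [this, h.trivial _ hx, one_mul]

theorem IsLevelOne.continuous (h : IsLevelOne Λ) : Continuous fun a => (Λ a : ℂ) :=
  h.isLocallyConstant.continuous

theorem IsLevelOne.exists_ne_one (h : IsLevelOne Λ) {n : ℤ} {z : F} (hz : z ∉ pw F (n + 1)) :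
    ∃ t ∈ pw F (-n), Λ (t * z) ≠ 1 := by
  obtain ⟨a, ha, hΛ⟩ := h.nontrivial
  refine ⟨a * z⁻¹, mul_mem_pw' ha (inv_mem_pw hz), ?_⟩
  rwa [inv_mul_cancel_right₀ (ne_zero_of_notMem hz)]

theorem exists_entry_notMem {n : ℤ} {W : g F} (hW : W ∉ box F n n n) : ∃ i j, W i j ∉ pw F n := by
  by_contra hcon
  push Not at hcon
  exact hW ⟨hcon 0 0, hcon 0 1, hcon 1 0, hcon 1 1⟩

theorem single_mem_ball {n : ℤ} {z : F} (hz : z ∈ pw F n) (i j : Fin 2) :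
    Matrix.single i j z ∈ box F n n n := by
  refine ⟨?_, ?_, ?_, ?_⟩ <;> rw [Matrix.single_apply] <;> split_ifs <;> simp [hz, zero_mem]

theorem trace_single_mul (i j : Fin 2) (z : F) (W : g F) :
    (Matrix.single i j z * W).trace = z * W j i := by
  fin_cases i <;> fin_cases j <;>
    simp [Matrix.trace_fin_two, Matrix.mul_apply, Matrix.single_apply]

/-- The characters of a ball given by matrices outside of the dual ball are nontrivial. -/
theorem IsLevelOne.exists_trace_ne_one (h : IsLevelOne Λ) {n : ℤ} {W : g F}
    (hW : W ∉ box F (n + 1) (n + 1) (n + 1)) : ∃ Z ∈ box F (-n) (-n) (-n), Λ (Z * W).trace ≠ 1 := by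
  obtain ⟨i, j, hij⟩ := exists_entry_notMem hW
  obtain ⟨t, ht, hΛ⟩ := h.exists_ne_one hij
  exact ⟨Matrix.single j i t, single_mem_ball ht j i, by rwa [trace_single_mul]⟩

variable [MeasurableSpace (g F)] [BorelSpace (g F)] (dY : Measure (g F)) [dY.IsAddHaarMeasure]

theorem continuous_char_trace (h : IsLevelOne Λ) (W : g F) :
    Continuous fun Z : g F => (Λ (Z * W).trace : ℂ) :=
  h.continuous.comp (Continuous.matrix_trace (continuous_id.mul continuous_const))

/-- The integral of a nontrivial character over a lattice vanishes. -/
theorem setIntegral_char_eq_zero {L : AddSubgroup (g F)} (hL : IsLat L) {W : g F}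
    (hW : ∃ Z ∈ L, Λ (Z * W).trace ≠ 1) : ∫ Z in (L : Set (g F)), (Λ (Z * W).trace : ℂ) ∂dY = 0 := by
  obtain ⟨A, hA, hne⟩ := hW
  have hm : MeasurableSet (L : Set (g F)) := hL.isOpen.measurableSet
  set I := ∫ Z in (L : Set (g F)), (Λ (Z * W).trace : ℂ) ∂dY with hI
  have h1 : I = (Λ (A * W).trace : ℂ) * I := by
    conv_lhs => rw [hI, ← integral_indicator hm, ← integral_add_right_eq_self _ A]
    rw [hI, ← integral_const_mul, ← integral_indicator hm]
    congr 1
    funext Z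
    by_cases hZ : Z ∈ L
    · rw [Set.indicator_of_mem (show Z + A ∈ (L : Set (g F)) from add_mem hZ hA),
        Set.indicator_of_mem (show Z ∈ (L : Set (g F)) from hZ), add_mul, Matrix.trace_add,
        AddChar.map_add_eq_mul, Circle.coe_mul, mul_comm]
    · rw [Set.indicator_of_notMem, Set.indicator_of_notMem]
      · exact hZ
      · exact fun h => hZ ((AddSubgroup.add_mem_cancel_right L hA).1 h)
  have h2 : ((Λ (A * W).trace : ℂ) - 1) * I = 0 := by rw [sub_mul, one_mul, ← h1, sub_self]
  refine (mul_eq_zero.1 h2).resolve_left fun h3 => hne ?_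
  exact Circle.ext (by rw [Circle.coe_one]; exact sub_eq_zero.1 h3)

end Character

end GLTwo

namespace GLTwo

/-! ### Fourier transforms of nilpotent orbital integrals. -/

section FourierTransform

variable {F : Type*} [Field F] [ValuativeRel F] [TopologicalSpace F] [IsNonarchimedeanLocalField F]
  {Λ : AddChar F Circle}

/-- First order expansion in Z with an exact quadratic remainder: Ad(1 + Z)Y = Y + [Z, Y](1 + Z)⁻¹
with (1 + Z)⁻¹ = 1 - Z(1 + Z)⁻¹. Cyclicity of the trace turns the linear term into a pairing of Z
with [Y, X]. -/
theorem trace_mul_Ad_onePlus (X Y Z : g F) (hZ : Z ∈ box F 1 1 1) :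
    (X * Ad (onePlus Z) Y).trace = (X * Y).trace + (Z * (Y * X - X * Y)).trace -
      (X * ((Z * Y - Y * Z) * (Z * (((onePlus Z)⁻¹ : G F) : g F)))).trace := by
  have hk := coe_onePlus_of_mem_ball hZ
  set k := onePlus Z with hkdef
  set K : g F := ((k⁻¹ : G F) : g F) with hK
  have h1 : K = 1 - Z * K := by
    have : (k : g F) * K = 1 := by rw [hK]; simp
    rw [hk, add_mul, one_mul] at this
    rw [← this]; abel
  have h2 : Ad k Y = Y + (Z * Y - Y * Z) * K := by
    rw [Ad_eq_iff, hk, add_mul, add_mul, one_mul, mul_assoc _ K, ← hk, hK, Units.inv_mul, mul_one, hk,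
      mul_add, mul_one]
    abel
  have h3 : (Z * Y - Y * Z) * K = (Z * Y - Y * Z) - (Z * Y - Y * Z) * (Z * K) := by
    conv_lhs => rw [h1, mul_sub, mul_one]
  have h4 : (X * (Z * Y - Y * Z)).trace = (Z * (Y * X - X * Y)).trace := by
    rw [mul_sub, mul_sub, Matrix.trace_sub, Matrix.trace_sub]
    congr 1
    · rw [Matrix.trace_mul_comm, mul_assoc]
    · rw [← mul_assoc, Matrix.trace_mul_comm]
  rw [h2, h3, mul_add, mul_sub, Matrix.trace_add, Matrix.trace_sub, h4]
  abel

variable [MeasurableSpace (g F)] [BorelSpace (g F)]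

theorem measurableEmbedding_Ad (k : G F) : MeasurableEmbedding (Ad k) :=
  (Homeomorph.mk (AdEquiv k).toEquiv (continuous_Ad k) (continuous_Ad k⁻¹)).measurableEmbedding

/-- Far from zero, the integral of `Λ (tr (X Y))` over a shell of the nilpotent cone vanishes. -/
theorem setIntegral_shell_eq_zero (hΛ : IsLevelOne Λ) (dY : Measure (g F)) [dY.IsAddHaarMeasure]
    {μ : Measure (g F)} (hN : ∀ᵐ Y ∂μ, Y ∈ nilCone F) (hinv : ∀ x : G F, μ.map (Ad x) = μ)
    (hfin : ∀ K, IsCompact K → μ K < ⊤) {X : g F} {e c n : ℤ} (hX : X ∈ box F (-e) (-e) (-e))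
    (hc : ∀ Y ∈ nilCone F, Y ∈ box F 0 0 0 → Y ∉ box F 1 1 1 →
      Y * X - X * Y ∉ box F (c + 1) (c + 1) (c + 1)) (hn : 1 + e + 2 * c ≤ n) (hn' : c + 1 ≤ n) :
    ∫ Y in (box F (-n) (-n) (-n) : Set (g F)) \ box F (1 - n) (1 - n) (1 - n),
      (Λ (X * Y).trace : ℂ) ∂μ = 0 := by
  set S : Set (g F) := (box F (-n) (-n) (-n) : Set (g F)) \ box F (1 - n) (1 - n) (1 - n) with hS
  have hSm : MeasurableSet S := (isOpen_box _ _ _).measurableSet.diff (isOpen_box _ _ _).measurableSet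
  have hSfin : μ S < ⊤ := (measure_mono Set.sdiff_subset).trans_lt (hfin _ (isCompact_ball _))
  -- The exponent n - c balances two needs. The quadratic remainder has exponent at least n - e - 2c
  -- ≥ 1, so Λ ignores it; yet the ball is large enough for its pairing with [Y, X], which is
  -- outside the ball of exponent c + 1 - n, to be nontrivial.
  have hLat := isLat_box (F := F) (n - c) (n - c) (n - c)
  set B : Set (g F) := (box F (n - c) (n - c) (n - c) : Set (g F)) with hB
  have hBm : MeasurableSet B := hLat.isOpen.measurableSet
  have hBfin : dY B < ⊤ := hLat.isCompact.measure_lt_top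
  set I := ∫ Y in S, (Λ (X * Y).trace : ℂ) ∂μ with hI
  have h1 : ∀ Z ∈ B, I = ∫ Y in S, (Λ (X * Y).trace : ℂ) * (Λ (Z * (Y * X - X * Y)).trace : ℂ) ∂μ := by
    intro Z hZ
    have hZ1 : Z ∈ box F 1 1 1 := box_mono (by omega) (by omega) (by omega) hZ
    have hk : (onePlus Z : g F) ∈ box F 0 0 0 := by
      rw [coe_onePlus_of_mem_ball hZ1]
      exact add_mem one_mem_ball (box_mono (by omega) (by omega) (by omega) hZ1)
    have hk' := inv_onePlus_mem_ball hZ1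
    have hpre : Ad (onePlus Z) ⁻¹' S = S := by
      ext Y
      simp only [hS, Set.mem_preimage, Set.mem_sdiff, SetLike.mem_coe, Ad_mem_ball_iff hk hk']
    have hmp : MeasurePreserving (Ad (onePlus Z)) μ μ := ⟨(continuous_Ad _).measurable, hinv _⟩
    rw [hI, ← hmp.setIntegral_preimage_emb (measurableEmbedding_Ad _), hpre]
    refine setIntegral_congr_fun hSm fun Y hY => ?_
    have hlast : (X * ((Z * Y - Y * Z) * (Z * (((onePlus Z)⁻¹ : G F) : g F)))).trace ∈ pw F 1 := by
      have a1 : Z * Y - Y * Z ∈ box F (n - c - n) (n - c - n) (n - c - n) :=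
        sub_mem (mul_mem_box hZ hY.1) (mul_mem_box hY.1 hZ)
      have a2 := mul_mem_ball hX (mul_mem_ball a1 (mul_mem_ball hZ hk'))
      exact pw_anti (by omega) (trace_mem_pw a2)
    change (Λ (X * Ad (onePlus Z) Y).trace : ℂ) = _
    rw [trace_mul_Ad_onePlus X Y Z hZ1, sub_eq_add_neg, AddChar.map_add_eq_mul,
      AddChar.map_add_eq_mul, hΛ.trivial _ (neg_mem hlast), mul_one, Circle.coe_mul]
  have : IsFiniteMeasure (μ.restrict S) := ⟨by simpa using hSfin⟩
  have : IsFiniteMeasure (dY.restrict B) := ⟨by simpa using hBfin⟩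
  have hcont : Continuous (Function.uncurry fun (Z Y : g F) =>
      (Λ (X * Y).trace : ℂ) * (Λ (Z * (Y * X - X * Y)).trace : ℂ)) := by
    refine (hΛ.continuous.comp (Continuous.matrix_trace ?_)).mul
      (hΛ.continuous.comp (Continuous.matrix_trace ?_)) <;> fun_prop
  have hint : Integrable (Function.uncurry fun (Z Y : g F) =>
      (Λ (X * Y).trace : ℂ) * (Λ (Z * (Y * X - X * Y)).trace : ℂ))
      ((dY.restrict B).prod (μ.restrict S)) := by
    refine Integrable.of_bound hcont.aestronglyMeasurable 1 (Filter.Eventually.of_forall fun p => ?_)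
    rw [Function.uncurry, norm_mul]
    exact le_of_eq (by rw [Circle.norm_coe, Circle.norm_coe, one_mul])
  -- Averaging the Z-independent value I over B and exchanging the integrals leaves, for each Y, the
  -- integral of a nontrivial character over a lattice.
  have h2 : ∫ _ in B, I ∂dY = 0 := by
    rw [setIntegral_congr_fun hBm h1, integral_integral_swap hint]
    refine integral_eq_zero_of_ae ?_
    filter_upwards [ae_restrict_of_ae hN, ae_restrict_mem hSm] with Y hY hYS
    rw [integral_const_mul, setIntegral_char_eq_zero dY hLat, mul_zero]
    · rfl
    have hY' : unif F ^ n • Y ∈ nilCone F := by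
      rw [mem_nilCone_iff] at hY ⊢
      rw [Matrix.trace_smul, hY.1, Matrix.det_smul, hY.2]; simp
    have hscale : ∀ (W : g F) (m : ℤ), unif F ^ n • W ∈ box F m m m ↔
        W ∈ box F (m - n) (m - n) (m - n) := by
      intro W m
      simp only [mem_box, Matrix.smul_apply, smul_eq_mul, unif_zpow_mul_mem]
    have h3 := hc _ hY' (by rw [hscale, zero_sub]; exact hYS.1) (by rw [hscale]; exact hYS.2)
    rw [Matrix.smul_mul, Matrix.mul_smul, ← smul_sub, hscale, show c + 1 - n = c - n + 1 by ring] at h3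
    have := hΛ.exists_trace_ne_one h3
    rwa [neg_sub] at this
  rw [setIntegral_const, smul_eq_zero] at h2
  refine h2.resolve_left ?_
  exact (ENNReal.toReal_pos ((isOpen_box _ _ _).measure_pos dY ⟨0, zero_mem _⟩).ne' hBfin.ne).ne'

/-- The Fourier transform of a function invariant under a ball is supported in the dual ball. -/
theorem fourier_eq_zero_of_transInv (hΛ : IsLevelOne Λ) (dY : Measure (g F)) [dY.IsAddHaarMeasure]
    {f : schwartz (g F)} {n : ℤ} (hf : f ∈ transInv (box F n n n : Set (g F))) {X : g F}
    (hX : X ∉ box F (1 - n) (1 - n) (1 - n)) : fourier dY Λ (f : g F → ℂ) X = 0 := by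
  obtain ⟨Z, hZ, hne⟩ := hΛ.exists_trace_ne_one (n := -n) (by rwa [neg_add_eq_sub])
  rw [neg_neg] at hZ
  set I := fourier dY Λ (f : g F → ℂ) X with hI
  have h1 : I = (Λ (Z * X).trace : ℂ) * I := by
    conv_lhs => rw [hI, fourier, ← integral_add_right_eq_self _ Z]
    rw [hI, fourier, ← integral_const_mul]
    congr 1
    funext Y
    rw [hf Y Z hZ, mul_add, Matrix.trace_add, AddChar.map_add_eq_mul, Circle.coe_mul,
      Matrix.trace_mul_comm Z X]
    ring
  have h2 : ((Λ (Z * X).trace : ℂ) - 1) * I = 0 := by rw [sub_mul, one_mul, ← h1, sub_self]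
  refine (mul_eq_zero.1 h2).resolve_left fun h3 => hne ?_
  exact Circle.ext (by rw [Circle.coe_one]; exact sub_eq_zero.1 h3)

theorem char_trace_add {X D Y : g F} (hΛ : IsLevelOne Λ) (h : (D * Y).trace ∈ pw F 1) :
    Λ ((X + D) * Y).trace = Λ (X * Y).trace := by
  rw [add_mul, Matrix.trace_add, AddChar.map_add_eq_mul, hΛ.trivial _ h, mul_one]

/-- Uniform lower bound for the commutator of a regular semisimple matrix with nilpotent ones. -/
theorem IsRegSemisimple.exists_commutator_bound {X : g F} (hX : IsRegSemisimple X) :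
    ∃ c : ℤ, 0 ≤ c ∧ ∀ D ∈ box F (c + 1) (c + 1) (c + 1), ∀ Y ∈ nilCone F, Y ∈ box F 0 0 0 →
      Y ∉ box F 1 1 1 → Y * (X + D) - (X + D) * Y ∉ box F (c + 1) (c + 1) (c + 1) := by
  -- K is compact and avoids 0, so its commutators with X stay away from 0. A perturbation D in the
  -- ball of exponent c + 1 changes them by less than the bound.
  set K : Set (g F) := (box F 0 0 0 : Set (g F)) ∩ ((box F 1 1 1 : Set (g F))ᶜ ∩ nilCone F) with hK
  have hcl : IsClosed (nilCone F) := by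
    have : nilCone F = (fun X : g F => (X.trace, X.det)) ⁻¹' {(0, 0)} := by
      ext X; rw [mem_nilCone_iff]; simp
    rw [this]
    exact isClosed_singleton.preimage
      ((Continuous.matrix_trace continuous_id).prodMk (Continuous.matrix_det continuous_id))
  have hKc : IsCompact K := (isCompact_ball 0).inter_right
    ((isOpen_box 1 1 1).isClosed_compl.inter hcl)
  have hK' := hKc.image (show Continuous fun Y : g F => Y * X - X * Y by fun_prop)
  have h0 : ((fun Y : g F => Y * X - X * Y) '' K)ᶜ ∈ 𝓝 (0 : g F) := by
    refine hK'.isClosed.isOpen_compl.mem_nhds ?_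
    rintro ⟨Y, ⟨-, h1, h2⟩, h3⟩
    refine hX.commutator_ne_zero h2 ?_ h3
    rintro rfl
    exact h1 (zero_mem _)
  obtain ⟨n, -, hn⟩ := hasBasis_nhds_zero_ball.mem_iff.1 h0
  refine ⟨max n 0, le_max_right _ _, fun D hD Y hY hY0 hY1 h => ?_⟩
  have hD' : D * Y - Y * D ∈ box F (max n 0 + 1) (max n 0 + 1) (max n 0 + 1) :=
    sub_mem (mul_mem_box hD hY0) (mul_mem_box hY0 hD)
  have h2 := add_mem h hD'
  have e : Y * (X + D) - (X + D) * Y + (D * Y - Y * D) = Y * X - X * Y := by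
    rw [mul_add, add_mul]; abel
  rw [e] at h2
  exact hn (box_mono (by omega) (by omega) (by omega) h2) ⟨Y, ⟨hY0, hY1, hY⟩, rfl⟩

/-- Near a regular semisimple point, the Fourier transform of an invariant measure on the nilpotent
cone is given by a constant. -/
theorem exists_hasValueAt_fourierDist (hΛ : IsLevelOne Λ) (dY : Measure (g F)) [dY.IsAddHaarMeasure]
    {O : NilOrbit F} {μ : Measure (g F)} (hμ : IsOrbitalMeasure O μ) {X : g F}
    (hX : IsRegSemisimple X) : ∃ c, HasValueAt dY (fourierDist dY Λ μ) X c := by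
  have hN : ∀ᵐ Y ∂μ, Y ∈ nilCone F := by
    have : ∀ᵐ X ∂μ, X ∈ O.1 := hμ.carried
    filter_upwards [this] with Y hY using orbit_subset_nilCone O hY
  obtain ⟨c, hc0, hc⟩ := hX.exists_commutator_bound
  obtain ⟨e', he'⟩ := exists_ball_mem X
  obtain ⟨e, he0, he⟩ : ∃ e : ℤ, 0 ≤ e ∧ X ∈ box F (-e) (-e) (-e) :=
    ⟨max (-e') 0, le_max_right _ _, box_mono (by omega) (by omega) (by omega) he'⟩
  set n₀ : ℤ := 1 + e + 2 * c with hn₀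
  set J : ℤ → g F → ℂ := fun n X' => ∫ Y in (box F (-n) (-n) (-n) : Set (g F)), (Λ (X' * Y).trace : ℂ) ∂μ
    with hJ
  set U : Set (g F) := {X' | X' - X ∈ box F (c + 1 + n₀) (c + 1 + n₀) (c + 1 + n₀)} with hU
  -- The value is the truncated integral at radius n₀. Larger radii only add vanishing shells, and
  -- on the ball of radius n₀ the phase is the same for X' and X.
  have hshift : ∀ X' ∈ U, ∀ l : ℕ, J (n₀ + l) X' = J n₀ X := by
    intro X' hX' l
    have hX'e : X' ∈ box F (-e) (-e) (-e) := by
      have := add_mem (box_mono (F := F) (a := -e) (b := -e) (c := -e) (by omega) (by omega) (by omega) hX') he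
      rwa [sub_add_cancel] at this
    have hXX' : X' = X + (X' - X) := by abel
    induction l with
    | zero =>
      simp only [hJ, Nat.cast_zero, add_zero]
      refine setIntegral_congr_fun (isOpen_box _ _ _).measurableSet fun Y hY => ?_
      rw [hXX', char_trace_add hΛ]
      exact pw_anti (by omega) (trace_mem_pw (mul_mem_ball hX' hY))
    | succ l ih =>
      rw [← ih]
      have hfinite : ∀ n : ℤ, IntegrableOn (fun Y => (Λ (X' * Y).trace : ℂ))
          (box F n n n : Set (g F)) μ := by
        intro n
        have : IsFiniteMeasure (μ.restrict (box F n n n : Set (g F))) :=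
          ⟨by simpa using hμ.finite _ (isCompact_ball n)⟩
        refine Integrable.of_bound (Continuous.aestronglyMeasurable ?_) 1
          (Filter.Eventually.of_forall fun Y => (Circle.norm_coe _).le)
        exact hΛ.continuous.comp (Continuous.matrix_trace (by fun_prop))
      have h1 := setIntegral_shell_eq_zero hΛ dY hN hμ.invariant hμ.finite (X := X') (e := e) (c := c)
        (n := n₀ + (l + 1 : ℕ)) hX'e (fun Y hY h0 h1 => by
          have := hc (X' - X) (box_mono (by omega) (by omega) (by omega) hX') Y hY h0 h1
          rwa [← hXX'] at this) (by omega) (by omega)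
      rw [setIntegral_sdiff (isOpen_box _ _ _).measurableSet (hfinite _)
        (box_mono (by omega) (by omega) (by omega)), sub_eq_zero] at h1
      simp only [hJ]
      rw [h1]
      congr 4 <;> push_cast <;> ring
  refine ⟨J n₀ X, U, (isOpen_coset (isLat_box _ _ _) X).mem_nhds (by simp [zero_mem]),
    fun f hf => ?_⟩
  obtain ⟨M, hM⟩ := exists_mem_transInv_ball f
  -- Invariance of f under the ball of exponent M puts its transform in the ball of exponent 1 - M,
  -- which this truncation contains.
  set l : ℕ := (M - 1 - n₀).toNat with hl
  set N : ℤ := n₀ + l with hNdef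
  have hsupp : ∀ Y ∉ (box F (-N) (-N) (-N) : Set (g F)), fourier dY Λ (f : g F → ℂ) Y = 0 := by
    intro Y hY
    refine fourier_eq_zero_of_transInv hΛ dY hM fun h => hY ?_
    exact box_mono (by omega) (by omega) (by omega) h
  rw [fourierDist, ← setIntegral_eq_integral_of_forall_compl_eq_zero hsupp]
  simp only [fourier]
  have : IsFiniteMeasure (μ.restrict (box F (-N) (-N) (-N) : Set (g F))) :=
    ⟨by simpa using hμ.finite _ (isCompact_ball _)⟩
  have hfi : Integrable (f : g F → ℂ) dY := integrable_schwartz dY (fun K hK => hK.measure_lt_top) f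
  have hint : Integrable (Function.uncurry fun (Y X' : g F) => (f : g F → ℂ) X' * (Λ (Y * X').trace : ℂ))
      ((μ.restrict (box F (-N) (-N) (-N) : Set (g F))).prod dY) := by
    have h1 : Integrable (fun p : g F × g F => (f : g F → ℂ) p.2)
        ((μ.restrict (box F (-N) (-N) (-N) : Set (g F))).prod dY) := hfi.comp_snd _
    refine h1.mul_bdd (c := 1) (Continuous.aestronglyMeasurable ?_)
      (Filter.Eventually.of_forall fun p => (Circle.norm_coe _).le)
    exact hΛ.continuous.comp (Continuous.matrix_trace (by fun_prop))
  rw [integral_integral_swap hint, ← integral_const_mul]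
  congr 1
  funext X'
  rw [integral_const_mul, mul_comm]
  by_cases hX' : (f : g F → ℂ) X' = 0
  · rw [hX', mul_zero, mul_zero]
  · rw [← hshift X' (hf hX') l]
    simp only [hJ]
    congr 2
    funext Y
    rw [Matrix.trace_mul_comm]

end FourierTransform

end GLTwo

namespace GLTwo

/-! ### Annihilators of lattices and Fourier inversion. -/

section Fourier

variable {F : Type*} [Field F] [ValuativeRel F] [TopologicalSpace F] [IsNonarchimedeanLocalField F]
  {Λ : AddChar F Circle}

/-- The annihilator of a lattice for the pairing `Λ (tr (X * Y))`. -/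
def perp (Λ : AddChar F Circle) (L : AddSubgroup (g F)) : AddSubgroup (g F) where
  carrier := {Z | ∀ Y ∈ L, Λ (Z * Y).trace = 1}
  zero_mem' := fun Y _ => by simp
  add_mem' := fun {a b} ha hb Y hY => by
    rw [add_mul, Matrix.trace_add, AddChar.map_add_eq_mul, ha Y hY, hb Y hY, one_mul]
  neg_mem' := fun {a} ha Y hY => by
    rw [neg_mul, Matrix.trace_neg, AddChar.map_neg_eq_inv, ha Y hY, inv_one]

theorem trace_Ad_mul (k : G F) (X Y : g F) : (Ad k X * Ad k Y).trace = (X * Y).trace := by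
  rw [← Ad_mul_mat, trace_Ad]

/-- The trace pairs the entry (i, j) with the entry (j, i), and P^(1-e) is the annihilator of P^e
for Λ, which is trivial on P but not on O. -/
theorem mem_perp_iff_entries (hΛ : IsLevelOne Λ) {L : AddSubgroup (g F)} {h : G F}
    {e : Fin 2 → Fin 2 → ℤ} (hL : ∀ Y, Y ∈ L ↔ ∀ i j, (Ad h⁻¹ Y) i j ∈ pw F (e i j)) {Z : g F} :
    Z ∈ perp Λ L ↔ ∀ i j, (Ad h⁻¹ Z) i j ∈ pw F (1 - e j i) := by
  constructor
  · intro hZ i j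
    by_contra hn
    obtain ⟨t, ht, hne⟩ := hΛ.exists_ne_one (n := -e j i) (z := (Ad h⁻¹ Z) i j)
      (by rwa [neg_add_eq_sub])
    rw [neg_neg] at ht
    refine hne ?_
    rw [← trace_single_mul, Matrix.trace_mul_comm, ← Ad_inv_Ad h (Matrix.single j i t), trace_Ad_mul]
    refine hZ _ ((hL _).2 fun i' j' => ?_)
    rw [Ad_inv_Ad, Matrix.single_apply]
    split_ifs with hij
    · rw [← hij.1, ← hij.2]; exact ht
    · exact zero_mem _
  · intro hZ Y hY
    rw [hL] at hY
    rw [← trace_Ad_mul h⁻¹]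
    refine hΛ.trivial _ ?_
    rw [Matrix.trace]
    refine sum_mem fun i _ => ?_
    rw [Matrix.diag_apply, Matrix.mul_apply]
    exact sum_mem fun j _ => mul_mem_pw' (hZ i j) (hY j i)

theorem perp_ball (hΛ : IsLevelOne Λ) (n : ℤ) :
    perp Λ (box F n n n) = box F (1 - n) (1 - n) (1 - n) := by
  ext Z
  rw [mem_perp_iff_entries hΛ (h := 1) (e := fun _ _ => n)]
  · simp only [inv_one, Ad_one, Fin.forall_fin_two, mem_box]; tauto
  · intro Y; simp only [inv_one, Ad_one, Fin.forall_fin_two, mem_box]; tauto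

theorem perp_latPlusGrp (hΛ : IsLevelOne Λ) (x : Building F) (s : ℝ) :
    perp Λ (latPlusGrp F x s) = latGrp F x (-s) := by
  obtain ⟨h, t, rfl⟩ := exists_pt x
  ext Z
  rw [mem_perp_iff_entries hΛ (fun Y => mem_latPlus_pt)]
  refine Iff.trans ?_ mem_lat_pt.symm
  refine forall_congr' fun i => forall_congr' fun j => ?_
  rw [show -s + t i - t j = -(s + t j - t i) by ring, Int.ceil_neg]
  ring_nf

theorem perp_latGrp (hΛ : IsLevelOne Λ) (x : Building F) (s : ℝ) :
    perp Λ (latGrp F x s) = latPlusGrp F x (-s) := by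
  obtain ⟨h, t, rfl⟩ := exists_pt x
  ext Z
  rw [mem_perp_iff_entries hΛ (fun Y => mem_lat_pt)]
  refine Iff.trans ?_ mem_latPlus_pt.symm
  refine forall_congr' fun i => forall_congr' fun j => ?_
  rw [show -s + t i - t j = -(s + t j - t i) by ring, Int.floor_neg]
  ring_nf

variable [MeasurableSpace (g F)] [BorelSpace (g F)] (dY : Measure (g F)) [dY.IsAddHaarMeasure]

theorem integrable_mul_char (hΛ : IsLevelOne Λ) (f : schwartz (g F)) (X : g F) :
    Integrable (fun Y => (f : g F → ℂ) Y * (Λ (X * Y).trace : ℂ)) dY := by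
  refine Continuous.integrable_of_hasCompactSupport ?_ f.2.2.mul_right
  refine f.2.1.continuous.mul ?_
  simp_rw [Matrix.trace_mul_comm X]
  exact continuous_char_trace hΛ X

open Classical in
theorem fourier_cosetInd {L : AddSubgroup (g F)} (hL : IsLat L) (c Z : g F) :
    fourier dY Λ (cosetInd c L : g F → ℂ) Z =
      Λ (Z * c).trace * if Z ∈ perp Λ L then (dY.real (L : Set (g F)) : ℂ) else 0 := by
  rw [fourier, ← integral_add_right_eq_self _ c]
  have h1 : ∀ Y, (cosetInd c L : g F → ℂ) (Y + c) * (Λ (Z * (Y + c)).trace : ℂ) =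
      Λ (Z * c).trace * (L : Set (g F)).indicator (fun Y => (Λ (Y * Z).trace : ℂ)) Y := by
    intro Y
    rw [cosetInd_apply hL, add_sub_cancel_right, mul_add, Matrix.trace_add, AddChar.map_add_eq_mul,
      Circle.coe_mul, Matrix.trace_mul_comm Z Y]
    by_cases hY : Y ∈ L
    · rw [if_pos hY, Set.indicator_of_mem (SetLike.mem_coe.2 hY)]; ring
    · rw [if_neg hY, Set.indicator_of_notMem (by simpa using hY)]; ring
  simp_rw [h1]
  rw [integral_const_mul, integral_indicator hL.isOpen.measurableSet]
  congr 1
  split_ifs with hZ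
  · rw [setIntegral_congr_fun (g := fun _ => (1 : ℂ)) hL.isOpen.measurableSet]
    · simp
    · intro Y hY
      simp only [Matrix.trace_mul_comm Y Z, hZ Y hY, Circle.coe_one]
  · refine setIntegral_char_eq_zero dY hL ?_
    by_contra! hn
    exact hZ fun Y hY => by rw [Matrix.trace_mul_comm, hn Y hY]

theorem fourier_add_of_mem_perp {f : g F → ℂ} {L : AddSubgroup (g F)} (hf : Function.support f ⊆ L)
    {X Z : g F} (hZ : Z ∈ perp Λ L) : fourier dY Λ f (X + Z) = fourier dY Λ f X := by
  refine integral_congr_ae (Filter.Eventually.of_forall fun Y => ?_)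
  by_cases hY : f Y = 0
  · simp [hY]
  · simp only [add_mul, Matrix.trace_add, AddChar.map_add_eq_mul, hZ Y (hf hY), mul_one]

theorem fourier_mem_schwartz (hΛ : IsLevelOne Λ) (f : schwartz (g F)) :
    fourier dY Λ (f : g F → ℂ) ∈ schwartz (g F) := by
  constructor
  · obtain ⟨m, hm⟩ := exists_ball_superset (isCompact_support_schwartz f)
    rw [IsLocallyConstant.iff_eventually_eq]
    intro X
    refine mem_nhds_iff_ball.2 ⟨1 - m, fun Z hZ => ?_⟩
    exact fourier_add_of_mem_perp dY hm (by rwa [perp_ball hΛ])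
  · obtain ⟨n, hn⟩ := exists_mem_transInv_ball f
    refine HasCompactSupport.intro (isCompact_ball (1 - n)) fun X hX => ?_
    exact fourier_eq_zero_of_transInv hΛ dY hn hX

/-- The Fourier transform as an endomorphism of the Schwartz space. -/
noncomputable def fourierMap (hΛ : IsLevelOne Λ) : schwartz (g F) →ₗ[ℂ] schwartz (g F) where
  toFun f := ⟨_, fourier_mem_schwartz dY hΛ f⟩
  map_add' f f' := by
    ext X
    change fourier _ _ _ _ = fourier _ _ _ _ + fourier _ _ _ _
    rw [fourier, fourier, fourier,
      ← integral_add (integrable_mul_char dY hΛ f X) (integrable_mul_char dY hΛ f' X)]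
    refine integral_congr_ae (Filter.Eventually.of_forall fun Y => ?_)
    exact add_mul _ _ _
  map_smul' c f := by
    ext X
    change fourier _ _ _ _ = c * fourier _ _ _ _
    rw [fourier, fourier, ← integral_const_mul]
    refine integral_congr_ae (Filter.Eventually.of_forall fun Y => ?_)
    exact mul_assoc _ _ _

theorem fourierMap_apply (hΛ : IsLevelOne Λ) (f : schwartz (g F)) (X : g F) :
    (fourierMap dY hΛ f : g F → ℂ) X = fourier dY Λ (f : g F → ℂ) X := rfl

/-- The constant in the inversion formula, computed from the ball of radius `n`. -/
noncomputable def inversionConst (n : ℤ) : ℂ :=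
  dY.real (box F n n n : Set (g F)) * dY.real (box F (1 - n) (1 - n) (1 - n) : Set (g F))

theorem measureReal_pos_of_isLat {L : AddSubgroup (g F)} (hL : IsLat L) :
    0 < dY.real (L : Set (g F)) :=
  ENNReal.toReal_pos (hL.isOpen.measure_pos dY ⟨0, zero_mem L⟩).ne' hL.isCompact.measure_lt_top.ne

theorem inversionConst_ne_zero (n : ℤ) : inversionConst dY n ≠ 0 :=
  mul_ne_zero (Complex.ofReal_ne_zero.2 (measureReal_pos_of_isLat dY (isLat_box _ _ _)).ne')
    (Complex.ofReal_ne_zero.2 (measureReal_pos_of_isLat dY (isLat_box _ _ _)).ne')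

theorem fourier_fourier_cosetInd (hΛ : IsLevelOne Λ) (n : ℤ) (c X : g F) :
    (fourierMap dY hΛ (fourierMap dY hΛ (cosetInd c (box F n n n))) : g F → ℂ) X =
      inversionConst dY n * (cosetInd c (box F n n n) : g F → ℂ) (-X) := by
  classical
  have hL := isLat_box (F := F) n n n
  have hL' := isLat_box (F := F) (1 - n) (1 - n) (1 - n)
  have h1 : (fourierMap dY hΛ (cosetInd c (box F n n n)) : g F → ℂ) = fun Z =>
      (Λ (Z * c).trace : ℂ) *
        ((dY.real (box F n n n : Set (g F)) : ℂ) *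
          (cosetInd 0 (box F (1 - n) (1 - n) (1 - n)) : g F → ℂ) Z) := by
    ext Z
    rw [fourierMap_apply, fourier_cosetInd dY hL, perp_ball hΛ, cosetInd_apply hL', sub_zero]
    simp
  rw [fourierMap_apply, fourier, h1]
  have h2 : ∀ Y : g F, (Λ (Y * c).trace : ℂ) * ((dY.real (box F n n n : Set (g F)) : ℂ) *
      (cosetInd 0 (box F (1 - n) (1 - n) (1 - n)) : g F → ℂ) Y) * (Λ (X * Y).trace : ℂ) =
      (dY.real (box F n n n : Set (g F)) : ℂ) *
      ((cosetInd 0 (box F (1 - n) (1 - n) (1 - n)) : g F → ℂ) Y * Λ ((X + c) * Y).trace) := by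
    intro Y
    rw [add_mul, Matrix.trace_add, AddChar.map_add_eq_mul, Matrix.trace_mul_comm c Y, Circle.coe_mul]
    ring
  simp_rw [h2]
  rw [integral_const_mul]
  change _ * fourier dY Λ _ _ = _
  rw [fourier_cosetInd dY hL', perp_ball hΛ, cosetInd_apply hL, inversionConst]
  have h3 : X + c ∈ box F (1 - (1 - n)) (1 - (1 - n)) (1 - (1 - n)) ↔ -X - c ∈ box F n n n := by
    rw [sub_sub_cancel, ← neg_mem_iff, neg_add, sub_eq_add_neg]
  simp only [h3, mul_zero, Matrix.trace_zero, AddChar.map_zero_eq_one, Circle.coe_one, one_mul]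
  split_ifs <;> simp

theorem fourier_fourier_of_transInv (hΛ : IsLevelOne Λ) {n : ℤ} {f : schwartz (g F)}
    (hf : f ∈ transInv (box F n n n : Set (g F))) (X : g F) :
    (fourierMap dY hΛ (fourierMap dY hΛ f) : g F → ℂ) X =
      inversionConst dY n * (f : g F → ℂ) (-X) := by
  obtain ⟨R, -, hR⟩ := exists_sum_cosetInd (isLat_box n n n) hf
  have h (R : Finset (g F)) (a : g F → ℂ) (X : g F) :
      (fourierMap dY hΛ (fourierMap dY hΛ (∑ c ∈ R, a c • cosetInd c (box F n n n))) : g F → ℂ) X =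
      inversionConst dY n * (∑ c ∈ R, a c • cosetInd c (box F n n n) : schwartz (g F)).1 (-X) := by
    simp only [map_sum, map_smul, Submodule.coe_sum, Submodule.coe_smul, Finset.sum_apply,
      Pi.smul_apply, fourier_fourier_cosetInd, smul_eq_mul, Finset.mul_sum]
    exact Finset.sum_congr rfl fun c _ => by ring
  have := h R (f : g F → ℂ) X
  rwa [← hR] at this

/-- The indicator of the larger ball is also invariant under the smaller one, so both constants
compute the same double transform at 0. -/
theorem inversionConst_eq (hΛ : IsLevelOne Λ) (n m : ℤ) : inversionConst dY n = inversionConst dY m := by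
  wlog h : n ≤ m generalizing n m
  · exact (this m n (by omega)).symm
  have h1 := fourier_fourier_cosetInd dY hΛ n 0 0
  rw [fourier_fourier_of_transInv dY hΛ (n := m)] at h1
  · have h2 : (cosetInd 0 (box F n n n) : g F → ℂ) (-0) = 1 := by
      rw [cosetInd_apply (isLat_box n n n), if_pos (by simp)]
    rw [h2, mul_one, mul_one] at h1
    exact h1.symm
  · intro X Y hY
    exact cosetInd_mem_transInv (isLat_box n n n) 0 X Y (box_mono (by omega) (by omega) (by omega) hY)

theorem fourier_inversion (hΛ : IsLevelOne Λ) (f : schwartz (g F)) (X : g F) :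
    (fourierMap dY hΛ (fourierMap dY hΛ f) : g F → ℂ) X =
      inversionConst dY 0 * (f : g F → ℂ) (-X) := by
  obtain ⟨n, hn⟩ := exists_mem_transInv_ball f
  rw [fourier_fourier_of_transInv dY hΛ hn, inversionConst_eq dY hΛ n 0]

end Fourier

end GLTwo

namespace GLTwo

/-! ### Biduality of lattices. -/

section Duality

variable {F : Type*} [Field F] [ValuativeRel F] [TopologicalSpace F] [IsNonarchimedeanLocalField F]
  {Λ : AddChar F Circle} [MeasurableSpace (g F)] [BorelSpace (g F)]

theorem support_fourier_cosetInd (hΛ : IsLevelOne Λ) (dY : Measure (g F)) [dY.IsAddHaarMeasure]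
    {L : AddSubgroup (g F)} (hL : IsLat L) :
    Function.support (fourierMap dY hΛ (cosetInd 0 L) : g F → ℂ) = perp Λ L := by
  classical
  ext Z
  have := (measureReal_pos_of_isLat dY hL).ne'
  rw [Function.mem_support, fourierMap_apply, fourier_cosetInd dY hL]
  simp [this]

/-- The annihilator is the support of the Fourier transform of the indicator of L, which is again
locally constant with compact support. -/
theorem isLat_perp (hΛ : IsLevelOne Λ) {L : AddSubgroup (g F)} (hL : IsLat L) :
    IsLat (perp Λ L) := by
  have h := support_fourier_cosetInd hΛ Measure.addHaar hL
  constructor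
  · rw [← h]
    exact (fourierMap Measure.addHaar hΛ (cosetInd 0 L)).2.1 {0}ᶜ
  · rw [← h]; exact isCompact_support_schwartz _

/-- Supports are compared in the inversion formula for the indicator of L; the sign there is
harmless since L = -L. -/
theorem perp_perp (hΛ : IsLevelOne Λ) {L : AddSubgroup (g F)} (hL : IsLat L) :
    perp Λ (perp Λ L) = L := by
  classical
  have hL' := isLat_perp hΛ hL
  set dY : Measure (g F) := Measure.addHaar
  have hp := (measureReal_pos_of_isLat dY hL).ne'
  have h1 : fourierMap dY hΛ (cosetInd 0 L) =
      (dY.real (L : Set (g F)) : ℂ) • cosetInd 0 (perp Λ L) := by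
    ext Z
    rw [fourierMap_apply, fourier_cosetInd dY hL, Submodule.coe_smul, Pi.smul_apply,
      cosetInd_apply hL', sub_zero]
    simp
  ext X
  have h2 := fourier_inversion dY hΛ (cosetInd 0 L) X
  rw [h1, map_smul, Submodule.coe_smul, Pi.smul_apply, cosetInd_apply hL, sub_zero, neg_mem_iff] at h2
  have h3 := Set.ext_iff.1 (support_fourier_cosetInd hΛ dY hL') X
  rw [SetLike.mem_coe] at h3
  rw [← h3, Function.mem_support]
  by_cases hX : X ∈ L
  · rw [if_pos hX, mul_one] at h2
    refine iff_of_true (fun h0 => ?_) hX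
    rw [h0, smul_zero] at h2
    exact inversionConst_ne_zero dY 0 h2.symm
  · rw [if_neg hX, mul_zero, smul_eq_mul, mul_eq_zero] at h2
    refine iff_of_false (fun h0 => h2.elim (fun h => ?_) h0) hX
    exact hp (Complex.ofReal_eq_zero.1 h)

theorem IsLat.sup {A B : AddSubgroup (g F)} (hA : IsLat A) (hB : IsLat B) : IsLat (A ⊔ B) := by
  constructor
  · exact AddSubgroup.isOpen_mono (le_sup_left : A ≤ A ⊔ B) hA.isOpen
  · have : ((A ⊔ B : AddSubgroup (g F)) : Set (g F)) =
        (fun p : g F × g F => p.1 + p.2) '' ((A : Set (g F)) ×ˢ (B : Set (g F))) := by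
      ext X
      simp only [SetLike.mem_coe, AddSubgroup.mem_sup, Set.mem_image, Set.mem_prod, Prod.exists]
      constructor
      · rintro ⟨a, ha, b, hb, h⟩; exact ⟨a, b, ⟨ha, hb⟩, h⟩
      · rintro ⟨a, b, ⟨ha, hb⟩, h⟩; exact ⟨a, ha, b, hb, h⟩
    rw [this]
    exact (hA.isCompact.prod hB.isCompact).image (continuous_fst.add continuous_snd)

/-- The annihilator of A + B lies in both annihilators, so biduality for A + B gives the
decomposition. This turns triviality of a character on an intersection into membership in a sum. -/
theorem exists_add_eq_of_perp (hΛ : IsLevelOne Λ) {A B : AddSubgroup (g F)} (hA : IsLat A)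
    (hB : IsLat B) {X : g F} (hX : ∀ Z ∈ perp Λ A, Z ∈ perp Λ B → Λ (X * Z).trace = 1) :
    ∃ a ∈ A, ∃ b ∈ B, a + b = X := by
  rw [← AddSubgroup.mem_sup, ← perp_perp hΛ (hA.sup hB)]
  intro Z hZ
  exact hX Z (fun Y hY => hZ Y (AddSubgroup.mem_sup_left hY))
    (fun Y hY => hZ Y (AddSubgroup.mem_sup_right hY))

end Duality

/-! ### Unimodularity. -/

section Unimodular

variable {F : Type*} [Field F] [ValuativeRel F] [TopologicalSpace F] [IsNonarchimedeanLocalField F]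

/-- A positive character of `GL(2,F)` that is trivial on the center is trivial. -/
theorem monoidHom_eq_one (φ : G F →* NNReal) (hφ : ∀ s : Fˣ, φ (diagG s s) = 1) (x : G F) :
    φ x = 1 := by
  have hne : ∀ x, φ x ≠ 0 := fun x h => by
    have := map_mul φ x x⁻¹
    rw [mul_inv_cancel, map_one, h, zero_mul] at this
    exact one_ne_zero this
  have hsq : ∀ x, φ x * φ x = 1 → φ x = 1 := fun x h => by
    rw [← sq] at h
    exact (pow_eq_one_iff_of_nonneg zero_le two_ne_zero).1 h
  have hconj : ∀ x y : G F, φ (x * y * x⁻¹) = φ y := fun x y => by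
    rw [map_mul, map_mul, mul_right_comm, ← map_mul, mul_inv_cancel, map_one, one_mul]
  have hu1 : unif F ≠ 1 := fun h => by
    have := nabs_unif_zpow (F := F) 1
    rw [h, zpow_one, nabs_one, zpow_neg_one] at this
    exact (inv_lt_one_of_one_lt₀ (one_lt_q F)).ne this.symm
  have hw : φ (weyl F) = 1 := by
    refine hsq _ ?_
    rw [← map_mul, ← hφ 1]
    congr 1
    ext : 1
    simp only [Units.val_mul, weyl, diagG, coe_mkG]
    refine ext_g ?_ ?_ ?_ ?_ <;> simp [Matrix.mul_apply, Fin.sum_univ_two]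
  refine GL2_induction (P := fun x => φ x = 1) ?_ ?_ ?_ hw x
  · intro x y hx hy
    rw [map_mul, hx, hy, one_mul]
  -- diag(s, t) and its Weyl conjugate diag(t, s) have a scalar product, so the square of the value
  -- is 1; values are positive.
  · intro s t
    refine hsq _ ?_
    rw [← hφ (s * t)]
    nth_rw 1 [← hconj (weyl F) (diagG s t)]
    rw [← map_mul]
    congr 1
    rw [show weyl F * diagG s t * (weyl F)⁻¹ = diagG t s from ?_]
    · ext : 1
      simp only [Units.val_mul, diagG, coe_mkG]
      refine ext_g ?_ ?_ ?_ ?_ <;> simp [Matrix.mul_apply, Fin.sum_univ_two, mul_comm]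
    · rw [mul_inv_eq_iff_eq_mul]
      ext : 1
      simp only [Units.val_mul, weyl, diagG, coe_mkG]
      refine ext_g ?_ ?_ ?_ ?_ <;> simp [Matrix.mul_apply, Fin.sum_univ_two]
  -- Each lower unipotent element is a commutator of a unipotent with diag(1, ϖ), since ϖ - 1 is
  -- invertible.
  · intro u
    set s : Fˣ := Units.mk0 (unif F) (unif_ne_zero F) with hs
    set v : F := u / (unif F - 1) with hv
    have hvu : (unif F - 1) * v = u := mul_div_cancel₀ u (sub_ne_zero.2 hu1)
    have h1 : diagG 1 s * lowU v * (diagG 1 s)⁻¹ = lowU v * lowU u := by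
      rw [mul_inv_eq_iff_eq_mul]
      ext : 1
      simp only [Units.val_mul, lowU, diagG, coe_mkG, hs, Units.val_mk0]
      refine ext_g ?_ ?_ ?_ ?_ <;> simp [Matrix.mul_apply, Fin.sum_univ_two]
      rw [← hvu]; ring
    have h2 := hconj (diagG 1 s) (lowU v)
    rw [h1, map_mul] at h2
    exact (mul_eq_left₀ (hne _)).1 h2

/-- The adjoint action as a continuous automorphism. -/
def AdCont (k : G F) : g F ≃ₜ+ g F where
  toAddEquiv := AdEquiv k
  continuous_toFun := continuous_Ad k
  continuous_invFun := continuous_Ad k⁻¹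

/-- The factor by which Ad scales Haar measure is a positive character of G, trivial on the center.
-/
theorem map_Ad_addHaar [MeasurableSpace (g F)] [BorelSpace (g F)] (dY : Measure (g F))
    [dY.IsAddHaarMeasure] (k : G F) : dY.map (Ad k) = dY := by
  let φ : G F →* NNReal :=
    { toFun := fun k => addEquivAddHaarChar (AdCont k)
      map_one' := by
        rw [← addEquivAddHaarChar_refl (G := g F)]
        congr 1
        ext X : 1
        exact Ad_one X
      map_mul' := fun x y => by
        rw [mul_comm, ← addEquivAddHaarChar_trans]
        congr 1
        ext X : 1
        exact Ad_mul x y X }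
  have h1 : φ k = 1 := by
    refine monoidHom_eq_one φ (fun s => ?_) k
    rw [← map_one φ]
    change addEquivAddHaarChar _ = addEquivAddHaarChar _
    congr 1
    ext X : 1
    change Ad _ X = Ad _ X
    rw [Ad_one, Ad_eq_iff]
    simp only [diagG, coe_mkG]
    refine ext_g ?_ ?_ ?_ ?_ <;> simp [Matrix.mul_apply, Fin.sum_univ_two, mul_comm]
  have h2 := addEquivAddHaarChar_smul_map dY (AdCont k)
  rwa [show addEquivAddHaarChar (AdCont k) = 1 from h1, one_smul] at h2

variable (F) in
theorem isOpenEmbedding_coe : IsOpenEmbedding (fun γ : G F => (γ : g F)) := by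
  have hU : ∀ X : g F, IsUnit X ↔ X.det ≠ 0 := fun X => by
    rw [Matrix.isUnit_iff_isUnit_det, isUnit_iff_ne_zero]
  have hdet : Continuous fun X : g F => X.det := continuous_id.matrix_det
  refine ⟨?_, ?_⟩
  · refine Units.isEmbedding_val_mk' (f := fun X : g F => X⁻¹) ?_ fun u => (Matrix.coe_units_inv u).symm
    have : (fun X : g F => X⁻¹) = fun X => (X.det)⁻¹ • X.adjugate := by
      ext X : 1
      rw [Matrix.inv_def, Ring.inverse_eq_inv']
    rw [this]
    refine ContinuousOn.smul (hdet.continuousOn.inv₀ fun X hX => (hU X).1 hX) ?_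
    exact (continuous_id.matrix_adjugate).continuousOn
  · have : Set.range (fun γ : G F => (γ : g F)) = {X | X.det ≠ 0} := by
      ext X
      rw [Set.mem_ofPred_eq, ← hU]; rfl
    rw [this]
    exact isOpen_ne_fun hdet continuous_const

instance : LocallyCompactSpace (G F) := (isOpenEmbedding_coe F).locallyCompactSpace
instance : SecondCountableTopology (G F) := (isOpenEmbedding_coe F).isEmbedding.secondCountableTopology
instance : T2Space (G F) := (isOpenEmbedding_coe F).isEmbedding.t2Space

/-- For central x, right and left translations agree, so the modular character is trivial on the
center and `monoidHom_eq_one` applies. -/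
theorem isMulRightInvariant_haar [MeasurableSpace (G F)] [BorelSpace (G F)] (dγ : Measure (G F))
    [dγ.IsHaarMeasure] : dγ.IsMulRightInvariant := by
  have hmap : ∀ x : G F, dγ.map (· * x) = Measure.modularCharacterFun x • dγ := fun x => by
    rw [Measure.modularCharacterFun_eq_haarScalarFactor dγ x]
    exact Measure.isMulLeftInvariant_eq_smul _ dγ
  refine ⟨fun x => ?_⟩
  have h1 : Measure.modularCharacter x = 1 := by
    refine monoidHom_eq_one Measure.modularCharacter (fun s => ?_) x
    have h := hmap (diagG s s)
    have hc : (fun x : G F => x * diagG s s) = fun x => diagG s s * x := by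
      ext x : 1
      ext : 1
      simp only [Units.val_mul, diagG, coe_mkG]
      refine ext_g ?_ ?_ ?_ ?_ <;> simp [Matrix.mul_apply, Fin.sum_univ_two, mul_comm]
    rw [hc, map_mul_left_eq_self] at h
    obtain ⟨K, hKc, hK1⟩ := exists_compact_mem_nhds (1 : G F)
    have h3 := congrArg (fun m => m K) h
    simp only [Measure.smul_apply] at h3
    have hpos : dγ K ≠ 0 := (Measure.measure_pos_of_mem_nhds dγ hK1).ne'
    have hlt := (hKc.measure_lt_top (μ := dγ)).ne
    rw [ENNReal.smul_def, smul_eq_mul] at h3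
    have h4 : ((Measure.modularCharacterFun (diagG s s : G F) : NNReal) : ENNReal) = 1 := by
      rw [← ENNReal.mul_left_inj hpos hlt, one_mul, ← h3]
    exact_mod_cast h4
  rw [hmap, show Measure.modularCharacterFun x = 1 from h1, one_smul]

theorem integral_conj [MeasurableSpace (G F)] [BorelSpace (G F)] (dγ : Measure (G F))
    [dγ.IsHaarMeasure] (x : G F) (f : G F → ℂ) : ∫ γ, f (x * γ * x⁻¹) ∂dγ = ∫ γ, f γ ∂dγ := by
  have := isMulRightInvariant_haar dγ
  rw [← integral_mul_left_eq_self f x, ← integral_mul_right_eq_self (fun γ => f (x * γ)) x⁻¹]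
  simp only [mul_assoc]

end Unimodular

end GLTwo

namespace GLTwo

/-! ### Transport of functions along open embeddings, and values of distributions. -/

section Embedding

variable {A B : Type*} [TopologicalSpace A] [TopologicalSpace B]

theorem comp_mem_schwartz [T2Space A] {j : A → B} (hj : IsOpenEmbedding j) (f : schwartz B)
    (hf : Function.support (f : B → ℂ) ⊆ Set.range j) : (f : B → ℂ) ∘ j ∈ schwartz A := by
  refine ⟨f.2.1.comp_continuous hj.continuous, ?_⟩
  refine HasCompactSupport.of_support_subset_isCompact
    (hj.isInducing.isCompact_preimage' (isCompact_support_schwartz f) hf) fun a ha => ha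

theorem extend_mem_schwartz [T2Space B] {j : A → B} (hj : IsOpenEmbedding j) (f : schwartz A) :
    Function.extend j (f : A → ℂ) 0 ∈ schwartz B := by
  have hsup : Function.support (Function.extend j (f : A → ℂ) 0) =
      j '' Function.support (f : A → ℂ) := by
    ext b
    constructor
    · intro hb
      by_cases h : ∃ a, j a = b
      · obtain ⟨a, rfl⟩ := h
        refine ⟨a, ?_, rfl⟩
        rwa [Function.mem_support, hj.injective.extend_apply] at hb
      · exact absurd (Function.extend_apply' _ _ _ h) hb
    · rintro ⟨a, ha, rfl⟩
      rwa [Function.mem_support, hj.injective.extend_apply]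
  have hK : IsCompact (j '' Function.support (f : A → ℂ)) :=
    (isCompact_support_schwartz f).image hj.continuous
  refine ⟨?_, HasCompactSupport.of_support_subset_isCompact hK hsup.le⟩
  rw [IsLocallyConstant.iff_eventually_eq]
  intro b
  by_cases hb : b ∈ j '' Function.support (f : A → ℂ)
  · obtain ⟨a, ha, rfl⟩ := hb
    have h1 := hj.isOpenMap.image_mem_nhds ((IsLocallyConstant.iff_eventually_eq _).1 f.2.1 a)
    filter_upwards [h1]
    rintro _ ⟨a', ha', rfl⟩
    rw [hj.injective.extend_apply, hj.injective.extend_apply]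
    exact ha'
  · have h0 : ∀ c ∉ j '' Function.support (f : A → ℂ), Function.extend j (f : A → ℂ) 0 c = 0 :=
      fun c hc => by
        rw [← hsup] at hc
        exact Function.notMem_support.1 hc
    filter_upwards [hK.isClosed.isOpen_compl.mem_nhds hb] with c hc
    rw [h0 c hc, h0 b hb]

theorem HasValueAt.unique [MeasurableSpace A] {m : Measure A} {T : schwartz A → ℂ} {a : A}
    (hm : ∀ U ∈ 𝓝 a, ∃ f : schwartz A, Function.support (f : A → ℂ) ⊆ U ∧ ∫ z, (f : A → ℂ) z ∂m ≠ 0)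
    {c c' : ℂ} (h : HasValueAt m T a c) (h' : HasValueAt m T a c') : c = c' := by
  obtain ⟨U, hU, hT⟩ := h
  obtain ⟨U', hU', hT'⟩ := h'
  obtain ⟨f, hf, h0⟩ := hm _ (Filter.inter_mem hU hU')
  refine mul_right_cancel₀ h0 ?_
  rw [← hT f (hf.trans Set.inter_subset_left), ← hT' f (hf.trans Set.inter_subset_right)]

theorem HasValueAt.valueAt_eq [MeasurableSpace A] {m : Measure A} {T : schwartz A → ℂ} {a : A}
    (hm : ∀ U ∈ 𝓝 a, ∃ f : schwartz A, Function.support (f : A → ℂ) ⊆ U ∧ ∫ z, (f : A → ℂ) z ∂m ≠ 0)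
    {c : ℂ} (h : HasValueAt m T a c) : valueAt m T a = c := by
  have hex : ∃ c, HasValueAt m T a c := ⟨c, h⟩
  rw [valueAt, dif_pos hex]
  exact hex.choose_spec.unique hm h

theorem integral_ind_ne_zero [T2Space A] [MeasurableSpace A] [BorelSpace A]
    (m : Measure A) [m.IsOpenPosMeasure] [IsFiniteMeasureOnCompacts m] {a : A}
    {K : Set A} (hK : IsCompact K) (hK' : IsOpen K) (ha : a ∈ K) :
    ∫ z, (ind K : A → ℂ) z ∂m ≠ 0 := by
  have h1 : ∫ z, (ind K : A → ℂ) z ∂m = m.real K := by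
    rw [coe_ind hK' hK]
    exact (integral_indicator_const (1 : ℂ) hK'.measurableSet).trans (by simp)
  rw [h1]
  exact Complex.ofReal_ne_zero.2
    (ENNReal.toReal_pos (hK'.measure_pos m ⟨a, ha⟩).ne' hK.measure_lt_top.ne).ne'

end Embedding

/-! ### Comparison of Haar measures on G and on the Lie algebra. -/

section Transfer

variable {F : Type*} [Field F] [ValuativeRel F] [TopologicalSpace F] [IsNonarchimedeanLocalField F]

theorem mem_gPlus_zero {X : g F} : X ∈ gPlus F 0 ↔ X.trace ∈ pw F 1 ∧ X.det ∈ pw F 1 := by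
  rw [mem_gPlus_iff]; simp

theorem coe_onePlus_of_mem {X : g F} (hX : X ∈ gPlus F 0) : (onePlus X : g F) = 1 + X :=
  coe_onePlus (mem_gPlus_zero.1 hX).1 (mem_gPlus_zero.1 hX).2

theorem Ad_mem_gPlus_iff (k : G F) {X : g F} {r : ℝ} : Ad k X ∈ gPlus F r ↔ X ∈ gPlus F r := by
  simp only [mem_gPlus_iff, trace_Ad, det_Ad]

variable (F) in
theorem isClopen_gPlus_zero : IsClopen (gPlus F 0) := by
  have h : gPlus F 0 = (fun X : g F => X.trace) ⁻¹' (pw F 1) ∩ (fun X : g F => X.det) ⁻¹' (pw F 1) := by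
    ext X; exact mem_gPlus_zero
  have h1 : Continuous fun X : g F => X.trace := continuous_id.matrix_trace
  have h2 : Continuous fun X : g F => X.det := continuous_id.matrix_det
  rw [h]
  exact ⟨((isClosed_pw 1).preimage h1).inter ((isClosed_pw 1).preimage h2),
    ((isOpen_pw 1).preimage h1).inter ((isOpen_pw 1).preimage h2)⟩

variable (F) in
theorem isOpenEmbedding_sub_one : IsOpenEmbedding (fun γ : G F => (γ : g F) - 1) :=
  (Homeomorph.subRight (1 : g F)).isOpenEmbedding.comp (isOpenEmbedding_coe F)

/-- Restriction of a Schwartz function to the topologically nilpotent set. -/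
noncomputable def restrTopNil : schwartz (g F) →ₗ[ℂ] schwartz (g F) where
  toFun h := ⟨(gPlus F 0).indicator (h : g F → ℂ), by
    classical
    refine ⟨?_, h.2.2.mono fun X hX => ?_⟩
    · rw [IsLocallyConstant.iff_eventually_eq]
      intro X
      by_cases hX : X ∈ gPlus F 0
      · filter_upwards [(isClopen_gPlus_zero F).isOpen.mem_nhds hX,
          (IsLocallyConstant.iff_eventually_eq _).1 h.2.1 X] with Y hY hYX
        rw [Set.indicator_of_mem hX, Set.indicator_of_mem hY, hYX]
      · filter_upwards [(isClopen_gPlus_zero F).isClosed.isOpen_compl.mem_nhds hX] with Y hY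
        rw [Set.indicator_of_notMem hX, Set.indicator_of_notMem hY]
    · exact fun h0 => hX (by simp [h0])⟩
  map_add' h h' := by ext X; exact congrFun (Set.indicator_add _ _ _) X
  map_smul' c h := by ext X; exact congrFun (Set.indicator_const_smul _ c _) X

/-- The function `γ ↦ h (γ - 1)` on the topologically unipotent set, extended by zero. -/
noncomputable def toG : schwartz (g F) →ₗ[ℂ] schwartz (G F) where
  toFun h := ⟨_, comp_mem_schwartz (isOpenEmbedding_sub_one F) (restrTopNil h) (by
    intro X hX
    have hX' : X ∈ gPlus F 0 := by
      by_contra hn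
      exact hX (Set.indicator_of_notMem hn _)
    exact ⟨onePlus X, by simp only [coe_onePlus_of_mem hX', add_sub_cancel_left]⟩)⟩
  map_add' h h' := by ext γ; simp only [map_add]; rfl
  map_smul' c h := by ext γ; simp only [map_smul]; rfl

theorem toG_apply (h : schwartz (g F)) (γ : G F) :
    (toG h : G F → ℂ) γ = (gPlus F 0).indicator (h : g F → ℂ) ((γ : g F) - 1) := rfl

theorem coe_conj_sub_one (k γ : G F) : ((k * γ * k⁻¹ : G F) : g F) - 1 = Ad k ((γ : g F) - 1) := by
  rw [Ad_sub, Units.val_mul, Units.val_mul]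
  congr 1
  rw [Ad, mul_one, ← Units.val_mul, mul_inv_cancel, Units.val_one]

theorem toG_conj (x : G F) {h h' : schwartz (g F)} (hh : ∀ X, (h' : g F → ℂ) X = (h : g F → ℂ) (Ad x X))
    (γ : G F) : (toG h' : G F → ℂ) γ = (toG h : G F → ℂ) (x * γ * x⁻¹) := by
  classical
  rw [toG_apply, toG_apply, coe_conj_sub_one, Set.indicator_apply, Set.indicator_apply, Ad_mem_gPlus_iff, hh]

theorem exists_toG_eq (f : schwartz (G F))
    (hf : ∀ γ, (f : G F → ℂ) γ ≠ 0 → (γ : g F) - 1 ∈ gPlus F 0) :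
    ∃ h : schwartz (g F), toG h = f ∧ ∀ X, (h : g F → ℂ) X ≠ 0 → ∃ γ : G F, (γ : g F) - 1 = X ∧
      (f : G F → ℂ) γ ≠ 0 := by
  have hj := isOpenEmbedding_sub_one F
  refine ⟨⟨_, extend_mem_schwartz hj f⟩, ?_, fun X hX => ?_⟩
  · ext γ
    rw [toG_apply]
    have h1 := hj.injective.extend_apply (f : G F → ℂ) 0 γ
    by_cases hγ : (γ : g F) - 1 ∈ gPlus F 0
    · rw [Set.indicator_of_mem hγ]; exact h1
    · rw [Set.indicator_of_notMem hγ]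
      by_contra h0
      exact hγ (hf γ (Ne.symm h0))
  · by_cases h : ∃ γ : G F, (γ : g F) - 1 = X
    · obtain ⟨γ, rfl⟩ := h
      refine ⟨γ, rfl, ?_⟩
      have h1 := hj.injective.extend_apply (f : G F → ℂ) 0 γ
      rw [← h1]; exact hX
    · exact absurd (Function.extend_apply' _ _ _ h) hX

/-- The companion form is integral because trace and determinant lie in P. This reduces local
questions on g_{0+} to integral matrices. -/
theorem exists_Ad_mem_ball {X : g F} (hX : X ∈ gPlus F 0) : ∃ k : G F, Ad k X ∈ box F 0 0 0 := by
  obtain ⟨ht, hd⟩ := mem_gPlus_zero.1 hX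
  by_cases h : X 1 0 ≠ 0 ∨ X 0 1 ≠ 0 ∨ X 0 0 ≠ X 1 1
  · obtain ⟨k, hk⟩ := exists_companion X h
    refine ⟨k⁻¹, ?_⟩
    rw [hk]
    exact ⟨by simp, by simpa using one_mem_pw, by simpa using pw_anti (by omega) hd,
      by simpa using pw_anti (by omega) ht⟩
  · push Not at h
    obtain ⟨h10, h01, h00⟩ := h
    have h1 : X 0 0 ∈ pw F 1 := by
      by_contra hn
      rw [Matrix.det_fin_two, h10, h01, ← h00] at hd
      refine hn (mem_pw_of_mul_mem (m := 0) (n := 1) (a := X 0 0) ?_ (by simpa using hn))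
      simpa using hd
    refine ⟨1, ?_⟩
    rw [Ad_one]
    refine ⟨pw_anti (by omega) h1, by simp [h01], by simp [h10], ?_⟩
    rw [← h00]
    exact pw_anti (by omega) h1

theorem add_ball_mem_gPlus_zero {X Z : g F} (hX : X ∈ gPlus F 0) (hX' : X ∈ box F 0 0 0)
    (hZ : Z ∈ box F 1 1 1) : X + Z ∈ gPlus F 0 := by
  rw [mem_gPlus_zero] at hX ⊢
  refine ⟨?_, ?_⟩
  · rw [Matrix.trace_add]; exact add_mem hX.1 (trace_mem_pw hZ)
  · have : (X + Z).det = X.det + Z.det +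
        (X 0 0 * Z 1 1 + Z 0 0 * X 1 1 - (X 0 1 * Z 1 0 + Z 0 1 * X 1 0)) := by
      simp only [Matrix.det_fin_two, Matrix.add_apply]; ring
    rw [this]
    refine add_mem (add_mem hX.2 (pw_anti (by omega) (det_mem_pw_of_mem_ball hZ))) ?_
    exact sub_mem (add_mem (mul_mem_pw' hX'.1 hZ.2.2.2) (mul_mem_pw' hZ.1 hX'.2.2.2))
      (add_mem (mul_mem_pw' hX'.2.1 hZ.2.2.1) (mul_mem_pw' hZ.2.1 hX'.2.2.1))

theorem schwartz_comp_Ad (x : G F) (h : schwartz (g F)) :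
    (fun X => (h : g F → ℂ) (Ad x X)) ∈ schwartz (g F) := by
  have := comp_mem_schwartz (AdCont x).toHomeomorph.isOpenEmbedding h (fun X _ => ⟨Ad x⁻¹ X, Ad_Ad_inv x X⟩)
  exact this

variable [MeasurableSpace (g F)] [BorelSpace (g F)] [MeasurableSpace (G F)] [BorelSpace (G F)]
  (dY : Measure (g F)) [dY.IsAddHaarMeasure] (dγ : Measure (G F)) [dγ.IsHaarMeasure]

/-- Since 1 + c lies in GL(2, O), left translation by it carries the nth congruence neighbourhood of
1 onto the coset of 1 + c; the volume therefore does not depend on c. -/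
theorem integral_toG_cosetInd {n : ℤ} (hn : 1 ≤ n) {c : g F} (hc : c ∈ gPlus F 0)
    (hc' : c ∈ box F 0 0 0) : ∫ γ, (toG (cosetInd c (box F n n n)) : G F → ℂ) γ ∂dγ =
      dγ.real {γ : G F | (γ : g F) - 1 ∈ box F n n n} := by
  set k := onePlus c with hk
  have hkc : (k : g F) = 1 + c := coe_onePlus_of_mem hc
  have hdet := det_one_add (mem_gPlus_zero.1 hc).1 (mem_gPlus_zero.1 hc).2
  have hk0 : (k : g F) ∈ box F 0 0 0 := by rw [hkc]; exact add_mem one_mem_ball hc'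
  have hk1 : ((k⁻¹ : G F) : g F) ∈ box F 0 0 0 := inv_mem_ball hk0 (by rw [hkc]; exact hdet.2)
  rw [← integral_mul_left_eq_self _ k]
  have h1 : ∀ γ : G F, (toG (cosetInd c (box F n n n)) : G F → ℂ) (k * γ) =
      {γ : G F | (γ : g F) - 1 ∈ box F n n n}.indicator 1 γ := by
    intro γ
    classical
    have e : ((k * γ : G F) : g F) - 1 - c = (k : g F) * ((γ : g F) - 1) := by
      rw [Units.val_mul, mul_sub, mul_one, hkc]; abel
    have e' : (γ : g F) - 1 = ((k⁻¹ : G F) : g F) * (((k * γ : G F) : g F) - 1 - c) := by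
      rw [e, Units.inv_mul_cancel_left]
    have hiff : ((k * γ : G F) : g F) - 1 - c ∈ box F n n n ↔ (γ : g F) - 1 ∈ box F n n n := by
      constructor
      · intro h
        rw [e']
        have := mul_mem_ball hk1 h
        rwa [zero_add] at this
      · intro h
        rw [e]
        have := mul_mem_ball hk0 h
        rwa [zero_add] at this
    rw [toG_apply, Set.indicator_apply, Set.indicator_apply, cosetInd_apply (isLat_box n n n)]
    simp only [hiff, Set.mem_ofPred_eq]
    by_cases h : (γ : g F) - 1 ∈ box F n n n
    · have h2 : ((k * γ : G F) : g F) - 1 ∈ gPlus F 0 := by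
        have := add_ball_mem_gPlus_zero hc hc' (box_mono hn hn hn (hiff.2 h))
        rwa [add_sub_cancel] at this
      rw [if_pos h, if_pos h, if_pos h2]; rfl
    · rw [if_neg h, if_neg h, ite_self]
  simp_rw [h1]
  refine (integral_indicator_const (1 : ℂ) ?_).trans (by simp)
  exact (((isOpen_box n n n).preimage (isOpenEmbedding_sub_one F).continuous)).measurableSet

theorem integral_toG_of_transInv {n : ℤ} (hn : 1 ≤ n) {h : schwartz (g F)}
    (hh : h ∈ transInv (box F n n n : Set (g F)))
    (hs : ∀ X, (h : g F → ℂ) X ≠ 0 → X ∈ gPlus F 0 ∧ X ∈ box F 0 0 0) :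
    ∫ γ, (toG h : G F → ℂ) γ ∂dγ =
      dγ.real {γ : G F | (γ : g F) - 1 ∈ box F n n n} / dY.real (box F n n n : Set (g F)) *
        ∫ X, (h : g F → ℂ) X ∂dY := by
  have hY : (dY.real (box F n n n : Set (g F)) : ℂ) ≠ 0 :=
    Complex.ofReal_ne_zero.2 (measureReal_pos_of_isLat dY (isLat_box n n n)).ne'
  obtain ⟨R, hR0, hR⟩ := exists_sum_cosetInd (isLat_box n n n) hh
  have key (a : g F → ℂ) : ∫ γ, (toG (∑ c ∈ R, a c • cosetInd c (box F n n n)) : G F → ℂ) γ ∂dγ =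
      dγ.real {γ : G F | (γ : g F) - 1 ∈ box F n n n} / dY.real (box F n n n : Set (g F)) *
        ∫ X, (∑ c ∈ R, a c • cosetInd c (box F n n n) : schwartz (g F)).1 X ∂dY := by
    simp only [map_sum, map_smul, Submodule.coe_sum, Submodule.coe_smul, Finset.sum_apply,
      Pi.smul_apply]
    rw [integral_finsetSum, integral_finsetSum, Finset.mul_sum]
    · refine Finset.sum_congr rfl fun c hc => ?_
      rw [integral_smul, integral_smul, integral_cosetInd dY (isLat_box n n n),
        integral_toG_cosetInd dγ hn (hs c (hR0 c hc)).1 (hs c (hR0 c hc)).2]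
      have : dY.real {Y | Y - c ∈ box F n n n} = dY.real (box F n n n : Set (g F)) := by
        rw [measureReal_def, measureReal_def]
        simp_rw [sub_eq_add_neg]
        exact congrArg _ (measure_preimage_add_right dY (-c) (box F n n n : Set (g F)))
      rw [this, smul_eq_mul, smul_eq_mul]
      field_simp
    · exact fun c _ => (integrable_schwartz dY (fun K hK => hK.measure_lt_top) _).const_mul _
    · exact fun c _ => (integrable_schwartz dγ (fun K hK => hK.measure_lt_top) _).const_mul _
  have := key (h : g F → ℂ)
  rwa [← hR] at this

/-- The ratio between the two Haar measures near the identity. -/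
noncomputable def haarRatio : ℝ :=
  dγ.real {γ : G F | (γ : g F) - 1 ∈ box F 1 1 1} / dY.real (box F 1 1 1 : Set (g F))

theorem haarRatio_pos : 0 < haarRatio dY dγ := by
  have ho : IsOpen {γ : G F | (γ : g F) - 1 ∈ box F 1 1 1} :=
    (isOpen_box 1 1 1).preimage (isOpenEmbedding_sub_one F).continuous
  refine div_pos (ENNReal.toReal_pos (ho.measure_pos dγ ⟨1, by simp⟩).ne' ?_)
    (measureReal_pos_of_isLat dY (isLat_box 1 1 1))
  refine (IsCompact.measure_lt_top ?_).ne
  refine (isOpenEmbedding_sub_one F).isInducing.isCompact_preimage' (isCompact_box 1 1 1) fun X hX => ?_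
  exact ⟨onePlus X, by simp only [coe_onePlus_of_mem_ball hX, add_sub_cancel_left]⟩

theorem integral_toG_of_support {h : schwartz (g F)}
    (hs : ∀ X, (h : g F → ℂ) X ≠ 0 → X ∈ gPlus F 0 ∧ X ∈ box F 0 0 0) :
    ∫ γ, (toG h : G F → ℂ) γ ∂dγ = haarRatio dY dγ * ∫ X, (h : g F → ℂ) X ∂dY := by
  obtain ⟨m, hm⟩ := exists_mem_transInv_ball h
  set n := max m 1
  have hh : h ∈ transInv (box F n n n : Set (g F)) := fun X Y hY =>
    hm X Y (box_mono (le_max_left _ _) (le_max_left _ _) (le_max_left _ _) hY)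
  have hn : 1 ≤ n := le_max_right _ _
  rw [integral_toG_of_transInv dY dγ hn hh hs]
  congr 1
  have hs0 : ∀ X, (cosetInd 0 (box F 1 1 1) : g F → ℂ) X ≠ 0 → X ∈ gPlus F 0 ∧ X ∈ box F 0 0 0 := by
    intro X hX
    rw [cosetInd_apply_ne_zero (isLat_box 1 1 1), sub_zero] at hX
    refine ⟨?_, box_mono (by omega) (by omega) (by omega) hX⟩
    have := add_ball_mem_gPlus_zero (X := 0) (by rw [mem_gPlus_zero]; simp) (zero_mem _) hX
    rwa [zero_add] at this
  -- The ratio at level n equals the one at level 1, since both integrate the indicator of the ball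
  -- of exponent 1.
  have h1 := integral_toG_of_transInv dY dγ le_rfl (cosetInd_mem_transInv (isLat_box 1 1 1) 0) hs0
  have h2 := integral_toG_of_transInv dY dγ hn (h := cosetInd 0 (box F 1 1 1))
    (fun X Y hY => cosetInd_mem_transInv (isLat_box 1 1 1) 0 X Y (box_mono hn hn hn hY)) hs0
  rw [h1] at h2
  have h0 : ∫ X, (cosetInd 0 (box F 1 1 1) : g F → ℂ) X ∂dY ≠ 0 := by
    rw [integral_cosetInd dY (isLat_box 1 1 1)]
    simpa using (measureReal_pos_of_isLat dY (isLat_box (F := F) 1 1 1)).ne'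
  have h3 := mul_right_cancel₀ h0 h2
  rw [haarRatio, ← h3]
  push_cast
  rfl

/-- A conjugation moves X to an integral matrix; both Haar measures are invariant under it. -/
theorem exists_integral_toG {X : g F} (hX : X ∈ gPlus F 0) : ∃ U ∈ 𝓝 X, U ⊆ gPlus F 0 ∧
    ∀ h : schwartz (g F), Function.support (h : g F → ℂ) ⊆ U →
      ∫ γ, (toG h : G F → ℂ) γ ∂dγ = haarRatio dY dγ * ∫ X, (h : g F → ℂ) X ∂dY := by
  obtain ⟨k, hk⟩ := exists_Ad_mem_ball hX
  refine ⟨Ad k ⁻¹' {Y | Y - Ad k X ∈ box F 1 1 1}, ?_, fun Y hY => ?_, fun h hh => ?_⟩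
  · refine (continuous_Ad k).continuousAt.preimage_mem_nhds ?_
    exact (isOpen_coset (isLat_box 1 1 1) _).mem_nhds (by simp)
  · have := add_ball_mem_gPlus_zero ((Ad_mem_gPlus_iff k).2 hX) hk hY
    rwa [add_sub_cancel, Ad_mem_gPlus_iff] at this
  · set h' : schwartz (g F) := ⟨_, schwartz_comp_Ad k⁻¹ h⟩ with hh'
    have e1 : ∫ γ, (toG h' : G F → ℂ) γ ∂dγ = ∫ γ, (toG h : G F → ℂ) γ ∂dγ := by
      rw [← integral_conj dγ k⁻¹ (toG h)]
      exact integral_congr_ae (Filter.Eventually.of_forall fun γ => toG_conj k⁻¹ (fun _ => rfl) γ)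
    have e2 : ∫ X, (h' : g F → ℂ) X ∂dY = ∫ X, (h : g F → ℂ) X ∂dY := by
      nth_rw 2 [← map_Ad_addHaar dY k⁻¹]
      rw [(measurableEmbedding_Ad k⁻¹).integral_map]
    rw [← e1, ← e2]
    refine integral_toG_of_support dY dγ fun Y hY => ?_
    have h1 := hh (show Ad k⁻¹ Y ∈ Function.support (h : g F → ℂ) from hY)
    rw [Set.mem_preimage, Ad_Ad_inv] at h1
    constructor
    · have := add_ball_mem_gPlus_zero ((Ad_mem_gPlus_iff k).2 hX) hk h1
      rwa [add_sub_cancel] at this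
    · have h2 : Y - Ad k X ∈ box F 0 0 0 := box_mono (by omega) (by omega) (by omega) h1
      have := add_mem h2 hk
      rwa [sub_add_cancel] at this

end Transfer

end GLTwo

namespace GLTwo

/-! ### Traces of operators of finite rank. -/

section Trace

variable {V : Type*} [AddCommGroup V] [Module ℂ V]

/-- By tr(AB) = tr(BA) the trace can be computed on any finite-dimensional space that contains the
range, so several operators can share one space. -/
theorem finiteRankTrace_eq {A : V →ₗ[ℂ] V} {W : Submodule ℂ V} [FiniteDimensional ℂ W]
    (h : LinearMap.range A ≤ W) :
    finiteRankTrace A = LinearMap.trace ℂ W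
      ((A.codRestrict W fun v => h ⟨v, rfl⟩) ∘ₗ W.subtype) := by
  have : FiniteDimensional ℂ (LinearMap.range A) := Submodule.finiteDimensional_of_le h
  have e : (A.codRestrict W fun v => h ⟨v, rfl⟩) ∘ₗ W.subtype =
      Submodule.inclusion h ∘ₗ (A.rangeRestrict ∘ₗ W.subtype) := by
    ext v; rfl
  rw [e, LinearMap.trace_comp_comm']
  rfl

theorem finiteRankTrace_add {A B : V →ₗ[ℂ] V} {W : Submodule ℂ V} [FiniteDimensional ℂ W]
    (hA : LinearMap.range A ≤ W) (hB : LinearMap.range B ≤ W) :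
    finiteRankTrace (A + B) = finiteRankTrace A + finiteRankTrace B := by
  have hAB : LinearMap.range (A + B) ≤ W := by
    rintro _ ⟨v, rfl⟩
    exact add_mem (hA ⟨v, rfl⟩) (hB ⟨v, rfl⟩)
  rw [finiteRankTrace_eq hA, finiteRankTrace_eq hB, finiteRankTrace_eq hAB, ← map_add]
  rfl

theorem finiteRankTrace_smul {A : V →ₗ[ℂ] V} {W : Submodule ℂ V} [FiniteDimensional ℂ W]
    (hA : LinearMap.range A ≤ W) (c : ℂ) :
    finiteRankTrace (c • A) = c * finiteRankTrace A := by
  have hcA : LinearMap.range (c • A) ≤ W := by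
    rintro _ ⟨v, rfl⟩
    exact Submodule.smul_mem _ c (hA ⟨v, rfl⟩)
  rw [finiteRankTrace_eq hA, finiteRankTrace_eq hcA, ← smul_eq_mul, ← map_smul]
  rfl

theorem finiteRankTrace_zero : finiteRankTrace (0 : V →ₗ[ℂ] V) = 0 := by
  rw [finiteRankTrace_eq (W := ⊥) (by simp)]
  convert! map_zero (LinearMap.trace ℂ (⊥ : Submodule ℂ V))

theorem finiteRankTrace_conj {A P Q : V →ₗ[ℂ] V} [FiniteDimensional ℂ (LinearMap.range A)]
    (hQP : Q ∘ₗ P = LinearMap.id) :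
    finiteRankTrace (P ∘ₗ A ∘ₗ Q) = finiteRankTrace A := by
  set W := LinearMap.range A
  have hle : LinearMap.range (P ∘ₗ A ∘ₗ Q) ≤ W.map P := by
    rintro _ ⟨v, rfl⟩
    exact ⟨A (Q v), ⟨_, rfl⟩, rfl⟩
  rw [finiteRankTrace_eq hle]
  let i : W →ₗ[ℂ] W.map P := (P ∘ₗ W.subtype).codRestrict _ fun w => ⟨w, w.2, rfl⟩
  let j : W.map P →ₗ[ℂ] W := A.rangeRestrict ∘ₗ Q ∘ₗ (W.map P).subtype
  have e : ((P ∘ₗ A ∘ₗ Q).codRestrict (W.map P) fun v => hle ⟨v, rfl⟩) ∘ₗ (W.map P).subtype =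
      i ∘ₗ j := by
    ext v; rfl
  rw [e, LinearMap.trace_comp_comm']
  have e' : j ∘ₗ i = A.rangeRestrict ∘ₗ W.subtype := by
    ext v
    change A (Q (P v)) = A v
    rw [← LinearMap.comp_apply Q P, hQP, LinearMap.id_apply]
  rw [e']
  rfl

end Trace

/-! ### Congruence subgroups. -/

section Congruence

variable {F : Type*} [Field F] [ValuativeRel F] [TopologicalSpace F] [IsNonarchimedeanLocalField F]

variable (F) in
/-- The principal congruence subgroups of `GL(2,O)` (all of `GL(2,O)` for `n = 0`). -/
def congSub (n : ℕ) : Subgroup (G F) where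
  carrier := {γ | (γ : g F) - 1 ∈ box F n n n ∧ ((γ⁻¹ : G F) : g F) - 1 ∈ box F n n n}
  one_mem' := by simp
  mul_mem' := by
    have key : ∀ X Y : g F, X - 1 ∈ box F n n n → Y - 1 ∈ box F n n n → X * Y - 1 ∈ box F n n n := by
      intro X Y hX hY
      have e : X * Y - 1 = (X - 1) * (Y - 1) + (X - 1) + (Y - 1) := by noncomm_ring
      rw [e]
      exact add_mem (add_mem (box_mono (by omega) (by omega) (by omega) (mul_mem_ball hX hY)) hX) hY
    intro a b ha hb
    refine ⟨?_, ?_⟩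
    · rw [Units.val_mul]; exact key _ _ ha.1 hb.1
    · rw [mul_inv_rev, Units.val_mul]; exact key _ _ hb.2 ha.2
  inv_mem' := fun {a} ha => ⟨ha.2, by rw [inv_inv]; exact ha.1⟩

theorem mem_congSub {n : ℕ} {γ : G F} : γ ∈ congSub F n ↔
    (γ : g F) - 1 ∈ box F n n n ∧ ((γ⁻¹ : G F) : g F) - 1 ∈ box F n n n := Iff.rfl

theorem mem_congSub_zero {γ : G F} : γ ∈ congSub F 0 ↔
    (γ : g F) ∈ box F 0 0 0 ∧ ((γ⁻¹ : G F) : g F) ∈ box F 0 0 0 := by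
  rw [mem_congSub, Nat.cast_zero]
  have key : ∀ X : g F, X - 1 ∈ box F 0 0 0 ↔ X ∈ box F 0 0 0 := fun X =>
    ⟨fun h => by simpa using add_mem h one_mem_ball, fun h => sub_mem h one_mem_ball⟩
  exact and_congr (key _) (key _)

theorem isOpen_congSub (n : ℕ) : IsOpen (congSub F n : Set (G F)) :=
  ((isOpen_box _ _ _).preimage (isOpenEmbedding_sub_one F).continuous).inter
    ((isOpen_box _ _ _).preimage ((isOpenEmbedding_sub_one F).continuous.comp continuous_inv))

theorem isCompact_congSub (n : ℕ) : IsCompact (congSub F n : Set (G F)) := by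
  have h0 : IsCompact (congSub F 0 : Set (G F)) := by
    have : (congSub F 0 : Set (G F)) = (fun γ : G F => (γ : g F)) ⁻¹'
        ((box F 0 0 0 : Set (g F)) ∩ {X | X.det ∈ (pw F 1 : Set F)ᶜ}) := by
      ext γ
      rw [SetLike.mem_coe, mem_congSub_zero]
      constructor
      · intro h
        refine ⟨h.1, fun hd => ?_⟩
        have h1 := mul_mem_pw (SetLike.mem_coe.1 hd) (det_mem_pw_of_mem_ball h.2)
        rw [← Matrix.det_mul, ← Units.val_mul, mul_inv_cancel, Units.val_one, Matrix.det_one] at h1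
        have := unif_zpow_mul_mem.1 (show unif F ^ (0 : ℤ) * 1 ∈ pw F (1 + (0 + 0)) by simpa using h1)
        rw [mem_pw, nabs_one] at this
        have h2 := zpow_lt_one_of_neg₀ (one_lt_q F) (show -(1 + (0 + 0) - 0 : ℤ) < 0 by norm_num)
        exact absurd this (not_le.2 h2)
      · intro h
        exact ⟨h.1, inv_mem_ball h.1 h.2⟩
    rw [this]
    refine (isOpenEmbedding_coe F).isInducing.isCompact_preimage' ?_ fun X hX => ?_
    · refine (isCompact_box 0 0 0).inter_right ?_
      exact (isOpen_pw 1).isClosed_compl.preimage (continuous_id.matrix_det)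
    · have hd : X.det ≠ 0 := fun h => hX.2 (by rw [h]; exact zero_mem (pw F 1))
      exact ⟨Matrix.GeneralLinearGroup.mkOfDetNeZero X hd, rfl⟩
  refine h0.of_isClosed_subset ((congSub F n).isClosed_of_isOpen (isOpen_congSub n)) fun γ hγ => ?_
  exact ⟨box_mono (by omega) (by omega) (by omega) hγ.1, box_mono (by omega) (by omega) (by omega) hγ.2⟩

theorem congSub_anti {m n : ℕ} (h : m ≤ n) : congSub F n ≤ congSub F m := fun _ hγ =>
  ⟨box_mono (by omega) (by omega) (by omega) hγ.1, box_mono (by omega) (by omega) (by omega) hγ.2⟩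

theorem exists_congSub_subset {U : Set (G F)} (hU : U ∈ 𝓝 (1 : G F)) :
    ∃ n : ℕ, (congSub F n : Set (G F)) ⊆ U := by
  rw [(isOpenEmbedding_sub_one F).isInducing.nhds_eq_comap, Filter.mem_comap] at hU
  obtain ⟨S, hS, hSU⟩ := hU
  rw [mem_nhds_iff_ball] at hS
  obtain ⟨n, hn⟩ := hS
  refine ⟨n.toNat, fun γ hγ => hSU ?_⟩
  have := hn _ (box_mono (by omega) (by omega) (by omega) hγ.1)
  simpa using this

theorem congSub_conj {n : ℕ} {k γ : G F} (hk : k ∈ congSub F 0) (hγ : γ ∈ congSub F n) :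
    k * γ * k⁻¹ ∈ congSub F n := by
  rw [mem_congSub_zero] at hk
  have key : ∀ γ : G F, (γ : g F) - 1 ∈ box F n n n → ((k * γ * k⁻¹ : G F) : g F) - 1 ∈ box F n n n := by
    intro γ hγ
    rw [coe_conj_sub_one]
    exact (Ad_mem_ball_iff hk.1 hk.2 n _).2 hγ
  refine ⟨key γ hγ.1, ?_⟩
  rw [show (k * γ * k⁻¹)⁻¹ = k * γ⁻¹ * k⁻¹ by group]
  exact key _ hγ.2

theorem exists_left_invariant (f : schwartz (G F)) : ∃ n : ℕ, ∀ k ∈ congSub F n, ∀ γ,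
    (f : G F → ℂ) (k * γ) = (f : G F → ℂ) γ := by
  have h1 : ∀ γ : G F, ∃ n : ℕ, ∀ k ∈ congSub F n, (f : G F → ℂ) (k * γ) = (f : G F → ℂ) γ := by
    intro γ
    have h2 := (IsLocallyConstant.iff_eventually_eq _).1 f.2.1 γ
    have h3 : Filter.Tendsto (fun k : G F => k * γ) (𝓝 1) (𝓝 γ) := by
      have := (continuous_mul_const γ).tendsto (1 : G F)
      rwa [one_mul] at this
    obtain ⟨n, hn⟩ := exists_congSub_subset (h3.eventually h2)
    exact ⟨n, fun k hk => hn hk⟩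
  choose n hn using h1
  obtain ⟨t, ht⟩ := (isCompact_support_schwartz f).elim_finite_subcover
    (fun γ : G F => (fun x : G F => x * γ⁻¹) ⁻¹' (congSub F (n γ) : Set (G F)))
    (fun γ => (isOpen_congSub _).preimage (continuous_mul_const _))
    (fun γ _ => Set.mem_iUnion.2 ⟨γ, by simp⟩)
  have key : ∀ k ∈ congSub F (t.sup n), ∀ γ, (f : G F → ℂ) γ ≠ 0 →
      (f : G F → ℂ) (k * γ) = (f : G F → ℂ) γ := by
    intro k hk γ hγ
    obtain ⟨γ', hγ't, hγ'⟩ := Set.mem_iUnion₂.1 (ht hγ)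
    have h2 : γ = (γ * γ'⁻¹) * γ' := by group
    have hk' : k ∈ congSub F (n γ') := congSub_anti (Finset.le_sup hγ't) hk
    rw [h2, hn γ' _ hγ', ← mul_assoc, hn γ' _ (mul_mem hk' hγ')]
  refine ⟨t.sup n, fun k hk γ => ?_⟩
  by_cases h0 : (f : G F → ℂ) γ = 0
  · by_contra hne
    have h4 := key k⁻¹ (inv_mem hk) (k * γ) (by rw [← h0]; exact hne)
    rw [inv_mul_cancel_left] at h4
    exact hne h4.symm
  · exact key k hk γ h0

end Congruence

/-! ### Hecke operators and the distribution character. -/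

section Hecke

variable {F : Type*} [Field F] [ValuativeRel F] [TopologicalSpace F] [IsNonarchimedeanLocalField F]
  {V : Type*} [AddCommGroup V] [Module ℂ V] {π : Representation ℂ (G F) V}

theorem IsSmooth.isLocallyConstant (hπ : IsSmooth π) (v : V) : IsLocallyConstant fun γ : G F => π γ v := by
  rw [IsLocallyConstant.iff_eventually_eq]
  intro γ
  have h1 : Filter.Tendsto (fun y : G F => γ⁻¹ * y) (𝓝 γ) (𝓝 1) := by
    have := (continuous_const_mul (γ⁻¹ : G F)).tendsto γ
    rwa [inv_mul_cancel] at this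
  filter_upwards [h1.eventually (hπ v)] with y hy
  have h2 : π γ (π (γ⁻¹ * y) v) = π γ v := by rw [hy]
  rwa [← Module.End.mul_apply, ← map_mul, mul_inv_cancel_left] at h2

/-- The vectors fixed by every element of `S`. -/
def fixedBy (π : Representation ℂ (G F) V) (S : Set (G F)) : Submodule ℂ V where
  carrier := {v | ∀ γ ∈ S, π γ v = v}
  zero_mem' := fun _ _ => map_zero _
  add_mem' := fun ha hb γ hγ => by rw [map_add, ha γ hγ, hb γ hγ]
  smul_mem' := fun c v hv γ hγ => by rw [map_smul, hv γ hγ]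

variable [MeasurableSpace (G F)]

theorem IsHeckeOperator.unique {dγ : Measure (G F)} {f : G F → ℂ} {A B : V →ₗ[ℂ] V}
    (hA : IsHeckeOperator π dγ f A) (hB : IsHeckeOperator π dγ f B) : A = B := by
  ext v
  rw [← sub_eq_zero, ← Module.forall_dual_apply_eq_zero_iff ℂ]
  intro l
  rw [map_sub, hA v l, hB v l, sub_self]

variable [BorelSpace (G F)] (dγ : Measure (G F)) [dγ.IsHaarMeasure]

theorem isHeckeOperator_heckeOperator (hπ : IsSmooth π) (f : schwartz (G F)) :
    IsHeckeOperator π dγ (f : G F → ℂ) (heckeOperator π dγ (f : G F → ℂ)) := by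
  have h := exists_isHeckeOperator π hπ dγ f
  rw [heckeOperator, dif_pos h]
  exact h.choose_spec

theorem integrable_hecke (hπ : IsSmooth π) (f : schwartz (G F)) (v : V) (l : Module.Dual ℂ V) :
    Integrable (fun γ => (f : G F → ℂ) γ * l (π γ v)) dγ := by
  refine Continuous.integrable_of_hasCompactSupport ?_ f.2.2.mul_right
  exact (f.2.1.mul ((hπ.isLocallyConstant v).comp l)).continuous

theorem heckeOperator_add (hπ : IsSmooth π) (f f' : schwartz (G F)) :
    heckeOperator π dγ ((f + f' : schwartz (G F)) : G F → ℂ) =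
      heckeOperator π dγ (f : G F → ℂ) + heckeOperator π dγ (f' : G F → ℂ) := by
  refine (isHeckeOperator_heckeOperator dγ hπ _).unique fun v l => ?_
  rw [LinearMap.add_apply, map_add, isHeckeOperator_heckeOperator dγ hπ f v l,
    isHeckeOperator_heckeOperator dγ hπ f' v l,
    ← integral_add (integrable_hecke dγ hπ f v l) (integrable_hecke dγ hπ f' v l)]
  refine integral_congr_ae (Filter.Eventually.of_forall fun γ => ?_)
  exact (add_mul _ _ _).symm

theorem heckeOperator_smul (hπ : IsSmooth π) (c : ℂ) (f : schwartz (G F)) :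
    heckeOperator π dγ ((c • f : schwartz (G F)) : G F → ℂ) =
      c • heckeOperator π dγ (f : G F → ℂ) := by
  refine (isHeckeOperator_heckeOperator dγ hπ _).unique fun v l => ?_
  rw [LinearMap.smul_apply, map_smul, isHeckeOperator_heckeOperator dγ hπ f v l, smul_eq_mul,
    ← integral_const_mul]
  refine integral_congr_ae (Filter.Eventually.of_forall fun γ => ?_)
  exact (mul_assoc _ _ _).symm

theorem heckeOperator_left (hπ : IsSmooth π) (x : G F) {f f' : schwartz (G F)}
    (h : ∀ γ, (f' : G F → ℂ) (x * γ) = (f : G F → ℂ) γ) :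
    heckeOperator π dγ (f' : G F → ℂ) = π x ∘ₗ heckeOperator π dγ (f : G F → ℂ) := by
  refine (isHeckeOperator_heckeOperator dγ hπ f').unique fun v l => ?_
  rw [← integral_mul_left_eq_self _ x]
  have := isHeckeOperator_heckeOperator dγ hπ f v (l ∘ₗ π x)
  rw [LinearMap.comp_apply] at this
  rw [LinearMap.comp_apply, this]
  refine integral_congr_ae (Filter.Eventually.of_forall fun γ => ?_)
  simp only [h, LinearMap.comp_apply, map_mul, Module.End.mul_apply]

theorem heckeOperator_right (hπ : IsSmooth π) (x : G F) {f f' : schwartz (G F)}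
    (h : ∀ γ, (f' : G F → ℂ) (γ * x) = (f : G F → ℂ) γ) :
    heckeOperator π dγ (f' : G F → ℂ) = heckeOperator π dγ (f : G F → ℂ) ∘ₗ π x := by
  have := isMulRightInvariant_haar dγ
  refine (isHeckeOperator_heckeOperator dγ hπ f').unique fun v l => ?_
  rw [← integral_mul_right_eq_self _ x, LinearMap.comp_apply, isHeckeOperator_heckeOperator dγ hπ f]
  refine integral_congr_ae (Filter.Eventually.of_forall fun γ => ?_)
  simp only [h, map_mul, Module.End.mul_apply]

theorem range_heckeOperator_le (hπ : IsSmooth π) {n : ℕ} {f : schwartz (G F)}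
    (hf : ∀ k ∈ congSub F n, ∀ γ, (f : G F → ℂ) (k * γ) = (f : G F → ℂ) γ) :
    LinearMap.range (heckeOperator π dγ (f : G F → ℂ)) ≤ fixedBy π (congSub F n : Set (G F)) := by
  rintro _ ⟨v, rfl⟩ k hk
  exact (LinearMap.congr_fun (heckeOperator_left dγ hπ k (f := f) (f' := f) (hf k hk)) v).symm

/-- The space of vectors fixed by a congruence subgroup is finite-dimensional. -/
def IsAdmissible (π : Representation ℂ (G F) V) : Prop :=
  ∀ n : ℕ, FiniteDimensional ℂ (fixedBy π (congSub F n : Set (G F)))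

/-- Additivity of the trace needs a common finite-dimensional space: the vectors fixed by a
congruence subgroup under which both functions are left invariant. -/
theorem charDist_add (hπ : IsSmooth π) (hadm : IsAdmissible π) (f f' : schwartz (G F)) :
    charDist π dγ (f + f') = charDist π dγ f + charDist π dγ f' := by
  obtain ⟨n, hn⟩ := exists_left_invariant f
  obtain ⟨m, hm⟩ := exists_left_invariant f'
  have := hadm (max n m)
  rw [charDist, charDist, charDist, heckeOperator_add dγ hπ]
  exact finiteRankTrace_add (W := fixedBy π (congSub F (max n m) : Set (G F)))
    (range_heckeOperator_le dγ hπ fun k hk => hn k (congSub_anti (le_max_left _ _) hk))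
    (range_heckeOperator_le dγ hπ fun k hk => hm k (congSub_anti (le_max_right _ _) hk))

theorem charDist_smul (hπ : IsSmooth π) (hadm : IsAdmissible π) (c : ℂ) (f : schwartz (G F)) :
    charDist π dγ (c • f) = c * charDist π dγ f := by
  obtain ⟨n, hn⟩ := exists_left_invariant f
  have := hadm n
  rw [charDist, charDist, heckeOperator_smul dγ hπ]
  exact finiteRankTrace_smul (range_heckeOperator_le dγ hπ hn) c

theorem charDist_conj (hπ : IsSmooth π) (hadm : IsAdmissible π) (x : G F) {f f' : schwartz (G F)}
    (h : ∀ γ, (f' : G F → ℂ) γ = (f : G F → ℂ) (x * γ * x⁻¹)) :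
    charDist π dγ f' = charDist π dγ f := by
  obtain ⟨n, hn⟩ := exists_left_invariant f
  have := hadm n
  have hfd : FiniteDimensional ℂ (LinearMap.range (heckeOperator π dγ (f : G F → ℂ))) :=
    Submodule.finiteDimensional_of_le (range_heckeOperator_le dγ hπ hn)
  have e : heckeOperator π dγ (f' : G F → ℂ) =
      π x⁻¹ ∘ₗ heckeOperator π dγ (f : G F → ℂ) ∘ₗ π x := by
    have := isMulRightInvariant_haar dγ
    refine (isHeckeOperator_heckeOperator dγ hπ f').unique fun v l => ?_
    have h1 := isHeckeOperator_heckeOperator dγ hπ f (π x v) (l ∘ₗ π x⁻¹)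
    rw [LinearMap.comp_apply] at h1
    rw [LinearMap.comp_apply, LinearMap.comp_apply, h1, ← integral_conj dγ x]
    refine integral_congr_ae (Filter.Eventually.of_forall fun γ => ?_)
    simp only [h, LinearMap.comp_apply, ← Module.End.mul_apply, ← map_mul]
    congr 4
    group
  rw [charDist, charDist, e]
  refine finiteRankTrace_conj ?_
  change π x * π x⁻¹ = 1
  rw [← map_mul, mul_inv_cancel, map_one]

end Hecke

end GLTwo

namespace GLTwo

/-! ### Schur's lemma in countable dimension and irreducibility. -/

section Schur

open Polynomial in
theorem injective_aeval_of_forall {Q : Type*} [AddCommGroup Q] [Module ℂ Q] {A : Module.End ℂ Q}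
    (h : ∀ z : ℂ, Function.Injective (A - algebraMap ℂ (Module.End ℂ Q) z)) {p : ℂ[X]} (hp : p ≠ 0) :
    Function.Injective (aeval A p) := by
  rw [(IsAlgClosed.splits p).eq_prod_roots, map_mul, aeval_C]
  have h1 : Function.Injective (algebraMap ℂ (Module.End ℂ Q) p.leadingCoeff) := by
    intro v w hvw
    exact smul_right_injective Q (leadingCoeff_ne_zero.2 hp) hvw
  refine h1.comp ?_
  induction p.roots using Multiset.induction_on with
  | empty =>
    rw [Multiset.map_zero, Multiset.prod_zero, map_one]
    exact Function.injective_id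
  | cons a s ih =>
    rw [Multiset.map_cons, Multiset.prod_cons, map_mul, map_sub, aeval_X, aeval_C]
    exact (h a).comp ih

open Polynomial in
/-- Schur's lemma in countable dimension. -/
theorem exists_eq_algebraMap {Q : Type*} [AddCommGroup Q] [Module ℂ Q] [Nontrivial Q]
    (hQ : Module.rank ℂ Q ≤ Cardinal.aleph0) {A : Module.End ℂ Q}
    (h : ∀ z : ℂ, A = algebraMap ℂ (Module.End ℂ Q) z ∨ Function.Bijective (A - algebraMap ℂ (Module.End ℂ Q) z)) :
    ∃ z : ℂ, A = algebraMap ℂ (Module.End ℂ Q) z := by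
  by_contra! hn
  have hb : ∀ z : ℂ, Function.Bijective (A - algebraMap ℂ (Module.End ℂ Q) z) := fun z => (h z).resolve_left (hn z)
  obtain ⟨v, hv⟩ := exists_ne (0 : Q)
  -- u z is (A - z)⁻¹ v. A linear relation among these vectors, after clearing denominators, is
  -- p(A)v = 0, and p(A) is injective for p ≠ 0. So they form an independent family indexed by the
  -- uncountable ℂ.
  choose u hu using fun z => (hb z).2 v
  have hli : LinearIndependent ℂ u := by
    classical
    rw [linearIndependent_iff']
    intro s c hs z hz
    set p : ℂ[X] := ∑ z ∈ s, C (c z) * ∏ w ∈ s.erase z, (X - C w) with hp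
    have hpv : aeval A p v = 0 := by
      have h1 : aeval A (∏ w ∈ s, (X - C w)) (∑ z ∈ s, c z • u z) = 0 := by rw [hs, map_zero]
      rw [← h1, hp, map_sum, LinearMap.sum_apply, map_sum]
      refine Finset.sum_congr rfl fun z hz => ?_
      rw [← Finset.prod_erase_mul s _ hz, map_mul, map_mul, Module.End.mul_apply, Module.End.mul_apply,
        map_smul, map_sub, aeval_X, aeval_C, aeval_C, hu, map_smul]
      rfl
    have hp0 : p = 0 := by
      by_contra hne
      refine hv (injective_aeval_of_forall (fun z => (hb z).1) hne ?_)
      rw [hpv, map_zero]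
    have he := congrArg (eval z) hp0
    rw [hp, eval_finsetSum, Finset.sum_eq_single z, eval_mul, eval_C, eval_prod, eval_zero,
      mul_eq_zero] at he
    · refine he.resolve_right (Finset.prod_ne_zero_iff.2 fun w hw => ?_)
      rw [eval_sub, eval_X, eval_C]
      exact sub_ne_zero.2 (Finset.ne_of_mem_erase hw).symm
    · intro w hw hwz
      rw [eval_mul, eval_prod, Finset.prod_eq_zero (Finset.mem_erase.2 ⟨hwz.symm, hz⟩) (by simp), mul_zero]
    · exact fun h => absurd hz h
  have h1 := hli.cardinal_lift_le_rank
  rw [Cardinal.mk_complex, Cardinal.lift_continuum] at h1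
  have h2 : Cardinal.lift.{0} (Module.rank ℂ Q) ≤ Cardinal.aleph0 := by
    rwa [Cardinal.lift_uzero]
  exact absurd (h1.trans h2) (not_le.2 Cardinal.aleph0_lt_continuum)

end Schur

section Irreducible

variable {H V : Type*} [Group H] [AddCommGroup V] [Module ℂ V] {π : Representation ℂ H V}

theorem eq_bot_or_eq_top_of_stable (hirr : π.IsIrreducible) (W : Submodule ℂ V)
    (hW : ∀ x, ∀ v ∈ W, π x v ∈ W) : W = ⊥ ∨ W = ⊤ := by
  have h := hirr.eq_bot_or_eq_top (⟨W, fun x v hv => hW x v hv⟩ : Subrepresentation π)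
  refine h.imp (fun h => ?_) (fun h => ?_)
  · exact congrArg Subrepresentation.toSubmodule h
  · exact congrArg Subrepresentation.toSubmodule h

theorem nontrivial_of_isIrreducible (hirr : π.IsIrreducible) : Nontrivial V := by
  by_contra hn
  rw [not_nontrivial_iff_subsingleton] at hn
  obtain ⟨a, b, hab⟩ := hirr.exists_pair_ne
  exact hab (Subrepresentation.toSubmodule_injective (Subsingleton.elim _ _))

theorem span_orbit_eq_top (hirr : π.IsIrreducible) {v : V} (hv : v ≠ 0) :
    Submodule.span ℂ (Set.range fun x => π x v) = ⊤ := by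
  refine (eq_bot_or_eq_top_of_stable hirr _ fun x w hw => ?_).resolve_left fun h => ?_
  · have : Submodule.span ℂ (Set.range fun x => π x v) ≤
        (Submodule.span ℂ (Set.range fun x => π x v)).comap (π x) := by
      rw [Submodule.span_le]
      rintro _ ⟨y, rfl⟩
      refine Submodule.subset_span ⟨x * y, ?_⟩
      simp
    exact this hw
  · have h1 : v ∈ Submodule.span ℂ (Set.range fun x => π x v) :=
      Submodule.subset_span ⟨1, by simp⟩
    rw [h, Submodule.mem_bot] at h1
    exact hv h1

end Irreducible

end GLTwo

namespace GLTwo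

/-! ### The Iwasawa and Cartan decompositions. -/

section Decomposition

variable {F : Type*} [Field F]

/-- The upper unipotent matrices. -/
noncomputable def upU (u : F) : G F := mkG 1 u 0 1 (by simp)

theorem eq_upU_mul_diagG_mul_lowU {x : G F} (hd : (x : g F) 1 1 ≠ 0) :
    ∃ s : Fˣ, (s : F) = (x : g F) 0 0 - (x : g F) 0 1 * ((x : g F) 1 0 / (x : g F) 1 1) ∧
      x = upU ((x : g F) 0 1 / (x : g F) 1 1) * diagG s (Units.mk0 _ hd) *
        lowU ((x : g F) 1 0 / (x : g F) 1 1) := by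
  have hdet : (x : g F).det ≠ 0 := (Matrix.isUnits_det_units x).ne_zero
  have hs : (x : g F) 0 0 - (x : g F) 0 1 * ((x : g F) 1 0 / (x : g F) 1 1) ≠ 0 := by
    intro h
    refine hdet ?_
    rw [Matrix.det_fin_two]
    field_simp at h
    linear_combination h
  refine ⟨Units.mk0 _ hs, rfl, ?_⟩
  ext : 1
  simp only [Units.val_mul, upU, lowU, diagG, coe_mkG, Units.val_mk0]
  refine ext_g ?_ ?_ ?_ ?_ <;> simp [Matrix.mul_apply, Fin.sum_univ_two, hd]
  rw [mul_div_cancel₀ _ hd]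

theorem inv_lowU (u : F) : (lowU u)⁻¹ = lowU (-u) := by
  rw [inv_eq_iff_mul_eq_one]
  ext : 1
  simp only [Units.val_mul, lowU, coe_mkG, Units.val_one]
  refine ext_g ?_ ?_ ?_ ?_ <;> simp [Matrix.mul_apply, Fin.sum_univ_two]

theorem inv_upU (u : F) : (upU u)⁻¹ = upU (-u) := by
  rw [inv_eq_iff_mul_eq_one]
  ext : 1
  simp only [Units.val_mul, upU, coe_mkG, Units.val_one]
  refine ext_g ?_ ?_ ?_ ?_ <;> simp [Matrix.mul_apply, Fin.sum_univ_two]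

theorem weyl_mul_weyl : weyl F * weyl F = 1 := by
  ext : 1
  simp only [Units.val_mul, weyl, coe_mkG, Units.val_one]
  refine ext_g ?_ ?_ ?_ ?_ <;> simp [Matrix.mul_apply, Fin.sum_univ_two]

theorem inv_diagG (s t : Fˣ) : (diagG s t)⁻¹ = diagG s⁻¹ t⁻¹ := by
  rw [inv_eq_iff_mul_eq_one]
  ext : 1
  simp only [Units.val_mul, diagG, coe_mkG, Units.val_one]
  refine ext_g ?_ ?_ ?_ ?_ <;> simp [Matrix.mul_apply, Fin.sum_univ_two]

theorem diagG_mul_upU (s t : Fˣ) (u : F) : diagG s t * upU u = upU (s * u / t) * diagG s t := by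
  ext : 1
  simp only [Units.val_mul, diagG, upU, coe_mkG]
  refine ext_g ?_ ?_ ?_ ?_ <;> simp [Matrix.mul_apply, Fin.sum_univ_two]

theorem diagG_mul_comm (s t s' t' : Fˣ) : diagG s t * diagG s' t' = diagG s' t' * diagG s t := by
  ext : 1
  simp only [Units.val_mul, diagG, coe_mkG]
  refine ext_g ?_ ?_ ?_ ?_ <;> simp [Matrix.mul_apply, Fin.sum_univ_two, mul_comm]

theorem diagG_scalar_mul_comm (s : Fˣ) (x : G F) : diagG s s * x = x * diagG s s := by
  ext : 1
  simp only [Units.val_mul, diagG, coe_mkG]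
  refine ext_g ?_ ?_ ?_ ?_ <;> simp [Matrix.mul_apply, Fin.sum_univ_two, mul_comm]

end Decomposition

section Integral

variable {F : Type*} [Field F] [ValuativeRel F] [TopologicalSpace F] [IsNonarchimedeanLocalField F]

theorem mem_pw_zero_iff_nabs {a : F} : a ∈ pw F 0 ↔ nabs a ≤ 1 := by
  rw [mem_pw, neg_zero, zpow_zero]

theorem div_mem_pw_zero {a b : F} (h : nabs a ≤ nabs b) : a / b ∈ pw F 0 := by
  rw [mem_pw_zero_iff_nabs, nabs_div]
  exact div_le_one_of_le₀ h (nabs_nonneg b)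

theorem lowU_mem_congSub {u : F} (hu : u ∈ pw F 0) : lowU u ∈ congSub F 0 := by
  rw [mem_congSub_zero, inv_lowU]
  simp only [lowU, coe_mkG]
  exact ⟨⟨by simpa using one_mem_pw, by simp, by simpa using hu, by simpa using one_mem_pw⟩,
    ⟨by simpa using one_mem_pw, by simp, by simpa using hu, by simpa using one_mem_pw⟩⟩

theorem upU_mem_congSub {n : ℕ} {u : F} (hu : u ∈ pw F n) : upU u ∈ congSub F n := by
  rw [mem_congSub, inv_upU]
  simp only [upU, coe_mkG]
  exact ⟨⟨by simp, by simpa using hu, by simp, by simp⟩, ⟨by simp, by simpa using hu, by simp, by simp⟩⟩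

variable (F) in
theorem weyl_mem_congSub : weyl F ∈ congSub F 0 := by
  rw [mem_congSub_zero, inv_eq_of_mul_eq_one_left weyl_mul_weyl]
  simp only [weyl, coe_mkG, and_self]
  exact ⟨by simp, by simpa using one_mem_pw, by simpa using one_mem_pw, by simp⟩

theorem diagG_mem_congSub {s t : Fˣ} (hs : nabs (s : F) = 1) (ht : nabs (t : F) = 1) :
    diagG s t ∈ congSub F 0 := by
  rw [mem_congSub_zero, inv_diagG]
  simp only [diagG, coe_mkG]
  have h : ∀ s : Fˣ, nabs (s : F) = 1 → (s : F) ∈ pw F 0 ∧ ((s⁻¹ : Fˣ) : F) ∈ pw F 0 := by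
    intro s hs
    rw [mem_pw_zero_iff_nabs, mem_pw_zero_iff_nabs, Units.val_inv_eq_inv_val, nabs_inv, hs]
    simp
  exact ⟨⟨by simpa using (h s hs).1, by simp, by simp, by simpa using (h t ht).1⟩,
    ⟨by simpa using (h s hs).2, by simp, by simp, by simpa using (h t ht).2⟩⟩

variable (F) in
/-- The uniformizer as a unit of `F`. -/
noncomputable def unifU : Fˣ := Units.mk0 (unif F) (unif_ne_zero F)

theorem coe_unifU_zpow (i : ℤ) : ((unifU F ^ i : Fˣ) : F) = unif F ^ i := by
  rw [Units.val_zpow_eq_zpow_val]; rfl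

theorem exists_unifU_zpow_mul (s : Fˣ) : ∃ (i : ℤ) (e : Fˣ), nabs (e : F) = 1 ∧ s = unifU F ^ i * e ∧
    nabs (s : F) = q F ^ (-i) := by
  have h1 := nabs_of_ne s.ne_zero
  refine ⟨val (s : F), (unifU F ^ val (s : F))⁻¹ * s, ?_, by rw [mul_inv_cancel_left], h1⟩
  rw [Units.val_mul, Units.val_inv_eq_inv_val, nabs_mul, nabs_inv, coe_unifU_zpow, nabs_unif_zpow, h1]
  exact inv_mul_cancel₀ (zpow_ne_zero _ (q_pos F).ne')

/-- A Weyl element, if needed, puts the larger entry of the bottom row in the last column; then the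
lower unipotent factor is integral. -/
theorem iwasawa_decomposition (x : G F) : ∃ (u : F) (s t : Fˣ), ∃ k ∈ congSub F 0,
    x = upU u * diagG s t * k := by
  have key : ∀ x : G F, (x : g F) 1 1 ≠ 0 → nabs ((x : g F) 1 0) ≤ nabs ((x : g F) 1 1) →
      ∃ (u : F) (s t : Fˣ), ∃ k ∈ congSub F 0, x = upU u * diagG s t * k := by
    intro x hd hle
    obtain ⟨s, -, hs⟩ := eq_upU_mul_diagG_mul_lowU hd
    exact ⟨_, s, _, _, lowU_mem_congSub (div_mem_pw_zero hle), hs⟩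
  have hw0 : ((x * weyl F : G F) : g F) 1 0 = (x : g F) 1 1 := by
    simp [weyl, Matrix.mul_apply, Fin.sum_univ_two]
  have hw1 : ((x * weyl F : G F) : g F) 1 1 = (x : g F) 1 0 := by
    simp [weyl, Matrix.mul_apply, Fin.sum_univ_two]
  have hne : ¬((x : g F) 1 0 = 0 ∧ (x : g F) 1 1 = 0) := fun h => by
    refine (Matrix.isUnits_det_units x).ne_zero ?_
    rw [Matrix.det_fin_two, h.1, h.2]; ring
  have hz : ∀ a b : F, ¬(a = 0 ∧ b = 0) → nabs a ≤ nabs b → b ≠ 0 := by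
    rintro a b hab hle rfl
    rw [nabs_zero] at hle
    exact hab ⟨by_contra fun h => absurd (nabs_pos h) (not_lt.2 hle), rfl⟩
  rcases le_total (nabs ((x : g F) 1 0)) (nabs ((x : g F) 1 1)) with hle | hle
  · exact key x (hz _ _ hne hle) hle
  · obtain ⟨u, s, t, k, hk, h⟩ := key (x * weyl F) (by
      rw [hw1]; exact hz _ _ (fun h => hne h.symm) hle) (by rwa [hw0, hw1])
    refine ⟨u, s, t, k * weyl F, mul_mem hk (weyl_mem_congSub F), ?_⟩
    rw [← mul_assoc, ← h, mul_assoc, weyl_mul_weyl, mul_one]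

theorem dg_eq_diagG (j : ℤ) : (dg j : G F) = diagG (unifU F ^ j) 1 := by
  ext : 1
  simp only [dg, diagG, coe_mkG, coe_unifU_zpow, Units.val_one]

/-- Weyl elements on both sides move an entry of maximal absolute value to the lower right. Both
unipotent factors are then integral, and the first diagonal entry is no larger than the second,
whence j ≥ 0. -/
theorem cartan_decomposition (x : G F) : ∃ k ∈ congSub F 0, ∃ k' ∈ congSub F 0, ∃ (i : ℤ) (j : ℕ),
    x = k * (diagG (unifU F ^ i) (unifU F ^ i) * dg j) * k' := by
  have key : ∀ x : G F, (∀ i j, nabs ((x : g F) i j) ≤ nabs ((x : g F) 1 1)) →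
      ∃ k ∈ congSub F 0, ∃ k' ∈ congSub F 0, ∃ (i : ℤ) (j : ℕ),
        x = k * (diagG (unifU F ^ i) (unifU F ^ i) * dg j) * k' := by
    intro x hx
    have hd : (x : g F) 1 1 ≠ 0 := by
      intro h0
      have h1 : ∀ i j, (x : g F) i j = 0 := fun i j => by_contra fun h => by
        have := (nabs_pos h).trans_le (hx i j)
        rw [h0, nabs_zero] at this
        exact lt_irrefl _ this
      refine (Matrix.isUnits_det_units x).ne_zero ?_
      rw [Matrix.det_fin_two, h1, h1]; simp [h1]
    obtain ⟨s, hs, h⟩ := eq_upU_mul_diagG_mul_lowU hd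
    obtain ⟨i, e, he, hi, hni⟩ := exists_unifU_zpow_mul (Units.mk0 _ hd)
    obtain ⟨i', e', he', hi', hni'⟩ := exists_unifU_zpow_mul s
    have hsle : nabs (s : F) ≤ nabs ((x : g F) 1 1) := by
      rw [hs, sub_eq_add_neg]
      refine (nabs_add_le _ _).trans (max_le (hx 0 0) ?_)
      rw [nabs_neg, nabs_mul]
      exact (mul_le_mul (hx 0 1) (mem_pw_zero_iff_nabs.1 (div_mem_pw_zero (hx 1 0)))
        (nabs_nonneg _) (nabs_nonneg _)).trans (mul_one _).le
    rw [Units.val_mk0] at hni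
    have hii' : i ≤ i' := by
      rw [hni, hni', zpow_le_zpow_iff_right₀ (one_lt_q F)] at hsle
      omega
    refine ⟨_, upU_mem_congSub (div_mem_pw_zero (hx 0 1)), _,
      mul_mem (diagG_mem_congSub he' he) (lowU_mem_congSub (div_mem_pw_zero (hx 1 0))),
      i, (i' - i).toNat, ?_⟩
    have e1 : diagG s (Units.mk0 _ hd) = diagG (unifU F ^ i) (unifU F ^ i) *
        dg ((i' - i).toNat : ℤ) * diagG e' e := by
      rw [dg_eq_diagG, hi, hi', Int.toNat_of_nonneg (by omega)]
      ext : 1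
      simp only [Units.val_mul, diagG, coe_mkG, Units.val_one]
      refine ext_g ?_ ?_ ?_ ?_ <;> simp [Matrix.mul_apply, Fin.sum_univ_two]
      rw [← zpow_add₀ (Units.ne_zero _), add_sub_cancel]
    rw [← mul_assoc, mul_assoc (upU _), ← e1]
    exact h
  have hw := weyl_mem_congSub F
  have hL : ∀ (x : G F) (i j), ((weyl F * x : G F) : g F) i j = (x : g F) (1 - i) j := by
    intro x i j
    fin_cases i <;> simp [weyl, Matrix.mul_apply, Fin.sum_univ_two]
  have hR : ∀ (x : G F) (i j), ((x * weyl F : G F) : g F) i j = (x : g F) i (1 - j) := by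
    intro x i j
    fin_cases j <;> simp [weyl, Matrix.mul_apply, Fin.sum_univ_two]
  have hstep : ∀ x : G F, (∃ i, ∀ i' j', nabs ((x : g F) i' j') ≤ nabs ((x : g F) i 1)) →
      ∃ k ∈ congSub F 0, ∃ k' ∈ congSub F 0, ∃ (i : ℤ) (j : ℕ),
        x = k * (diagG (unifU F ^ i) (unifU F ^ i) * dg j) * k' := by
    rintro x ⟨i, hi⟩
    fin_cases i
    · obtain ⟨k, hk, k', hk', i, j, h⟩ := key (weyl F * x) fun i' j' => by
        rw [hL, hL]; exact hi _ _
      refine ⟨weyl F * k, mul_mem hw hk, k', hk', i, j, ?_⟩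
      rw [mul_assoc, mul_assoc, ← mul_assoc k, ← h, ← mul_assoc, weyl_mul_weyl, one_mul]
    · exact key x hi
  obtain ⟨⟨i, j⟩, hij⟩ := Finite.exists_max fun p : Fin 2 × Fin 2 => nabs ((x : g F) p.1 p.2)
  fin_cases j
  · obtain ⟨k, hk, k', hk', i, j, h⟩ := hstep (x * weyl F) ⟨i, fun i' j' => by
      rw [hR, hR]; exact hij (i', 1 - j')⟩
    refine ⟨k, hk, k' * weyl F, mul_mem hk' hw, i, j, ?_⟩
    rw [← mul_assoc, ← h, mul_assoc, weyl_mul_weyl, mul_one]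
  · exact hstep x ⟨i, fun i' j' => hij (i', j')⟩

end Integral

end GLTwo

namespace GLTwo

/-! ### Admissibility when the Jacquet module vanishes. -/

section Admissible

variable {F : Type*} [Field F] [ValuativeRel F] [TopologicalSpace F] [IsNonarchimedeanLocalField F]
  {V : Type*} [AddCommGroup V] [Module ℂ V] {π : Representation ℂ (G F) V}

theorem apply_mul_apply (π : Representation ℂ (G F) V) (x y : G F) (v : V) :
    π (x * y) v = π x (π y v) := by
  rw [map_mul, Module.End.mul_apply]

theorem IsSmooth.finite_image (hπ : IsSmooth π) (v : V) {K : Set (G F)} (hK : IsCompact K) :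
    ((fun x => π x v) '' K).Finite := by
  let : TopologicalSpace V := ⊥
  have : DiscreteTopology V := ⟨rfl⟩
  exact (hK.image (hπ.isLocallyConstant v).continuous).finite_of_discrete

theorem IsSmooth.countable_range (hπ : IsSmooth π) (v : V) :
    (Set.range fun x => π x v).Countable := by
  obtain ⟨D, hD, hdense⟩ := TopologicalSpace.exists_countable_dense (G F)
  refine (hD.image fun x => π x v).mono ?_
  rintro _ ⟨x, rfl⟩
  obtain ⟨y, hy, hyD⟩ := hdense.inter_open_nonempty _
    ((hπ.isLocallyConstant v).isOpen_fiber (π x v)) ⟨x, rfl⟩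
  exact ⟨y, hyD, hy⟩

/-- One orbit spans V, and it is countable because G is separable and orbit maps are locally
constant. This is what Schur's lemma requires. -/
theorem rank_le_aleph0 (hirr : π.IsIrreducible) (hπ : IsSmooth π) :
    Module.rank ℂ V ≤ Cardinal.aleph0 := by
  have := nontrivial_of_isIrreducible hirr
  obtain ⟨v, hv⟩ := exists_ne (0 : V)
  have h := span_orbit_eq_top hirr hv
  have h1 := rank_span_le (R := ℂ) (Set.range fun x => π x v)
  rw [h, rank_top] at h1
  exact h1.trans (hπ.countable_range v).le_aleph0

theorem exists_central_character (hirr : π.IsIrreducible) (hπ : IsSmooth π) (s : Fˣ) :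
    ∃ z : ℂ, ∀ v, π (diagG s s) v = z • v := by
  have := nontrivial_of_isIrreducible hirr
  have hcomm : ∀ (z : ℂ) (x : G F) (v : V),
      π x ((π (diagG s s) - algebraMap ℂ (Module.End ℂ V) z) v) =
        (π (diagG s s) - algebraMap ℂ (Module.End ℂ V) z) (π x v) := by
    intro z x v
    simp only [LinearMap.sub_apply, map_sub, Module.algebraMap_end_apply, map_smul, ← apply_mul_apply,
      diagG_scalar_mul_comm]
  obtain ⟨z, hz⟩ := exists_eq_algebraMap (rank_le_aleph0 hirr hπ) (A := π (diagG s s)) fun z => by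
    set B := π (diagG s s) - algebraMap ℂ (Module.End ℂ V) z with hB
    have hker := eq_bot_or_eq_top_of_stable hirr (LinearMap.ker B) fun x v hv => by
      rw [LinearMap.mem_ker] at hv ⊢
      rw [← hcomm, hv, map_zero]
    have hran := eq_bot_or_eq_top_of_stable hirr (LinearMap.range B) fun x v hv => by
      obtain ⟨w, rfl⟩ := hv
      exact ⟨π x w, (hcomm z x w).symm⟩
    rcases hran with hran | hran
    · left
      rw [LinearMap.range_eq_bot] at hran
      exact sub_eq_zero.1 hran
    · rcases hker with hker | hker
      · right
        exact ⟨LinearMap.ker_eq_bot.1 hker, LinearMap.range_eq_top.1 hran⟩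
      · left
        rw [LinearMap.ker_eq_top] at hker
        exact sub_eq_zero.1 hker
  exact ⟨z, fun v => by rw [hz, Module.algebraMap_end_apply]⟩

/-- The kernel of the projection to the Jacquet module. -/
def jacquetKer (π : Representation ℂ (G F) V) : Submodule ℂ V :=
  Submodule.span ℂ {w | ∃ (u : F) (v : V), w = π (upU u) v - v}

theorem apply_diagG_mem_jacquetKer (s t : Fˣ) {v : V} (hv : v ∈ jacquetKer π) :
    π (diagG s t) v ∈ jacquetKer π := by
  have h : jacquetKer π ≤ (jacquetKer π).comap (π (diagG s t)) := by
    rw [jacquetKer, Submodule.span_le]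
    rintro _ ⟨u, v, rfl⟩
    refine Submodule.subset_span ⟨s * u / t, π (diagG s t) v, ?_⟩
    rw [map_sub, ← apply_mul_apply, ← apply_mul_apply, diagG_mul_upU]
  exact h hv

/-- e is the Hecke operator of the indicator of the congruence subgroup, left unnormalized (c is its
volume). It commutes with GL(2, O), where that subgroup is normal. -/
theorem exists_congSub_projection (hπ : IsSmooth π) (n : ℕ) : ∃ e : V →ₗ[ℂ] V,
    (∀ v, e v ∈ fixedBy π (congSub F n : Set (G F))) ∧
    (∃ c : ℂ, c ≠ 0 ∧ ∀ v ∈ fixedBy π (congSub F n : Set (G F)), e v = c • v) ∧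
    (∀ k ∈ congSub F n, ∀ v, e (π k v) = e v) ∧
    ∀ k ∈ congSub F 0, ∀ v, e (π k v) = π k (e v) := by
  borelize (G F)
  set dγ : Measure (G F) := Measure.haar
  set f : schwartz (G F) := ind (congSub F n : Set (G F)) with hf
  have hfe : ∀ γ, (f : G F → ℂ) γ = (congSub F n : Set (G F)).indicator 1 γ := fun γ => by
    rw [hf, coe_ind (isOpen_congSub n) (isCompact_congSub n)]
  classical
  have hcongr : ∀ x y : G F, (x ∈ congSub F n ↔ y ∈ congSub F n) → (f : G F → ℂ) x = (f : G F → ℂ) y := by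
    intro x y h
    rw [hfe, hfe, Set.indicator_apply, Set.indicator_apply]
    simp only [SetLike.mem_coe, h, Pi.one_apply]
  have hleft : ∀ k ∈ congSub F n, ∀ γ, (f : G F → ℂ) (k * γ) = (f : G F → ℂ) γ := fun k hk γ =>
    hcongr _ _ (Subgroup.mul_mem_cancel_left _ hk)
  refine ⟨heckeOperator π dγ (f : G F → ℂ), fun v => range_heckeOperator_le dγ hπ hleft ⟨v, rfl⟩,
    ⟨∫ γ, (f : G F → ℂ) γ ∂dγ, ?_, fun v hv => ?_⟩, fun k hk v => ?_, fun k hk v => ?_⟩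
  · exact integral_ind_ne_zero dγ (isCompact_congSub n) (isOpen_congSub n) (one_mem _)
  · rw [← sub_eq_zero, ← Module.forall_dual_apply_eq_zero_iff ℂ]
    intro l
    rw [map_sub, sub_eq_zero, isHeckeOperator_heckeOperator dγ hπ f, map_smul, smul_eq_mul,
      ← integral_mul_const]
    refine integral_congr_ae (Filter.Eventually.of_forall fun γ => ?_)
    by_cases hγ : γ ∈ congSub F n
    · simp only [hv γ hγ]
    · have : (f : G F → ℂ) γ = 0 := by rw [hfe, Set.indicator_of_notMem hγ]
      simp only [this, zero_mul]
  · exact (LinearMap.congr_fun (heckeOperator_right dγ hπ k (f := f) (f' := f) fun γ =>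
      hcongr _ _ (Subgroup.mul_mem_cancel_right _ hk)) v).symm
  · have hconj : ∀ γ, γ ∈ congSub F n ↔ k⁻¹ * γ * k ∈ congSub F n := fun γ => by
      constructor
      · intro h
        have := congSub_conj (inv_mem hk) h
        rwa [inv_inv] at this
      · intro h
        have := congSub_conj hk h
        rwa [show k * (k⁻¹ * γ * k) * k⁻¹ = γ by group] at this
    set f' : schwartz (G F) := ind ((fun γ => k⁻¹ * γ) ⁻¹' (congSub F n : Set (G F))) with hf'
    have ho : IsOpen ((fun γ => k⁻¹ * γ) ⁻¹' (congSub F n : Set (G F))) :=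
      (isOpen_congSub n).preimage (continuous_const_mul _)
    have hc : IsCompact ((fun γ => k⁻¹ * γ) ⁻¹' (congSub F n : Set (G F))) :=
      (Homeomorph.mulLeft k⁻¹).isCompact_preimage.2 (isCompact_congSub n)
    have hfe' : ∀ γ, (f' : G F → ℂ) γ = (f : G F → ℂ) (k⁻¹ * γ) := fun γ => by
      rw [hf', coe_ind ho hc, hfe]; rfl
    have h1 := heckeOperator_left dγ hπ k (f := f) (f' := f') fun γ => by
      rw [hfe', inv_mul_cancel_left]
    have h2 := heckeOperator_right dγ hπ k (f := f) (f' := f') fun γ => by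
      rw [hfe']
      refine hcongr _ _ ?_
      rw [← mul_assoc]
      exact (hconj γ).symm
    rw [h1] at h2
    exact (LinearMap.congr_fun h2 v).symm

theorem dg_mul_upU (j : ℕ) (u : F) : dg (j : ℤ) * upU u = upU (unif F ^ (j : ℤ) * u) * dg j := by
  rw [dg_eq_diagG, diagG_mul_upU, coe_unifU_zpow, Units.val_one, div_one]

/-- For large j, conjugation by diag(ϖ^j, 1) contracts a given upper unipotent element into the
congruence subgroup, which e does not see. -/
theorem exists_projection_eq_zero {n : ℕ} {e : V →ₗ[ℂ] V}
    (he : ∀ k ∈ congSub F n, ∀ v, e (π k v) = e v) {v : V} (hv : v ∈ jacquetKer π) :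
    ∃ J : ℕ, ∀ j : ℕ, J ≤ j → e (π (dg (j : ℤ)) v) = 0 := by
  induction hv using Submodule.span_induction with
  | mem w hw =>
    obtain ⟨u, v, rfl⟩ := hw
    obtain ⟨m, hm⟩ := exists_mem_pw u
    refine ⟨(n - m).toNat, fun j hj => ?_⟩
    rw [map_sub, map_sub, ← apply_mul_apply, dg_mul_upU, apply_mul_apply, he, sub_self]
    refine upU_mem_congSub ?_
    rw [unif_zpow_mul_mem]
    exact pw_anti (by omega) hm
  | zero => exact ⟨0, fun j _ => by rw [map_zero, map_zero]⟩
  | add v w _ _ hv hw =>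
    obtain ⟨J, hJ⟩ := hv
    obtain ⟨J', hJ'⟩ := hw
    refine ⟨max J J', fun j hj => ?_⟩
    rw [map_add, map_add, hJ j (le_trans (le_max_left _ _) hj), hJ' j (le_trans (le_max_right _ _) hj),
      add_zero]
  | smul c v _ hv =>
    obtain ⟨J, hJ⟩ := hv
    exact ⟨J, fun j hj => by rw [map_smul, map_smul, hJ j hj, smul_zero]⟩

/-- Project the orbit of w by e. In the Cartan decomposition the center contributes scalars, the
compact factors finitely many vectors, and j is bounded because all vectors are in the kernel to the
Jacquet module. -/
theorem finiteDimensional_of_jacquetKer_eq_top (hirr : π.IsIrreducible) (hπ : IsSmooth π)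
    (hJ : jacquetKer π = ⊤) (n : ℕ) : FiniteDimensional ℂ (fixedBy π (congSub F n : Set (G F))) := by
  obtain ⟨e, he1, ⟨c, hc0, hc⟩, he2, he3⟩ := exists_congSub_projection hπ n
  have := nontrivial_of_isIrreducible hirr
  obtain ⟨w, hw⟩ := exists_ne (0 : V)
  set R : Set V := (fun x => π x w) '' (congSub F 0 : Set (G F)) with hR
  have hRf : R.Finite := hπ.finite_image w (isCompact_congSub 0)
  choose J hJ using fun v : V => exists_projection_eq_zero he2 (v := v) (by rw [hJ]; trivial)
  obtain ⟨N, hN⟩ : ∃ N, ∀ v ∈ R, J v ≤ N := by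
    obtain ⟨N, hN⟩ := (hRf.image J).bddAbove
    exact ⟨N, fun v hv => hN ⟨v, hv, rfl⟩⟩
  set S : Set V := ⋃ v ∈ R, ⋃ j ∈ Set.Iio N,
    (fun x => π x (e (π (dg ((j : ℕ) : ℤ)) v))) '' (congSub F 0 : Set (G F)) with hS
  have hSf : S.Finite := hRf.biUnion fun v _ => (Set.finite_Iio N).biUnion fun j _ =>
    hπ.finite_image _ (isCompact_congSub 0)
  have hspan : ∀ x : G F, e (π x w) ∈ Submodule.span ℂ S := by
    intro x
    obtain ⟨k, hk, k', hk', i, j, rfl⟩ := cartan_decomposition x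
    obtain ⟨z, hz⟩ := exists_central_character hirr hπ (unifU F ^ i)
    rw [apply_mul_apply, apply_mul_apply, he3 k hk, apply_mul_apply, hz, map_smul, map_smul]
    refine Submodule.smul_mem _ _ ?_
    have hv : π k' w ∈ R := ⟨k', hk', rfl⟩
    by_cases hj : j < N
    · refine Submodule.subset_span ?_
      simp only [hS, Set.mem_iUnion]
      exact ⟨_, hv, j, hj, k, hk, rfl⟩
    · rw [hJ _ j ((hN _ hv).trans (not_lt.1 hj)), map_zero]
      exact zero_mem _
  have hle : fixedBy π (congSub F n : Set (G F)) ≤ Submodule.span ℂ S := by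
    intro v hv
    have h1 : ∀ v, e v ∈ Submodule.span ℂ S := by
      have : (⊤ : Submodule ℂ V) ≤ (Submodule.span ℂ S).comap e := by
        rw [← span_orbit_eq_top hirr hw, Submodule.span_le]
        rintro _ ⟨x, rfl⟩
        exact hspan x
      exact fun v => this trivial
    have h2 := h1 v
    rw [hc v hv] at h2
    exact (Submodule.smul_mem_iff _ hc0).1 h2
  have : FiniteDimensional ℂ (Submodule.span ℂ S) := FiniteDimensional.span_of_finite ℂ hSf
  exact Submodule.finiteDimensional_of_le hle

end Admissible

end GLTwo

namespace GLTwo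

/-! ### Admissibility when the Jacquet module is nonzero. -/

section Principal

variable {F : Type*} [Field F] [ValuativeRel F] [TopologicalSpace F] [IsNonarchimedeanLocalField F]
  {V : Type*} [AddCommGroup V] [Module ℂ V] {π : Representation ℂ (G F) V}

/-- A proper subspace stable under the Borel subgroup with trivial action of the unipotent radical on
the quotient. -/
structure IsBorelSub (π : Representation ℂ (G F) V) (M : Submodule ℂ V) : Prop where
  le : jacquetKer π ≤ M
  stable : ∀ (s t : Fˣ), ∀ v ∈ M, π (diagG s t) v ∈ M
  ne_top : M ≠ ⊤

theorem upU_apply_mem_iff {M : Submodule ℂ V} (hM : jacquetKer π ≤ M) (u : F) (v : V) :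
    π (upU u) v ∈ M ↔ v ∈ M := by
  have h : π (upU u) v - v ∈ M := hM (Submodule.subset_span ⟨u, v, rfl⟩)
  constructor
  · intro h1
    have := M.sub_mem h1 h
    rwa [sub_sub_cancel] at this
  · intro h1
    have := M.add_mem h h1
    rwa [sub_add_cancel] at this

/-- By the Iwasawa decomposition V is generated over the Borel subgroup by a finite set, so the
union of a chain of proper subspaces is proper and Zorn's lemma applies. -/
theorem exists_maximal_isBorelSub (hirr : π.IsIrreducible) (hπ : IsSmooth π)
    (hJ : jacquetKer π ≠ ⊤) : ∃ M, Maximal (IsBorelSub π) M := by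
  have := nontrivial_of_isIrreducible hirr
  obtain ⟨w, hw⟩ := exists_ne (0 : V)
  set R : Set V := (fun x => π x w) '' (congSub F 0 : Set (G F)) with hR
  have hRf : R.Finite := hπ.finite_image w (isCompact_congSub 0)
  have htop : ∀ M : Submodule ℂ V, jacquetKer π ≤ M → (∀ (s t : Fˣ), ∀ v ∈ M, π (diagG s t) v ∈ M) →
      R ⊆ M → M = ⊤ := by
    intro M h1 h2 h3
    rw [eq_top_iff, ← span_orbit_eq_top hirr hw, Submodule.span_le]
    rintro _ ⟨x, rfl⟩
    obtain ⟨u, s, t, k, hk, rfl⟩ := iwasawa_decomposition x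
    simp only [apply_mul_apply]
    rw [SetLike.mem_coe, upU_apply_mem_iff h1]
    exact h2 s t _ (h3 ⟨k, hk, rfl⟩)
  suffices hz : ∀ c ⊆ {M | IsBorelSub π M}, IsChain (· ≤ ·) c → ∀ y ∈ c,
      ∃ ub ∈ {M | IsBorelSub π M}, ∀ z ∈ c, z ≤ ub by
    obtain ⟨M, -, hM⟩ := zorn_le_nonempty₀ {M | IsBorelSub π M} hz (jacquetKer π)
      ⟨le_rfl, fun s t v hv => apply_diagG_mem_jacquetKer s t hv, hJ⟩
    exact ⟨M, hM⟩
  · intro c hcs hc y hy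
    have hmem : ∀ v, v ∈ sSup c ↔ ∃ M ∈ c, v ∈ M := fun v =>
      Submodule.mem_sSup_of_directed ⟨y, hy⟩ hc.directedOn
    refine ⟨sSup c, ⟨(hcs hy).le.trans (le_sSup hy), fun s t v hv => ?_, fun h => ?_⟩,
      fun z hz => le_sSup hz⟩
    · obtain ⟨M, hM, hv⟩ := (hmem v).1 hv
      exact (hmem _).2 ⟨M, hM, (hcs hM).stable s t v hv⟩
    · have hcov : ∀ S : Set V, S.Finite → ∃ M ∈ c, S ⊆ M := by
        intro S hS
        induction S, hS using Set.Finite.induction_on with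
        | empty => exact ⟨y, hy, Set.empty_subset _⟩
        | insert _ _ ih =>
          rename_i a S _ _
          obtain ⟨M, hM, hSM⟩ := ih
          obtain ⟨M', hM', haM'⟩ := (hmem a).1 (by rw [h]; trivial)
          rcases hc.total hM hM' with hle | hle
          · exact ⟨M', hM', Set.insert_subset haM' (hSM.trans hle)⟩
          · exact ⟨M, hM, Set.insert_subset (hle haM') hSM⟩
      obtain ⟨M, hM, hRM⟩ := hcov R hRf
      exact (hcs hM).ne_top (htop M (hcs hM).le (hcs hM).stable hRM)

/-- By maximality of M, a torus element minus a scalar is zero or bijective on V / M, as the torus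
is commutative; Schur's lemma makes it a scalar. -/
theorem exists_torus_character (hirr : π.IsIrreducible) (hπ : IsSmooth π) {M : Submodule ℂ V}
    (hM : Maximal (IsBorelSub π) M) (s t : Fˣ) : ∃ z : ℂ, ∀ v, π (diagG s t) v - z • v ∈ M := by
  have hB := hM.prop
  have : Nontrivial (V ⧸ M) := Submodule.Quotient.nontrivial_iff.2 hB.ne_top
  set A : Module.End ℂ (V ⧸ M) := M.mapQ M (π (diagG s t)) (fun v hv => hB.stable s t v hv) with hA
  have hAz : ∀ (z : ℂ) (v : V), (A - algebraMap ℂ (Module.End ℂ (V ⧸ M)) z) (M.mkQ v) =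
      M.mkQ (π (diagG s t) v - z • v) := by
    intro z v
    rw [LinearMap.sub_apply, Module.algebraMap_end_apply, map_sub, map_smul]
    rfl
  have hcomm : ∀ (z : ℂ) (s' t' : Fˣ) (v : V), π (diagG s' t') (π (diagG s t) v - z • v) =
      π (diagG s t) (π (diagG s' t') v) - z • π (diagG s' t') v := by
    intro z s' t' v
    rw [map_sub, map_smul, ← apply_mul_apply, ← apply_mul_apply, diagG_mul_comm]
  have hrank : Module.rank ℂ (V ⧸ M) ≤ Cardinal.aleph0 :=
    (rank_quotient_le M).trans (rank_le_aleph0 hirr hπ)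
  obtain ⟨z, hz⟩ := exists_eq_algebraMap hrank (A := A) fun z => by
    by_cases hall : ∀ v, π (diagG s t) v - z • v ∈ M
    · left
      rw [← sub_eq_zero]
      ext v
      rw [LinearMap.comp_apply, hAz, LinearMap.comp_apply, LinearMap.zero_apply, Submodule.mkQ_apply,
        Submodule.Quotient.mk_eq_zero]
      exact hall v
    · right
      set B : V →ₗ[ℂ] V := π (diagG s t) - z • LinearMap.id with hBdef
      have hBv : ∀ v, B v = π (diagG s t) v - z • v := fun v => rfl
      have hle1 : M ≤ M.comap B := fun v hv => by
        rw [Submodule.mem_comap, hBv]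
        exact sub_mem (hB.stable s t v hv) (M.smul_mem z hv)
      have hM1 : M.comap B ≤ M := by
        refine hM.le_of_ge ⟨hB.le.trans hle1, fun s' t' v hv => ?_, fun h => hall fun v => ?_⟩ hle1
        · rw [Submodule.mem_comap, hBv] at hv ⊢
          rw [← hcomm]
          exact hB.stable s' t' _ hv
        · have : v ∈ M.comap B := by rw [h]; trivial
          exact this
      have hM2 : M ⊔ LinearMap.range B = ⊤ := by
        by_contra hne
        have := hM.le_of_ge (y := M ⊔ LinearMap.range B) ⟨hB.le.trans le_sup_left, fun s' t' v hv => ?_, hne⟩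
          le_sup_left
        · exact hall fun v => this (Submodule.mem_sup_right ⟨v, rfl⟩)
        · obtain ⟨m, hm, _, ⟨v, rfl⟩, rfl⟩ := Submodule.mem_sup.1 hv
          rw [map_add]
          refine add_mem (Submodule.mem_sup_left (hB.stable s' t' m hm)) (Submodule.mem_sup_right ?_)
          exact ⟨π (diagG s' t') v, by rw [hBv, hBv, hcomm]⟩
      constructor
      · rw [injective_iff_map_eq_zero]
        intro w hw
        obtain ⟨v, rfl⟩ := M.mkQ_surjective w
        rw [hAz, Submodule.mkQ_apply, Submodule.Quotient.mk_eq_zero] at hw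
        rw [Submodule.mkQ_apply, Submodule.Quotient.mk_eq_zero]
        exact hM1 hw
      · intro w
        obtain ⟨v, rfl⟩ := M.mkQ_surjective w
        obtain ⟨m, hm, _, ⟨v', rfl⟩, hv⟩ := Submodule.mem_sup.1 (show v ∈ M ⊔ LinearMap.range B by
          rw [hM2]; trivial)
        refine ⟨M.mkQ v', ?_⟩
        rw [hAz, ← hv, map_add, ← hBv]
        have : M.mkQ m = 0 := by
          rw [Submodule.mkQ_apply, Submodule.Quotient.mk_eq_zero]; exact hm
        rw [this, zero_add]
  refine ⟨z, fun v => ?_⟩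
  have h1 := hAz z v
  rw [hz, sub_self, LinearMap.zero_apply] at h1
  rw [← Submodule.Quotient.mk_eq_zero]
  exact h1.symm

/-- The functional l sends v to the function x ↦ l(π(x)v) in a principal series. This map is
injective by irreducibility, and for v fixed by the congruence subgroup the function is determined
on finitely many representatives in GL(2, O). -/
theorem finiteDimensional_of_jacquetKer_ne_top (hirr : π.IsIrreducible) (hπ : IsSmooth π)
    (hJ : jacquetKer π ≠ ⊤) (n : ℕ) : FiniteDimensional ℂ (fixedBy π (congSub F n : Set (G F))) := by
  obtain ⟨M, hM⟩ := exists_maximal_isBorelSub hirr hπ hJ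
  obtain ⟨l, hl0, hl⟩ := M.exists_le_ker_of_lt_top (lt_top_iff_ne_top.2 hM.prop.ne_top)
  choose χ hχ using exists_torus_character hirr hπ hM
  have hlT : ∀ s t v, l (π (diagG s t) v) = χ s t * l v := by
    intro s t v
    have := hl (hχ s t v)
    rwa [LinearMap.mem_ker, map_sub, map_smul, sub_eq_zero, smul_eq_mul] at this
  have hlU : ∀ u v, l (π (upU u) v) = l v := by
    intro u v
    have := hl (hM.prop.le (Submodule.subset_span ⟨u, v, rfl⟩))
    rwa [LinearMap.mem_ker, map_sub, sub_eq_zero] at this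
  obtain ⟨R, hR, hcov⟩ : ∃ R : Finset (G F), (∀ r ∈ R, r ∈ congSub F 0) ∧
      ∀ k ∈ congSub F 0, ∃ r ∈ R, r⁻¹ * k ∈ congSub F n := by
    obtain ⟨R, hR, hcov⟩ := (isCompact_congSub (F := F) 0).elim_nhds_subcover
      (fun r : G F => (fun x : G F => r⁻¹ * x) ⁻¹' (congSub F n : Set (G F)))
      (fun r _ => ((isOpen_congSub n).preimage (continuous_const_mul _)).mem_nhds (by simp))
    refine ⟨R, hR, fun k hk => ?_⟩
    obtain ⟨r, hr, h⟩ := Set.mem_iUnion₂.1 (hcov hk)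
    exact ⟨r, hr, h⟩
  set Φ : fixedBy π (congSub F n : Set (G F)) →ₗ[ℂ] (R → ℂ) :=
    LinearMap.pi fun r => l ∘ₗ π (r : G F) ∘ₗ (fixedBy π (congSub F n : Set (G F))).subtype with hΦ
  refine FiniteDimensional.of_injective Φ ?_
  rw [injective_iff_map_eq_zero]
  rintro ⟨v, hv⟩ h0
  have h1 : ∀ r ∈ R, l (π r v) = 0 := fun r hr => congrFun h0 ⟨r, hr⟩
  have h2 : ∀ x, l (π x v) = 0 := by
    intro x
    obtain ⟨u, s, t, k, hk, rfl⟩ := iwasawa_decomposition x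
    obtain ⟨r, hr, hrk⟩ := hcov k hk
    have : k = r * (r⁻¹ * k) := by group
    rw [apply_mul_apply, apply_mul_apply, hlU, hlT, this, apply_mul_apply, hv _ hrk, h1 r hr, mul_zero]
  set N : Submodule ℂ V := ⨅ x : G F, LinearMap.ker (l ∘ₗ π x) with hN
  have hmem : ∀ v, v ∈ N ↔ ∀ x, l (π x v) = 0 := fun v => by
    rw [hN, Submodule.mem_iInf]; rfl
  have hbot : N = ⊥ := by
    refine (eq_bot_or_eq_top_of_stable hirr N fun x v hv => ?_).resolve_right fun h => hl0 ?_
    · rw [hmem] at hv ⊢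
      intro y
      rw [← apply_mul_apply]
      exact hv _
    · ext v
      have : v ∈ N := by rw [h]; trivial
      have := (hmem v).1 this 1
      rwa [map_one] at this
  have : v ∈ N := (hmem v).2 h2
  rw [hbot, Submodule.mem_bot] at this
  exact Subtype.ext this

/-- Irreducible smooth representations are admissible. -/
theorem isAdmissible_of_isIrreducible (hirr : π.IsIrreducible) (hπ : IsSmooth π) :
    IsAdmissible π := fun n => by
  by_cases hJ : jacquetKer π = ⊤
  · exact finiteDimensional_of_jacquetKer_eq_top hirr hπ hJ n
  · exact finiteDimensional_of_jacquetKer_ne_top hirr hπ hJ n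

end Principal

end GLTwo

namespace GLTwo

/-! ### The depth is an attained half-integer. -/

section Depth

variable {F : Type*} [Field F] [ValuativeRel F] [TopologicalSpace F] [IsNonarchimedeanLocalField F]
  {V : Type*} [AddCommGroup V] [Module ℂ V] {π : Representation ℂ (G F) V}

/-- With n = ⌊2ρ⌋ one has ρ < (n + 1)/2, so g_{x,ρ+} contains a conjugate of `stdLat F n`, and a
translate of v is fixed by the corresponding group at depth n/2. -/
theorem exists_fixed_half_integral {ρ : ℝ} {x : Building F} {v : V} (hv : v ≠ 0)
    (hx : ∀ γ ∈ grpPlus x ρ, π γ v = v) : ∃ (y : Building F) (w : V), w ≠ 0 ∧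
      ∀ γ ∈ grpPlus y ((⌊2 * ρ⌋ : ℝ) / 2), π γ w = w := by
  set n := ⌊2 * ρ⌋
  have hn : 2 * ρ < n + 1 := Int.lt_floor_add_one _
  obtain ⟨k, hk⟩ := exists_stdLat_subset_lat x n
  obtain ⟨y, hy⟩ := exists_latPlus_eq_stdLat (F := F) n
  refine ⟨y, π k⁻¹ v, fun h0 => hv ?_, fun γ hγ => ?_⟩
  · have := congrArg (π k) h0
    rwa [← apply_mul_apply, mul_inv_cancel, map_one, map_zero] at this
  · have h1 : π (k * γ * k⁻¹) v = v := by
      refine hx _ ?_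
      rw [grpPlus, Set.mem_ofPred_eq, coe_conj_sub_one]
      refine lat_subset_latPlus x (by linarith : ρ < ((n : ℝ) + 1) / 2) (hk _ ?_)
      rw [← SetLike.mem_coe, ← hy]
      exact hγ
    rw [← apply_mul_apply]
    nth_rw 2 [← h1]
    rw [← apply_mul_apply]
    congr 2
    group

/-- Rounding down to half-integers makes the infimum one over a discrete set, which smoothness shows
to be nonempty. -/
theorem exists_depth_eq (hirr : π.IsIrreducible) (hπ : IsSmooth π) :
    ∃ n : ℕ, depth π = (n : ℝ) / 2 ∧ ∃ (x : Building F) (v : V), v ≠ 0 ∧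
      ∀ γ ∈ grpPlus x ((n : ℝ) / 2), π γ v = v := by
  classical
  have := nontrivial_of_isIrreducible hirr
  set P : ℝ → Prop := fun ρ => ∃ (x : Building F) (v : V), v ≠ 0 ∧ ∀ γ ∈ grpPlus x ρ, π γ v = v
  have hP : ∀ ρ, 0 ≤ ρ → P ρ → ∃ n : ℕ, P ((n : ℝ) / 2) ∧ (n : ℝ) / 2 ≤ ρ := by
    rintro ρ h0 ⟨x, v, hv, hx⟩
    have h1 : 0 ≤ ⌊2 * ρ⌋ := Int.floor_nonneg.2 (by linarith)
    obtain ⟨n, hn⟩ := Int.eq_ofNat_of_zero_le h1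
    have h2 := exists_fixed_half_integral hv hx
    have h3 := Int.floor_le (2 * ρ)
    rw [hn] at h2 h3
    push_cast at h2 h3
    exact ⟨n, h2, by linarith⟩
  have hex : ∃ n : ℕ, P ((n : ℝ) / 2) := by
    obtain ⟨v, hv⟩ := exists_ne (0 : V)
    have hU := hπ v
    rw [Filter.Eventually, (isOpenEmbedding_sub_one F).isInducing.nhds_eq_comap, Filter.mem_comap] at hU
    obtain ⟨S, hS, hSU⟩ := hU
    obtain ⟨m, hm⟩ := mem_nhds_iff_ball.1 hS
    obtain ⟨n, hn, -⟩ := hP m.toNat (Nat.cast_nonneg _) ⟨vtx F, v, hv, fun γ hγ => by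
      rw [grpPlus, Set.mem_ofPred_eq, ← Int.cast_natCast, latPlus_vtx] at hγ
      refine hSU ?_
      have := hm _ (box_mono (by omega) (by omega) (by omega) hγ)
      simpa using this⟩
    exact ⟨n, hn⟩
  refine ⟨Nat.find hex, ?_, Nat.find_spec hex⟩
  refine IsLeast.csInf_eq ⟨⟨by positivity, Nat.find_spec hex⟩, ?_⟩
  rintro ρ ⟨h0, hρ⟩
  obtain ⟨n, hn, hle⟩ := hP ρ h0 hρ
  have : Nat.find hex ≤ n := Nat.find_min' hex hn
  have : (Nat.find hex : ℝ) ≤ n := by exact_mod_cast this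
  linarith

end Depth

/-! ### Multiplicative properties of the lattices. -/

section Lattices

variable {F : Type*} [Field F] [ValuativeRel F] [TopologicalSpace F] [IsNonarchimedeanLocalField F]

theorem smul_mem_lat {x : Building F} {s : ℝ} {a : F} {Y : g F} (ha : a ∈ pw F 0) (hY : Y ∈ lat x s) :
    a • Y ∈ lat x s := by
  obtain ⟨h, t, rfl⟩ := exists_pt x
  rw [mem_lat_pt] at hY ⊢
  intro i j
  rw [Ad_smul, Matrix.smul_apply, smul_eq_mul]
  exact mul_mem_pw' ha (hY i j)

theorem one_mem_lat_zero (x : Building F) : (1 : g F) ∈ lat x 0 := by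
  obtain ⟨h, t, rfl⟩ := exists_pt x
  rw [mem_lat_pt]
  intro i j
  have : Ad h⁻¹ (1 : g F) = 1 := by
    rw [Ad_eq_iff, one_mul, mul_one]
  rw [this, Matrix.one_apply]
  split_ifs with hij
  · rw [hij]; simpa using one_mem_pw
  · exact zero_mem _

theorem lat_subset_gPlus_zero {x : Building F} {s : ℝ} (hs : 0 < s) : lat x s ⊆ gPlus F 0 :=
  fun _ hY => Set.mem_iUnion.2 ⟨x, lat_subset_latPlus x hs hY⟩

theorem inv_sub_one_mem_lat {x : Building F} {s : ℝ} (hs : 0 < s) {k : G F}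
    (hk : (k : g F) - 1 ∈ lat x s) : ((k⁻¹ : G F) : g F) - 1 ∈ lat x s := by
  have hE := mem_gPlus_zero.1 (lat_subset_gPlus_zero hs hk)
  have hdet := det_one_add hE.1 hE.2
  rw [add_sub_cancel] at hdet
  have hk0 : (k : g F) ∈ lat x 0 := by
    have := (latGrp F x 0).add_mem (lat_anti x hs.le hk) (one_mem_lat_zero x)
    rwa [sub_add_cancel] at this
  have htr : (k : g F).trace ∈ pw F 0 := by
    have h1 : (k : g F).trace = ((k : g F) - 1).trace + (1 + 1) := by
      simp only [Matrix.trace_fin_two, Matrix.sub_apply, Matrix.one_apply_eq]; ring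
    rw [h1]
    exact add_mem (pw_anti (by omega) hE.1) (add_mem one_mem_pw one_mem_pw)
  -- By Cayley–Hamilton the inverse is a combination of 1 and k with integral coefficients, so it
  -- preserves the same norm lattice.
  have hinv : ((k⁻¹ : G F) : g F) = ((k : g F).det)⁻¹ • ((k : g F).trace • (1 : g F) - (k : g F)) := by
    rw [Matrix.coe_units_inv, Matrix.inv_def, Ring.inverse_eq_inv', Matrix.adjugate_fin_two]
    congr 1
    refine ext_g ?_ ?_ ?_ ?_ <;> simp [Matrix.trace_fin_two]
  have hk1 : ((k⁻¹ : G F) : g F) ∈ lat x 0 := by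
    rw [hinv]
    refine smul_mem_lat ?_ ((latGrp F x 0).sub_mem (smul_mem_lat htr (one_mem_lat_zero x)) hk0)
    have := inv_mem_pw (n := 0) (by simpa using hdet.2)
    simpa using this
  have e : ((k⁻¹ : G F) : g F) - 1 = -(((k⁻¹ : G F) : g F) * ((k : g F) - 1)) := by
    rw [mul_sub, Units.inv_mul, mul_one, neg_sub]
  rw [e]
  refine (latGrp F x s).neg_mem ?_
  have := mul_mem_lat hk1 hk
  rwa [zero_add] at this

end Lattices

/-! ### The local character expansion. -/

section Expansion

variable {F : Type*} [Field F] [ValuativeRel F] [TopologicalSpace F] [IsNonarchimedeanLocalField F]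
  {Λ : AddChar F Circle} [MeasurableSpace (g F)] [BorelSpace (g F)]

/-- Using the inverse character for one of the two transforms removes the sign from the inversion
formula. -/
theorem IsLevelOne.inv (hΛ : IsLevelOne Λ) : IsLevelOne Λ⁻¹ where
  trivial a ha := by rw [AddChar.inv_apply, hΛ.trivial _ (neg_mem ha)]
  nontrivial := by
    obtain ⟨a, ha, h⟩ := hΛ.nontrivial
    exact ⟨-a, neg_mem ha, by rwa [AddChar.inv_apply, neg_neg]⟩

theorem fourier_inv_char (dY : Measure (g F)) (f : g F → ℂ) (X : g F) :
    fourier dY Λ⁻¹ f X = fourier dY Λ f (-X) := by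
  simp only [fourier, AddChar.inv_apply, neg_mul, Matrix.trace_neg]

theorem fourier_inv_fourier (hΛ : IsLevelOne Λ) (dY : Measure (g F)) [dY.IsAddHaarMeasure]
    (f : schwartz (g F)) :
    fourierMap dY hΛ.inv (fourierMap dY hΛ f) = inversionConst dY 0 • f := by
  ext X
  rw [fourierMap_apply, fourier_inv_char, ← fourierMap_apply dY hΛ, fourier_inversion, neg_neg]
  rfl

theorem fourierMap_Ad (hΛ : IsLevelOne Λ) (dY : Measure (g F)) [dY.IsAddHaarMeasure] (x : G F)
    {f f' : schwartz (g F)} (h : ∀ X, (f' : g F → ℂ) X = (f : g F → ℂ) (Ad x X)) (X : g F) :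
    (fourierMap dY hΛ f' : g F → ℂ) X = (fourierMap dY hΛ f : g F → ℂ) (Ad x X) := by
  rw [fourierMap_apply, fourierMap_apply, fourier, fourier]
  nth_rw 2 [← map_Ad_addHaar dY x]
  rw [(measurableEmbedding_Ad x).integral_map]
  simp only [h, trace_Ad_mul]

variable [MeasurableSpace (G F)] [BorelSpace (G F)] (dY : Measure (g F)) [dY.IsAddHaarMeasure]
  (dγ : Measure (G F)) [dγ.IsHaarMeasure]
  {V : Type*} [AddCommGroup V] [Module ℂ V] {π : Representation ℂ (G F) V}

/-- The Fourier transform of the character near the identity, transported to the Lie algebra. -/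
noncomputable def charFourier (hΛ : IsLevelOne Λ) (hπ : IsSmooth π) (hadm : IsAdmissible π) :
    Module.Dual ℂ (schwartz (g F)) where
  toFun f := charDist π dγ (toG (fourierMap dY hΛ f))
  map_add' f f' := by rw [map_add, map_add, charDist_add dγ hπ hadm]
  map_smul' c f := by rw [map_smul, map_smul, charDist_smul dγ hπ hadm]; rfl

theorem charFourier_apply (hΛ : IsLevelOne Λ) (hπ : IsSmooth π) (hadm : IsAdmissible π)
    (f : schwartz (g F)) :
    charFourier dY dγ hΛ hπ hadm f = charDist π dγ (toG (fourierMap dY hΛ f)) := rfl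

open Classical in
theorem toG_fourier_cosetInd (hΛ : IsLevelOne Λ) {x : Building F} {r : ℝ} (hr : r < 0) (c : g F)
    (γ : G F) : (toG (fourierMap dY hΛ (cosetInd c (latPlusGrp F x r))) : G F → ℂ) γ =
      if (γ : g F) - 1 ∈ lat x (-r) then
        (Λ (((γ : g F) - 1) * c).trace : ℂ) * dY.real (latPlus x r) else 0 := by
  rw [toG_apply, Set.indicator_apply, fourierMap_apply, fourier_cosetInd dY (isLat_latPlusGrp x r),
    perp_latPlusGrp hΛ]
  by_cases h : (γ : g F) - 1 ∈ lat x (-r)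
  · rw [if_pos (lat_subset_gPlus_zero (by linarith) h), if_pos h,
      if_pos (show (γ : g F) - 1 ∈ latGrp F x (-r) from h)]
    rfl
  · rw [if_neg h, if_neg (show ¬(γ : g F) - 1 ∈ latGrp F x (-r) from h), mul_zero, ite_self]

/-- The group law differs from addition by (γ - 1)(k - 1), whose product with c lies in g_{x,-r}. As
-r > 0, its trace is in P and Λ does not see it. -/
theorem toG_fourier_cosetInd_mul (hΛ : IsLevelOne Λ) {x : Building F} {r s : ℝ} (hr : r < 0)
    (hs : s ≤ r) {c : g F} (hc : c ∈ lat x s) {k : G F} (hk : (k : g F) - 1 ∈ lat x (-s)) (γ : G F) :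
    (toG (fourierMap dY hΛ (cosetInd c (latPlusGrp F x r))) : G F → ℂ) (γ * k) =
      (Λ (((k : g F) - 1) * c).trace : ℂ) *
        (toG (fourierMap dY hΛ (cosetInd c (latPlusGrp F x r))) : G F → ℂ) γ := by
  have hmul : ∀ (γ k : G F), (k : g F) - 1 ∈ lat x (-s) → (γ : g F) - 1 ∈ lat x (-r) →
      ((γ * k : G F) : g F) - 1 ∈ lat x (-r) := by
    intro γ k hk hγ
    have e : ((γ * k : G F) : g F) - 1 =
        ((γ : g F) - 1) * ((k : g F) - 1) + ((γ : g F) - 1) + ((k : g F) - 1) := by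
      rw [Units.val_mul]; noncomm_ring
    rw [e]
    refine (latGrp F x (-r)).add_mem ((latGrp F x (-r)).add_mem ?_ hγ) (lat_anti x (by linarith) hk)
    exact lat_anti x (by linarith) (mul_mem_lat hγ hk)
  have hiff : ((γ * k : G F) : g F) - 1 ∈ lat x (-r) ↔ (γ : g F) - 1 ∈ lat x (-r) := by
    refine ⟨fun h => ?_, hmul γ k hk⟩
    have := hmul (γ * k) k⁻¹ (inv_sub_one_mem_lat (by linarith) hk) h
    rwa [mul_inv_cancel_right] at this
  rw [toG_fourier_cosetInd dY hΛ hr, toG_fourier_cosetInd dY hΛ hr]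
  by_cases h : (γ : g F) - 1 ∈ lat x (-r)
  · rw [if_pos (hiff.2 h), if_pos h]
    have e : (((γ * k : G F) : g F) - 1) * c = ((γ : g F) - 1) * ((k : g F) - 1) * c +
        (((k : g F) - 1) * c + ((γ : g F) - 1) * c) := by
      rw [Units.val_mul]; noncomm_ring
    have h1 : (((γ : g F) - 1) * ((k : g F) - 1) * c).trace ∈ pw F 1 := by
      have h2 := mul_mem_lat (mul_mem_lat h hk) hc
      exact (mem_gPlus_zero.1 (lat_subset_gPlus_zero (by linarith) h2)).1
    rw [e, Matrix.trace_add, Matrix.trace_add, AddChar.map_add_eq_mul, AddChar.map_add_eq_mul,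
      hΛ.trivial _ h1, one_mul, Circle.coe_mul]
    ring
  · rw [if_neg (fun h' => h (hiff.1 h')), if_neg h, mul_zero]

/-- A nonzero operator is nonzero on some π(k)v, which is fixed at depth ρ for the translated point.
Elements both fixing this vector and acting through Λ(tr(Zc)) force that character to be trivial.
Duality writes c as a sum from g_{x,s+} and g_{ky,-ρ}, and the second summand lies in g_{s+} because
s < -ρ. -/
theorem mem_gPlus_of_heckeOperator_ne_zero (hΛ : IsLevelOne Λ) (hirr : π.IsIrreducible)
    (hπ : IsSmooth π) {ρ r s : ℝ} (hρ : 0 ≤ ρ) (hrρ : r < -ρ) (hs : s ≤ r) {x y : Building F} {v : V}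
    (hv : v ≠ 0) (hfix : ∀ γ ∈ grpPlus y ρ, π γ v = v) {c : g F} (hc : c ∈ lat x s)
    (hne : heckeOperator π dγ
      (toG (fourierMap dY hΛ (cosetInd c (latPlusGrp F x r))) : G F → ℂ) ≠ 0) : c ∈ gPlus F s := by
  set φ := toG (fourierMap dY hΛ (cosetInd c (latPlusGrp F x r))) with hφ
  have hr : r < 0 := by linarith
  obtain ⟨k, hk⟩ : ∃ k, heckeOperator π dγ (φ : G F → ℂ) (π k v) ≠ 0 := by
    by_contra! hn
    refine hne ?_
    have : (⊤ : Submodule ℂ V) ≤ LinearMap.ker (heckeOperator π dγ (φ : G F → ℂ)) := by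
      rw [← span_orbit_eq_top hirr hv, Submodule.span_le]
      rintro _ ⟨k, rfl⟩
      exact hn k
    exact LinearMap.ker_eq_top.1 (top_le_iff.1 this)
  obtain ⟨h, t, rfl⟩ := exists_pt y
  have hfix' : ∀ γ ∈ grpPlus (pt (k * h) t) ρ, π γ (π k v) = π k v := by
    intro γ hγ
    have h1 : k⁻¹ * γ * k ∈ grpPlus (pt h t) ρ := by
      have h2 := coe_conj_sub_one k⁻¹ γ
      rw [inv_inv] at h2
      rw [grpPlus, Set.mem_ofPred_eq, h2, ← Ad_mem_latPlus_pt (k := k), Ad_Ad_inv]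
      exact hγ
    have h3 := congrArg (π k) (hfix _ h1)
    rwa [← apply_mul_apply, show k * (k⁻¹ * γ * k) = γ * k by group, apply_mul_apply] at h3
  obtain ⟨a, ha, b, hb, hab⟩ := exists_add_eq_of_perp hΛ (X := c) (isLat_latPlusGrp x s)
    (isLat_latGrp (pt (k * h) t) (-ρ)) fun Z hZ hZ' => by
      rw [perp_latPlusGrp hΛ] at hZ
      rw [perp_latGrp hΛ, neg_neg] at hZ'
      have hZE : Z ∈ gPlus F 0 := lat_subset_gPlus_zero (by linarith) hZ
      have hcoe := coe_onePlus_of_mem hZE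
      have hsub : (onePlus Z : g F) - 1 = Z := by rw [hcoe, add_sub_cancel_left]
      have h1 := heckeOperator_right dγ hπ (onePlus Z) (f := (Λ (Z * c).trace : ℂ) • φ) (f' := φ)
        fun γ => by
          rw [hφ, toG_fourier_cosetInd_mul dY hΛ hr hs hc (by rw [hsub]; exact hZ), hsub]
          rfl
      have h2 := LinearMap.congr_fun h1 (π k v)
      rw [LinearMap.comp_apply, hfix' (onePlus Z) (by
        rw [grpPlus, Set.mem_ofPred_eq, hsub]; exact hZ'), heckeOperator_smul dγ hπ,
        LinearMap.smul_apply] at h2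
      have h3 : ((Λ (Z * c).trace : ℂ) - 1) • heckeOperator π dγ (φ : G F → ℂ) (π k v) = 0 := by
        rw [sub_smul, one_smul, ← h2, sub_self]
      have h4 := (smul_eq_zero.1 h3).resolve_right hk
      rw [Matrix.trace_mul_comm]
      ext
      rw [sub_eq_zero.1 h4, Circle.coe_one]
  refine mem_gPlus_of_sub_mem (x := x) hc (X' := b) ?_ ?_
  · exact Set.mem_iUnion.2 ⟨pt (k * h) t, lat_subset_latPlus (s' := -ρ) _ (by linarith) hb⟩
  · rw [← hab, add_sub_cancel_right]; exact ha

theorem charFourier_mem_JTilde (hΛ : IsLevelOne Λ) (hirr : π.IsIrreducible) (hπ : IsSmooth π)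
    (hadm : IsAdmissible π) {ρ r : ℝ} (hρ : 0 ≤ ρ) (hrρ : r < -ρ) {y : Building F} {v : V}
    (hv : v ≠ 0) (hfix : ∀ γ ∈ grpPlus y ρ, π γ v = v) :
    charFourier dY dγ hΛ hπ hadm ∈ JTilde F r := by
  rw [mem_JTilde_iff]
  refine ⟨fun x f f' h => ?_, fun x s hs f hf hdis => ?_⟩
  · rw [charFourier_apply, charFourier_apply]
    exact charDist_conj dγ hπ hadm x (toG_conj x (fourierMap_Ad hΛ dY x h))
  · obtain ⟨R, hR0, hR⟩ := exists_sum_cosetInd (isLat_latPlusGrp x r) hf.1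
    rw [hR, map_sum]
    refine Finset.sum_eq_zero fun c hc => ?_
    rw [map_smul, charFourier_apply, charDist]
    by_cases hne : heckeOperator π dγ
        (toG (fourierMap dY hΛ (cosetInd c (latPlusGrp F x r))) : G F → ℂ) = 0
    · rw [hne, finiteRankTrace_zero, smul_zero]
    · have hmem := mem_gPlus_of_heckeOperator_ne_zero dY dγ hΛ hirr hπ hρ hrρ hs hv hfix
        (hf.2 (hR0 c hc)) hne
      exact absurd (hR0 c hc) (Set.disjoint_left.1 hdis hmem)

/-- The lattice contains a conjugate of `stdLat F n`, which is g_{y,(n/2)+} for a translate y of a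
standard point. -/
theorem mem_DPlus_of_transInv {x : Building F} {n : ℤ} {f : schwartz (g F)}
    (hf : f ∈ transInv (lat x ((n + 1) / 2))) : f ∈ DPlus F (n / 2) := by
  obtain ⟨k, hk⟩ := exists_stdLat_subset_lat x n
  obtain ⟨y, hy⟩ := exists_latPlus_eq_stdLat (F := F) n
  obtain ⟨h, t, rfl⟩ := exists_pt y
  refine Submodule.mem_iSup_of_mem (pt (k * h) t) fun X Y hY => hf X Y ?_
  rw [← Ad_Ad_inv k Y, Ad_mem_latPlus_pt, hy] at hY
  have := hk _ hY
  rwa [Ad_Ad_inv] at this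

theorem exists_local_expansion (hΛ : IsLevelOne Λ) (hirr : π.IsIrreducible) (hπ : IsSmooth π)
    {μ₀ μ₁ : Measure (g F)} (h₀ : IsOrbitalMeasure (orbZero F) μ₀)
    (h₁ : IsOrbitalMeasure (orbReg F) μ₁) : ∃ a b : ℂ, ∀ X ∈ gPlus F (depth π), X ∈ gPlus F 0 ∧
      ∃ U ∈ 𝓝 X, ∀ h : schwartz (g F), Function.support (h : g F → ℂ) ⊆ U →
        charDist π dγ (toG h) = a * fourierDist dY Λ μ₀ h + b * fourierDist dY Λ μ₁ h := by
  have hadm := isAdmissible_of_isIrreducible hirr hπ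
  obtain ⟨n, hn, y, v, hv, hfix⟩ := exists_depth_eq hirr hπ
  -- -(n + 1)/2 is the largest half-integer below minus the depth n/2. Transforms of functions
  -- supported in g_{x,(n/2)+} are invariant under g_{x,-n/2}, which is just what
  -- `mem_DPlus_of_transInv` requires.
  have hT : charFourier dY dγ hΛ.inv hπ hadm ∈ JTilde F ((-(n + 1) : ℤ) / 2) :=
    charFourier_mem_JTilde dY dγ hΛ.inv hirr hπ hadm (ρ := n / 2) (by positivity)
      (by push_cast; linarith) hv hfix
  obtain ⟨a, b, hab⟩ := exists_nilpotent_expansion hT h₀ h₁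
  have hC := inversionConst_ne_zero dY 0
  refine ⟨a / inversionConst dY 0, b / inversionConst dY 0, fun X hX => ?_⟩
  rw [hn] at hX
  obtain ⟨x, hx⟩ := Set.mem_iUnion.1 hX
  refine ⟨Set.mem_iUnion.2 ⟨x, latPlus_anti x (by positivity) hx⟩, latPlus x (n / 2),
    (isOpen_latPlus x _).mem_nhds hx, fun h hh => ?_⟩
  have hD : fourierMap dY hΛ h ∈ DPlus F ((-(n + 1) : ℤ) / 2) := by
    refine mem_DPlus_of_transInv (x := x) fun X Y hY => ?_
    refine fourier_add_of_mem_perp dY (L := latPlusGrp F x (n / 2)) hh ?_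
    rw [perp_latPlusGrp hΛ]
    have e : ((((-(n + 1) : ℤ) : ℝ)) + 1) / 2 = -((n : ℝ) / 2) := by push_cast; ring
    rw [e] at hY
    exact hY
  have h1 := hab _ hD
  rw [charFourier_apply, fourier_inv_fourier, map_smul, charDist_smul dγ hπ hadm] at h1
  change _ = a * fourierDist dY Λ μ₀ h + b * fourierDist dY Λ μ₁ h at h1
  field_simp
  rw [← h1]
  ring

theorem exists_test_function (X : g F) : ∀ U ∈ 𝓝 X, ∃ f : schwartz (g F),
    Function.support (f : g F → ℂ) ⊆ U ∧ ∫ z, (f : g F → ℂ) z ∂dY ≠ 0 := by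
  intro U hU
  obtain ⟨n, hn⟩ := mem_nhds_iff_ball.1 hU
  refine ⟨cosetInd X (box F n n n), fun Y hY => ?_, integral_ind_ne_zero dY
    (isCompact_coset (isLat_box n n n) X) (isOpen_coset (isLat_box n n n) X)
    (show X - X ∈ box F n n n by simp)⟩
  have := hn _ ((cosetInd_apply_ne_zero (isLat_box n n n)).1 hY)
  rwa [add_sub_cancel] at this

theorem exists_test_function_group (γ : G F) : ∀ U ∈ 𝓝 γ, ∃ f : schwartz (G F),
    Function.support (f : G F → ℂ) ⊆ U ∧ ∫ z, (f : G F → ℂ) z ∂dγ ≠ 0 := by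
  intro U hU
  have hU' : (fun x => γ * x) ⁻¹' U ∈ 𝓝 (1 : G F) :=
    (continuous_const_mul γ).continuousAt.preimage_mem_nhds (by rwa [mul_one])
  obtain ⟨n, hn⟩ := exists_congSub_subset hU'
  have hK : IsCompact ((fun x => γ⁻¹ * x) ⁻¹' (congSub F n : Set (G F))) :=
    (Homeomorph.mulLeft γ⁻¹).isCompact_preimage.2 (isCompact_congSub n)
  have hO : IsOpen ((fun x => γ⁻¹ * x) ⁻¹' (congSub F n : Set (G F))) :=
    (isOpen_congSub n).preimage (continuous_const_mul _)
  refine ⟨ind _, fun x hx => ?_, integral_ind_ne_zero dγ hK hO (a := γ) (by simp)⟩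
  rw [coe_ind hO hK] at hx
  have h1 : x ∈ (fun x => γ⁻¹ * x) ⁻¹' (congSub F n : Set (G F)) := Set.mem_of_indicator_ne_zero hx
  have := hn h1
  rwa [Set.mem_preimage, mul_inv_cancel_left] at this

/-- The character expansion near a regular semisimple element of positive depth. -/
theorem exists_character_expansion (hΛ : IsLevelOne Λ) {μ : NilOrbit F → Measure (g F)}
    (hμ : ∀ O, IsOrbitalMeasure O (μ O)) (hirr : π.IsIrreducible) (hπ : IsSmooth π) :
    ∃ c : NilOrbit F → ℂ, ∀ X ∈ gPlus F (depth π), IsRegSemisimple X →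
      ∃ γ : G F, (γ : g F) = 1 + X ∧ (∃ z, HasValueAt dγ (charDist π dγ) γ z) ∧
        character π dγ γ = ∑ᶠ O, c O * fourierFun dY Λ (μ O) X := by
  classical
  obtain ⟨a, b, hab⟩ := exists_local_expansion dY dγ hΛ hirr hπ (hμ (orbZero F)) (hμ (orbReg F))
  have hratio : (haarRatio dY dγ : ℂ) ≠ 0 := Complex.ofReal_ne_zero.2 (haarRatio_pos dY dγ).ne'
  -- The character is a density for dγ and the orbital transforms are densities for dY; hence the
  -- division by the ratio of the measures.
  refine ⟨fun O => (if O = orbZero F then a else b) / haarRatio dY dγ, fun X hX hreg => ?_⟩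
  obtain ⟨hX0, U, hU, hUab⟩ := hab X hX
  obtain ⟨m₀, hm₀⟩ := exists_hasValueAt_fourierDist hΛ dY (hμ (orbZero F)) hreg
  obtain ⟨m₁, hm₁⟩ := exists_hasValueAt_fourierDist hΛ dY (hμ (orbReg F)) hreg
  obtain ⟨U₀, hU₀, hT₀⟩ := id hm₀
  obtain ⟨U₁, hU₁, hT₁⟩ := id hm₁
  obtain ⟨U₂, hU₂, hU₂E, hint⟩ := exists_integral_toG dY dγ hX0
  have hcoe : (onePlus X : g F) = 1 + X := coe_onePlus_of_mem hX0
  have hval : HasValueAt dγ (charDist π dγ) (onePlus X) ((a * m₀ + b * m₁) / haarRatio dY dγ) := by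
    refine ⟨(fun γ : G F => (γ : g F) - 1) ⁻¹' ((U ∩ U₂) ∩ (U₀ ∩ U₁)), ?_, fun f hf => ?_⟩
    · refine (isOpenEmbedding_sub_one F).continuous.continuousAt.preimage_mem_nhds ?_
      rw [hcoe, add_sub_cancel_left]
      exact Filter.inter_mem (Filter.inter_mem hU hU₂) (Filter.inter_mem hU₀ hU₁)
    · obtain ⟨h, rfl, hh⟩ := exists_toG_eq f fun γ hγ => hU₂E (hf hγ).1.2
      have hsupp : Function.support (h : g F → ℂ) ⊆ (U ∩ U₂) ∩ (U₀ ∩ U₁) := by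
        intro Y hY
        obtain ⟨γ, rfl, hγ⟩ := hh Y hY
        exact hf hγ
      rw [hUab h fun Y hY => (hsupp hY).1.1, hT₀ h fun Y hY => (hsupp hY).2.1,
        hT₁ h fun Y hY => (hsupp hY).2.2, hint h fun Y hY => (hsupp hY).1.2]
      field_simp
  refine ⟨onePlus X, hcoe, ⟨_, hval⟩, ?_⟩
  rw [character, hval.valueAt_eq (exists_test_function_group dγ _)]
  rw [finsum_eq_finsetSum_of_support_subset (s := {orbZero F, orbReg F}) _ (fun O _ => by
    rcases nilOrbit_eq O with rfl | rfl <;> simp), Finset.sum_pair orbZero_ne_orbReg]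
  dsimp only
  rw [if_pos rfl, if_neg orbZero_ne_orbReg.symm, fourierFun, fourierFun,
    hm₀.valueAt_eq (exists_test_function dY X), hm₁.valueAt_eq (exists_test_function dY X)]
  ring

end Expansion

end GLTwo
-- Assembly.
theorem mainTheorem2 (F : Type*) [Field F] [ValuativeRel F] [TopologicalSpace F]
    [IsNonarchimedeanLocalField F] :
    (∀ k : ℤ, (JTilde F (k / 2)).map (DPlus F (k / 2)).dualRestrict =
      (invDistOn F (nilCone F)).map (DPlus F (k / 2)).dualRestrict) ∧
    ∀ [MeasurableSpace (g F)] [BorelSpace (g F)] [MeasurableSpace (G F)] [BorelSpace (G F)]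
      (dY : Measure (g F)) [dY.IsAddHaarMeasure] (dγ : Measure (G F)) [dγ.IsHaarMeasure]
      (Λ : AddChar F Circle),
      (∀ a ∈ 𝓂[F], Λ a = 1) → (∃ a ∈ 𝒪[F], Λ a ≠ 1) →
      (∀ O : NilOrbit F, ∃ μ : Measure (g F), IsOrbitalMeasure O μ) ∧
      ∀ μ : NilOrbit F → Measure (g F), (∀ O, IsOrbitalMeasure O (μ O)) →
        (∀ O X, IsRegSemisimple X → ∃ c, HasValueAt dY (fourierDist dY Λ (μ O)) X c) ∧
        ∀ (V : Type*) [AddCommGroup V] [Module ℂ V] (π : Representation ℂ (G F) V),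
          π.IsIrreducible → IsSmooth π →
          ∃ c : NilOrbit F → ℂ, ∀ X ∈ gPlus F (depth π), IsRegSemisimple X →
            ∃ γ : G F, (γ : g F) = 1 + X ∧
              (∃ z, HasValueAt dγ (charDist π dγ) γ z) ∧
              character π dγ γ = ∑ᶠ O, c O * fourierFun dY Λ (μ O) X := by
  refine ⟨map_JTilde_eq, ?_⟩
  intro _ _ _ _ dY _ dγ _ Λ h1 h2
  have hΛ : IsLevelOne Λ := by
    refine ⟨fun a ha => ?_, ?_⟩
    · obtain ⟨ha', hm⟩ := mem_maximalIdeal_iff ha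
      exact h1 ⟨a, ha'⟩ hm
    · obtain ⟨a, ha, hne⟩ := h2
      exact ⟨a, mem_pw_zero_iff.2 ha, hne⟩
  refine ⟨exists_isOrbitalMeasure, fun μ hμ => ⟨fun O X hX => ?_, fun V _ _ π hirr hπ => ?_⟩⟩
  · exact exists_hasValueAt_fourierDist hΛ dY (hμ O) hX
  · exact exists_character_expansion dY dγ hΛ hμ hirr hπ
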